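/- **Setting.** Let $P\subset\mathbb C$ be finite. A *meromorphic integrable bundle* $\mathcal M$ on $\mathbb P^1$ with poles in $P\cup\{\infty\}$ is identified with its module of global sections $M$: a left module over the Weyl algebra $\mathbb C[x]\langle\partial_x\rangle$ which is a module of finite type over $\mathbb C[x,\prod_{p\in P}(x-p)^{-1}]$. Write $t=x-p$ at a finite point $p$, $t=1/x$ at $\infty$, and $M_v=\mathbb C((t))\otimes_{\mathbb C[x]}M$ for the formal completion at $v$. We assume that the singularities are of the following resonance-free type. * At each $p\in P$ there is a basis of $M_p$ in which $\partial_x=\frac{d}{dx}+\frac{\mathrm{diag}(\mu_1,\dots,\mu_r)}{x-p}+(\text{power series in }t)$, where each $\mu_k$ is $0$ or has $\mathrm{Re}\,\mu_k\notin\mathbb Z$, and $\mu_k-\mu_m\notin\mathbb Z\setminus\{0\}$. * At $\infty$ there is a basis of $M_\infty$ in which $\partial_x=\frac{d}{dx}+\mathrm{diag}(a_k)+\mathrm{diag}(c_k)/x+O(x^{-2})$, where $\mathrm{Re}\,c_k\notin\mathbb Z$, and $c_k-c_m\notin\mathbb Z\setminus\{0\}$ if $a_k=a_m$. Put $Q=\{a_k\}$.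 Let $\psi_p^\alpha M\subset M_p$ be the generalized eigenspace of $t\partial_t=(x-p)\partial_x$ for the eigenvalue $\alpha$, and $\psi_{\infty,\xi}^\alpha M\subset M_\infty$ that of $-x(\partial_x-\xi)$ (the residue at infinity of the part with exponential factor $\xi$, in the coordinate $1/x$). A *parabolic structure* consists of decreasing, left continuous, exhaustive filtrations $\psi^{\alpha,\beta}$ ($\beta\in\mathbb R$) of all the spaces $\psi_p^\alpha M$ ($p\in P$) and $\psi_{\infty,\xi}^\alpha M$, each with jumps in an interval $[k,k+1)$, $k\in\mathbb Z$ (depending on $\alpha$), such that $t^N\psi^{\alpha,\beta}=\psi^{\alpha+N,\beta+N}$ for $N\in\mathbb Z$. It is *admissible* if $\psi_p^0M$ has only the weight $0$, for $p\in P$. With $\mathrm{gr}^\beta=\psi^{\alpha,\beta}/\psi^{\alpha,>\beta}$, the *parabolic degree* is $$\mathrm{pardeg}\,\mathcal M=\sum_{\alpha}\sum_{\beta\in[0,1)}(\beta-\alpha)\Big(\sum_{p\in P}\dim\mathrm{gr}^\beta\psi_p^\alpha M+\sum_{\xi}\dim\mathrm{gr}^\beta\psi_{\infty,\xi}^\alpha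 M\Big),$$ and the *slope* is the parabolic degree divided by the rank (the sum of the $\alpha$'s is an integer, by the residue theorem). $\mathcal M$ is *parabolically stable* if it is non-zero and every integrable subbundle other than $0$ and $\mathcal M$, with the induced filtrations $\psi^{\alpha,\beta}N=\psi^\alpha N\cap\psi^{\alpha,\beta}M$, has strictly smaller slope. **Transform.** A *minimal extension* of $M$ is a $\mathbb C[x]\langle\partial_x\rangle$-module $M_{\min}$ whose localization at $\prod_{p\in P}(x-p)$ is $M$ and which has no non-zero submodule and no non-zero quotient supported at a point; such a module embeds into $M$. The *minimal Laplace transform* $\widehat{\mathcal M}$ is the localization at $\prod_{\eta\in Q}(\xi-\eta)$ of $M_{\min}$, regarded as a $\mathbb C[\xi]\langle\partial_\xi\rangle$-module via $\xi=\partial_x$, $\partial_\xi=-x$. Its parabolic structure is the following. For $\alpha\notin\mathbb Z$ the filtrations are transported by the formal stationary phase isomorphisms $$\psi_{\infty,\eta}^{\alpha}M\cong\psi_{\eta}^{\alpha}\widehat{M}\quad(\eta\in Q),\qquad \psi_{p}^{\alpha}M\cong\psi_{\infty,-p}^{\alpha}\widehat M\quad(p\in P);$$ for $\alpha\in\mathbb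 Z$ the only weight is $\alpha$. Here the isomorphisms are those that send, for every $m\in M_{\min}$, the $\psi_{\infty,\eta}^{\alpha+1}$-component of the formal expansion of $m$ to its $\psi_\eta^{\alpha}$-component as a section of $\widehat{\mathcal M}$, and the $\psi_p^{\alpha-1}$-component to the $\psi_{\infty,-p}^{\alpha}$-component, followed or preceded by multiplication by the local coordinate to equalize the eigenvalues. **Proposition 4.3 (stability preserved; Sabbah).** Let $\mathcal M$ be a meromorphic integrable bundle as above, with an admissible parabolic structure. If $\mathcal M$ is parabolically stable of parabolic degree $0$, then $M$ has a unique minimal extension inside $M$, and the parabolic minimal Laplace transform $\widehat{\mathcal M}$ is again a meromorphic integrable bundle with poles in $Q\cup\{\infty\}$, with singularities of the above type and an admissible parabolic structure, and it is parabolically stable of parabolic degree $0$. -/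

import Mathlib

open Polynomial
open scoped TensorProduct

universe u

noncomputable section

/-! ### Modules over the Weyl algebra -/

/-- A left module over the Weyl algebra `ℂ[x]⟨∂ₓ⟩`: a `ℂ[x]`-module with an operator `D = ∂ₓ`
satisfying the Leibniz rule. (For `f` constant the rule says that `D` is `ℂ`-linear, for `f = x`
it says `[∂ₓ, x] = 1`.) -/
structure WeylModule : Type (u + 1) where
  carrier : Type u
  [grp : AddCommGroup carrier]
  [mod : Module ℂ[X] carrier]
  D : carrier →+ carrier
  leibniz : ∀ (f : ℂ[X]) (m : carrier), D (f • m) = derivative f • m + f • D m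

namespace WeylModule

instance : CoeSort WeylModule.{u} (Type u) := ⟨WeylModule.carrier⟩

instance (M : WeylModule.{u}) : AddCommGroup M := M.grp

instance (M : WeylModule.{u}) : Module ℂ[X] M := M.mod

instance (M : WeylModule.{u}) : Module ℂ M := Module.compHom M (C : ℂ →+* ℂ[X])

theorem complex_smul_def (M : WeylModule.{u}) (c : ℂ) (m : M) : c • m = (C c : ℂ[X]) • m := rfl

/-- `∂ₓ` as a `ℂ`-linear endomorphism. -/
def dLin (M : WeylModule.{u}) : Module.End ℂ M where
  toFun := M.D
  map_add' := M.D.map_add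
  map_smul' c m := by
    simp [complex_smul_def, M.leibniz]

theorem aeval_dLin_X_smul (M : WeylModule.{u}) (f : ℂ[X]) (m : M) :
    aeval M.dLin f ((X : ℂ[X]) • m) =
      aeval M.dLin (derivative f) m + (X : ℂ[X]) • aeval M.dLin f m := by
  induction f using Polynomial.induction_on' with
  | add p q hp hq => simp only [map_add, LinearMap.add_apply, hp, hq, smul_add]; abel
  | monomial n a =>
    induction n generalizing a m with
    | zero =>
      simp only [Polynomial.monomial_zero_left, aeval_C, Module.algebraMap_end_apply,
        derivative_C, map_zero, LinearMap.zero_apply, zero_add, complex_smul_def, smul_smul]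
      rw [mul_comm]
    | succ n ih =>
      have h : (monomial (n + 1) a : ℂ[X]) = monomial n a * X := by
        simp [Polynomial.monomial_mul_X]
      have hD : M.dLin ((X : ℂ[X]) • m) = m + (X : ℂ[X]) • M.dLin m := by
        change M.D _ = _ + _ • M.D _
        simp [M.leibniz]
      simp only [h, map_mul, aeval_X, Module.End.mul_apply, hD, map_add, ih,
        Polynomial.derivative_mul, Polynomial.derivative_X, mul_one, LinearMap.add_apply]
      abel

/-- Multiplication by `x`. -/
def mulX (M : WeylModule.{u}) : M →+ M := DistribSMul.toAddMonoidHom M (X : ℂ[X])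

/-- The Laplace transform of a module over the Weyl algebra: the same space, on which the new
variable `ξ` acts as `∂ₓ` and `∂_ξ` acts as `-x`. -/
def laplace (M : WeylModule.{u}) : WeylModule.{u} where
  carrier := M.carrier
  grp := M.grp
  mod := Module.compHom M.carrier (aeval M.dLin : ℂ[X] →ₐ[ℂ] Module.End ℂ M).toRingHom
  D := -M.mulX
  leibniz f m := by
    change -((X : ℂ[X]) • aeval M.dLin f m) =
      aeval M.dLin (derivative f) m + aeval M.dLin f (-((X : ℂ[X]) • m))
    rw [map_neg, aeval_dLin_X_smul]
    abel

/-- The identity of the underlying spaces. -/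
def toLaplace (M : WeylModule.{u}) : M → M.laplace := fun m => m

/-- The localization of `M` at the powers of a polynomial `g`, with
`∂ₓ (m / s) = (s ∂ₓ m - s' m) / s²`. -/
def localize (M : WeylModule.{u}) (g : ℂ[X]) : WeylModule.{u} where
  carrier := LocalizedModule (Submonoid.powers g) M
  D :=
    { toFun := fun z => z.liftOn
        (fun q => LocalizedModule.mk
          ((q.2 : ℂ[X]) • M.D q.1 - derivative (q.2 : ℂ[X]) • q.1) (q.2 * q.2)) (by
          rintro ⟨m, s⟩ ⟨m', s'⟩ ⟨c, h⟩
          rw [LocalizedModule.mk_eq]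
          refine ⟨c * c, ?_⟩
          simp only [Submonoid.smul_def, Submonoid.coe_mul] at h ⊢
          have h' := congrArg M.D h
          simp only [M.leibniz] at h'
          linear_combination (norm := module) ((c : ℂ[X]) * s * s') • h'
            - ((s : ℂ[X]) * s' * derivative (c : ℂ[X])
              + (c : ℂ[X]) * s' * derivative (s : ℂ[X])
              + (c : ℂ[X]) * s * derivative (s' : ℂ[X])) • h)
      map_zero' := by
        rw [← LocalizedModule.zero_mk (1 : Submonoid.powers g), LocalizedModule.liftOn_mk]
        simp
      map_add' := fun z w => by
        induction z using LocalizedModule.induction_on with | _ m s => _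
        induction w using LocalizedModule.induction_on with | _ m' s' => _
        simp only [LocalizedModule.mk_add_mk, LocalizedModule.liftOn_mk]
        rw [LocalizedModule.mk_eq]
        refine ⟨1, ?_⟩
        simp only [Submonoid.smul_def, Submonoid.coe_mul, Submonoid.coe_one, map_add, M.leibniz,
          Polynomial.derivative_mul]
        module }
  leibniz f z := by
    induction z using LocalizedModule.induction_on with | _ m s => _
    simp only [AddMonoidHom.coe_mk, ZeroHom.coe_mk, LocalizedModule.smul'_mk,
      LocalizedModule.mk_add_mk, LocalizedModule.liftOn_mk]
    rw [LocalizedModule.mk_eq]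
    refine ⟨1, ?_⟩
    simp only [Submonoid.smul_def, Submonoid.coe_mul, Submonoid.coe_one, M.leibniz]
    module

/-- The canonical map `m ↦ m / 1` into the localization. -/
def toLocalize (M : WeylModule.{u}) (g : ℂ[X]) : M → M.localize g :=
  fun m => (LocalizedModule.mk m 1 : LocalizedModule (Submonoid.powers g) M)

/-- A submodule over the Weyl algebra. -/
structure Sub (M : WeylModule.{u}) where
  toSubmodule : Submodule ℂ[X] M
  D_mem : ∀ m ∈ toSubmodule, M.D m ∈ toSubmodule

/-- A submodule over the Weyl algebra, as a module over the Weyl algebra. -/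
def Sub.toWeyl {M : WeylModule.{u}} (N : M.Sub) : WeylModule.{u} where
  carrier := N.toSubmodule
  D :=
    { toFun := fun m => ⟨M.D m, N.D_mem m m.2⟩
      map_zero' := by ext; simp
      map_add' := fun m m' => by ext; simp }
  leibniz f m := by ext; simp [M.leibniz]

/-- The inclusion of a submodule. -/
def Sub.incl {M : WeylModule.{u}} (N : M.Sub) : N.toWeyl →ₗ[ℂ[X]] M := N.toSubmodule.subtype

end WeylModule

/-! ### The formal completions of `ℂ(x)` at the points of the projective line -/

/-- A point of the projective line. -/
inductive Place : Type
  | fin (p : ℂ) : Place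
  | infty : Place

/-- `t d/dt` on formal Laurent series in `t`. -/
def laurentEuler : LaurentSeries ℂ →+ LaurentSeries ℂ where
  toFun g :=
    { coeff := fun n => (n : ℂ) * g.coeff n
      isPWO_support' := g.isPWO_support.mono fun n hn h => hn (by simp [h]) }
  map_zero' := by ext; simp
  map_add' g h := by ext; simp [mul_add]

@[simp]
theorem laurentEuler_coeff (g : LaurentSeries ℂ) (n : ℤ) :
    (laurentEuler g).coeff n = (n : ℂ) * g.coeff n := rfl

theorem laurentEuler_mul (g h : LaurentSeries ℂ) :
    laurentEuler (g * h) = laurentEuler g * h + g * laurentEuler h := by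
  have hg : (laurentEuler g).support ⊆ g.support := fun n hn h => hn (by simp [h])
  have hh : (laurentEuler h).support ⊆ h.support := fun n hn h => hn (by simp [h])
  ext n
  rw [HahnSeries.coeff_add, HahnSeries.coeff_mul_left' g.isPWO_support hg,
    HahnSeries.coeff_mul_right' h.isPWO_support hh, laurentEuler_coeff, HahnSeries.coeff_mul,
    Finset.mul_sum, ← Finset.sum_add_distrib]
  refine Finset.sum_congr rfl fun ij hij => ?_
  have : ij.1 + ij.2 = n := by simp_all
  simp only [laurentEuler_coeff, ← this]
  push_cast
  ring

/-- The completion of `ℂ(x)` at a place `v`: formal Laurent series in the local coordinate `t`,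
which is `x - p` at `p` and `1 / x` at infinity. -/
def LocalField (_v : Place) : Type := LaurentSeries ℂ

namespace LocalField

instance (v : Place) : Field (LocalField v) := inferInstanceAs (Field (LaurentSeries ℂ))

/-- The constant Laurent series. -/
def const (v : Place) : ℂ →+* LocalField v := (HahnSeries.C : ℂ →+* LaurentSeries ℂ)

instance (v : Place) : Algebra ℂ (LocalField v) := (const v).toAlgebra

/-- The local coordinate `t`. -/
def t (v : Place) : LocalField v := (HahnSeries.single 1 1 : LaurentSeries ℂ)

/-- The function `x` as a Laurent series in `t`. -/
def x : (v : Place) → LocalField v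
  | .fin p => algebraMap ℂ (LocalField (.fin p)) p + t (.fin p)
  | .infty => (t .infty)⁻¹

instance (v : Place) : Algebra ℂ[X] (LocalField v) :=
  (aeval (x v) : ℂ[X] →ₐ[ℂ] LocalField v).toRingHom.toAlgebra

theorem algebraMap_def (v : Place) (f : ℂ[X]) :
    algebraMap ℂ[X] (LocalField v) f = aeval (x v) f := rfl

instance (v : Place) : IsScalarTower ℂ ℂ[X] (LocalField v) :=
  IsScalarTower.of_algebraMap_eq fun c => by
    rw [algebraMap_def, Polynomial.algebraMap_eq, aeval_C]

/-- The derivation `t d/dt`. -/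
def euler (v : Place) : LocalField v →+ LocalField v := laurentEuler

theorem euler_mul (v : Place) (g h : LocalField v) :
    euler v (g * h) = euler v g * h + g * euler v h := laurentEuler_mul g h

/-- The function `e` such that `t d/dt = e d/dx`: it is `t` at a finite point and `-1 / t` at
infinity. -/
def eulerCoeff : (v : Place) → LocalField v
  | .fin p => t (.fin p)
  | .infty => -(t .infty)⁻¹

/-- The derivation `d/dx` of the completion. -/
def der (v : Place) : LocalField v →+ LocalField v :=
  (AddMonoidHom.mulLeft (eulerCoeff v)⁻¹).comp (euler v)

theorem der_mul (v : Place) (g h : LocalField v) :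
    der v (g * h) = der v g * h + g * der v h := by
  simp only [der, AddMonoidHom.comp_apply, AddMonoidHom.coe_mulLeft, euler_mul]
  ring

theorem t_ne_zero (v : Place) : t v ≠ 0 :=
  (HahnSeries.single_ne_zero one_ne_zero : (HahnSeries.single (1 : ℤ) (1 : ℂ)) ≠ 0)

theorem euler_algebraMap (v : Place) (c : ℂ) : euler v (algebraMap ℂ (LocalField v) c) = 0 := by
  change laurentEuler (HahnSeries.single 0 c) = 0
  ext n
  by_cases hn : n = 0
  · simp [hn]
  · simp [hn]

theorem euler_t (v : Place) : euler v (t v) = t v := by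
  change laurentEuler (HahnSeries.single 1 1) = HahnSeries.single 1 1
  ext n
  by_cases hn : n = 1
  · simp [hn]
  · simp [hn]

theorem der_algebraMap (v : Place) (c : ℂ) : der v (algebraMap ℂ (LocalField v) c) = 0 := by
  simp [der, euler_algebraMap]

theorem der_x (v : Place) : der v (x v) = 1 := by
  have ht := t_ne_zero v
  cases v with
  | fin p => simp [der, x, eulerCoeff, map_add, euler_algebraMap, euler_t, ht]
  | infty =>
    have h1 : euler .infty (1 : LocalField .infty) = 0 := by
      simpa using euler_algebraMap .infty 1
    have h2 := euler_mul .infty (t .infty) (t .infty)⁻¹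
    rw [mul_inv_cancel₀ ht, h1, euler_t, mul_inv_cancel₀ ht] at h2
    simp only [der, x, eulerCoeff, AddMonoidHom.comp_apply, AddMonoidHom.coe_mulLeft, inv_neg,
      inv_inv]
    linear_combination h2

theorem der_polynomial (v : Place) (f : ℂ[X]) :
    der v (algebraMap ℂ[X] (LocalField v) f)
      = algebraMap ℂ[X] (LocalField v) (derivative f) := by
  simp only [algebraMap_def]
  induction f using Polynomial.induction_on' with
  | add p q hp hq => simp [hp, hq]
  | monomial n a =>
    induction n generalizing a with
    | zero => simp [Polynomial.monomial_zero_left, der_algebraMap]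
    | succ n ih =>
      have h : (monomial (n + 1) a : ℂ[X]) = monomial n a * X := by
        simp [Polynomial.monomial_mul_X]
      rw [h]
      simp only [map_mul, aeval_X, der_mul, ih, der_x, Polynomial.derivative_mul,
        Polynomial.derivative_X, map_add, map_one]

/-- The image of a power series in `t`. -/
def ofPowerSeries (v : Place) : PowerSeries ℂ →+* LocalField v := HahnSeries.ofPowerSeries ℤ ℂ

end LocalField

namespace WeylModule

open LocalField

/-! ### Formal completions of a module with connection, and the spaces `ψ` -/

/-- The formal completion of `M` at `v`. -/
abbrev Compl (M : WeylModule.{u}) (v : Place) : Type u := LocalField v ⊗[ℂ[X]] M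

instance (M : WeylModule.{u}) (v : Place) : AddCommGroup (M.Compl v) :=
  TensorProduct.addCommGroup

/-- The action of `∂ₓ` on the completion, `∂ₓ (g ⊗ m) = (dg/dx) ⊗ m + g ⊗ ∂ₓ m`, as an additive
map. -/
def connAdd (M : WeylModule.{u}) (v : Place) : M.Compl v →+ M.Compl v :=
  TensorProduct.liftAddHom
    (AddMonoidHom.mk'
      (fun g => AddMonoidHom.mk' (fun m => der v g ⊗ₜ[ℂ[X]] m + g ⊗ₜ[ℂ[X]] M.D m) (by
        intro m m'
        simp only [map_add, TensorProduct.tmul_add]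
        abel))
      (by
        intro g g'
        ext m
        simp only [map_add, TensorProduct.add_tmul, AddMonoidHom.mk'_apply,
          AddMonoidHom.add_apply]
        abel))
    (by
      intro f g m
      simp only [AddMonoidHom.mk'_apply, Algebra.smul_def, der_mul, der_polynomial, M.leibniz,
        TensorProduct.tmul_add, TensorProduct.add_tmul]
      simp only [← Algebra.smul_def, TensorProduct.smul_tmul]
      abel)

theorem connAdd_tmul (M : WeylModule.{u}) (v : Place) (g : LocalField v) (m : M) :
    M.connAdd v (g ⊗ₜ m) = der v g ⊗ₜ[ℂ[X]] m + g ⊗ₜ[ℂ[X]] M.D m := rfl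

/-- The action of `∂ₓ` on the completion. -/
def conn (M : WeylModule.{u}) (v : Place) : Module.End ℂ (M.Compl v) where
  toFun := M.connAdd v
  map_add' := map_add _
  map_smul' c z := by
    induction z using TensorProduct.induction_on with
    | zero => simp
    | add a b ha hb => simp only [smul_add, map_add, ha, hb]
    | tmul g m =>
      simp only [TensorProduct.smul_tmul', connAdd_tmul, Algebra.smul_def, der_mul,
        der_algebraMap, zero_mul, zero_add, RingHom.id_apply, smul_add]

/-- The action of `t d/dt` on the completion, for the connection `∇ - ξ dx`. -/
def eulerOp (M : WeylModule.{u}) (v : Place) (ξ : ℂ) : Module.End ℂ (M.Compl v) :=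
  Algebra.lsmul ℂ ℂ (M.Compl v) (eulerCoeff v) ∘ₗ (M.conn v - ξ • LinearMap.id)

/-- The generalized eigenspace of `t d/dt` on the completion for the eigenvalue `α`, for the
connection `∇ - ξ dx`. At a finite (regular singular) point only `ξ = 0` is used. At infinity, the
completion is the direct sum of its parts with exponential factors `ξ`, and this is the space of
the part with factor `ξ`. -/
def psi (M : WeylModule.{u}) (v : Place) (ξ α : ℂ) : Submodule ℂ (M.Compl v) :=
  (M.eulerOp v ξ).maxGenEigenspace α

/-- The vectors of the completion whose formal expansion into (infinitely many) eigenvectors has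
no term in `psi M v ξ α`: the sum of the other eigenspaces, of the power series combinations of
eigenvectors with eigenvalues of larger real part, and, at infinity, of the parts with other
exponential factors. -/
def offPsi (M : WeylModule.{u}) (v : Place) (ξ α : ℂ) : Submodule ℂ (M.Compl v) :=
  (⨆ α' ∈ {α' : ℂ | α' ≠ α}, M.psi v ξ α') ⊔
  Submodule.span ℂ {z | ∃ (g : PowerSeries ℂ) (α' : ℂ) (w : M.Compl v),
    α.re < α'.re ∧ w ∈ M.psi v ξ α' ∧ z = ofPowerSeries v g • w} ⊔
  match v with
  | .fin _ => ⊥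
  | .infty => Submodule.span ℂ {z | ∃ (g : LocalField .infty) (ξ' α' : ℂ) (w : M.Compl .infty),
      ξ' ≠ ξ ∧ w ∈ M.psi .infty ξ' α' ∧ z = g • w}

/-- `w` is the component with eigenvalue `α` (and exponential factor `ξ`) of the formal expansion
of the section `m` at `v`. -/
def IsComponent (M : WeylModule.{u}) (v : Place) (ξ α : ℂ) (m : M) (w : M.Compl v) : Prop :=
  w ∈ M.psi v ξ α ∧ (1 : LocalField v) ⊗ₜ[ℂ[X]] m - w ∈ M.offPsi v ξ α

/-! ### Meromorphic bundles and their singularities -/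

/-- The polynomial `∏ (x - p)`, `p ∈ P`. -/
def _root_.polePoly (P : Finset ℂ) : ℂ[X] := ∏ p ∈ P, (X - C p)

/-- `M` is (the module of global sections of) a meromorphic bundle with integrable connection on
the projective line, with poles in `P ∪ {∞}`: the functions `x - p`, `p ∈ P`, are invertible on
`M`, and `M` is of finite type over `ℂ[x, 1 / ∏ (x - p)]`. -/
def IsMeromorphicBundle (P : Finset ℂ) (M : WeylModule.{u}) : Prop :=
  Function.Bijective (fun m : M => polePoly P • m) ∧
  ∃ s : Finset M, ∀ m : M, ∃ k : ℕ, polePoly P ^ k • m ∈ Submodule.span ℂ[X] (s : Set M)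

/-- The rank of a meromorphic bundle. -/
def rank (M : WeylModule.{u}) : ℕ := Module.finrank ℂ[X] M

/-- At `p` there is a lattice on which the connection is logarithmic, with semi-simple
resonance-free residue: `∂ₓ = d/dx + diag(μ) / (x - p) + holomorphic terms`. -/
def HasLogLattice (M : WeylModule.{u}) (p : ℂ) : Prop :=
  ∃ (r : ℕ) (b : Module.Basis (Fin r) (LocalField (.fin p)) (M.Compl (.fin p)))
    (μ : Fin r → ℂ) (R : Matrix (Fin r) (Fin r) (PowerSeries ℂ)),
    (∀ j, M.conn (.fin p) (b j) =
      (t (.fin p))⁻¹ • μ j • b j + ∑ i, ofPowerSeries (.fin p) (R i j) • b i) ∧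
    (∀ k, μ k = 0 ∨ ∀ n : ℤ, (μ k).re ≠ n) ∧
    (∀ k m, ∀ n : ℤ, μ k - μ m = n → n = 0)

/-- At infinity there is a lattice on which the connection has Poincaré rank (at most) one, with
diagonal resonance-free polar part: `∂ₓ = d/dx + diag(a) + diag(c) / x + O(1 / x²)`; and `Q` is the
set of the eigenvalues `a k` of the leading term. -/
def HasRankOneLattice (M : WeylModule.{u}) (Q : Finset ℂ) : Prop :=
  ∃ (r : ℕ) (b : Module.Basis (Fin r) (LocalField .infty) (M.Compl .infty))
    (a c : Fin r → ℂ) (R : Matrix (Fin r) (Fin r) (PowerSeries ℂ)),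
    (∀ j, M.conn .infty (b j) =
      a j • b j + t .infty • c j • b j +
        ∑ i, (t .infty ^ 2 * ofPowerSeries .infty (R i j)) • b i) ∧
    (∀ k, ∀ n : ℤ, (c k).re ≠ n) ∧
    (∀ k m, a k = a m → ∀ n : ℤ, c k - c m = n → n = 0) ∧
    Q = Finset.univ.image a

/-! ### Parabolic structures -/

/-- Families of subspaces `F v ξ α β` of the completions of `M`; `F v ξ α β` is meant to be the step
`ψ^{α, β}` of a decreasing filtration of `psi M v ξ α`. Only the places `v = p ∈ P` with `ξ = 0`, and
`v = ∞` with all `ξ`, matter. -/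
abbrev Filtrations (M : WeylModule.{u}) : Type u :=
  (v : Place) → (ξ α : ℂ) → ℝ → Submodule ℂ (M.Compl v)

/-- The filtrations `F v ξ` form a parabolic structure: each `F v ξ α` is a decreasing, left
continuous, exhaustive filtration of `psi M v ξ α` with jumps in an interval `[k, k + 1)`, `k ∈ ℤ`,
and multiplication by `t ^ N` is an isomorphism from the step `(α, β)` to the step
`(α + N, β + N)`. -/
def IsParabolicAt (M : WeylModule.{u}) (F : M.Filtrations) (v : Place) (ξ : ℂ) : Prop :=
  (∀ α β, F v ξ α β ≤ M.psi v ξ α) ∧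
  (∀ α, Antitone (F v ξ α)) ∧
  (∀ α β, ∃ γ < β, F v ξ α γ = F v ξ α β) ∧
  (∀ α, ∃ k : ℤ, F v ξ α k = M.psi v ξ α ∧ F v ξ α (k + 1) = ⊥) ∧
  (∀ (α : ℂ) (β : ℝ) (N : ℤ) (w : M.Compl v),
    w ∈ F v ξ α β ↔ t v ^ N • w ∈ F v ξ (α + N) (β + N))

/-- The parabolic structure is admissible at `v`: the eigenspace for the eigenvalue `0` has weight
`0` only. -/
def IsAdmissibleAt (M : WeylModule.{u}) (F : M.Filtrations) (v : Place) (ξ : ℂ) : Prop :=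
  F v ξ 0 0 = M.psi v ξ 0 ∧ ∀ β > 0, F v ξ 0 β = ⊥

/-- `(M, F)` is a meromorphic integrable bundle with poles in `P ∪ {∞}` and with an admissible
parabolic structure, whose singularities are regular with semi-simple resonance-free residue at the
points of `P`, and of Poincaré rank one with diagonalizable resonance-free polar part at infinity,
`Q` being the set of eigenvalues of the leading term there. -/
structure IsParabolicBundle (P Q : Finset ℂ) (M : WeylModule.{u}) (F : M.Filtrations) : Prop where
  bundle : IsMeromorphicBundle P M
  logLattice : ∀ p ∈ P, M.HasLogLattice p
  rankOneLattice : M.HasRankOneLattice Q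
  parabolic_fin : ∀ p ∈ P, M.IsParabolicAt F (.fin p) 0
  parabolic_infty : ∀ ξ, M.IsParabolicAt F .infty ξ
  admissible : ∀ p ∈ P, M.IsAdmissibleAt F (.fin p) 0

/-! ### Parabolic degree and stability -/

/-- `dim gr^β ψ^α`, where `gr^β` is the quotient of the step `β` by the union of the steps
`γ > β`. -/
def grDim (M : WeylModule.{u}) (F : M.Filtrations) (v : Place) (ξ α : ℂ) (β : ℝ) : ℕ :=
  Module.finrank ℂ (F v ξ α β ⧸ (⨆ γ ∈ Set.Ioi β, F v ξ α γ).submoduleOf (F v ξ α β))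

/-- The degree `- ∑_p ∑_{β ∈ [0, 1)} ∑_α α dim gr^β ψ_p^α`, the sum being over `P ∪ {∞}`. (It is an
integer for the bundles of interest, by the residue theorem.) -/
def degree (P : Finset ℂ) (M : WeylModule.{u}) (F : M.Filtrations) : ℂ :=
  -(∑ p ∈ P, ∑ᶠ (α : ℂ) (β : ℝ) (_ : β ∈ Set.Ico (0 : ℝ) 1), α * M.grDim F (.fin p) 0 α β
    + ∑ᶠ (ξ : ℂ) (α : ℂ) (β : ℝ) (_ : β ∈ Set.Ico (0 : ℝ) 1), α * M.grDim F .infty ξ α β)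

/-- The parabolic degree: the degree plus the sum of the weights in `[0, 1)`. -/
def parDegree (P : Finset ℂ) (M : WeylModule.{u}) (F : M.Filtrations) : ℝ :=
  (M.degree P F).re
    + (∑ p ∈ P, ∑ᶠ (α : ℂ) (β : ℝ) (_ : β ∈ Set.Ico (0 : ℝ) 1), β * M.grDim F (.fin p) 0 α β
      + ∑ᶠ (ξ : ℂ) (α : ℂ) (β : ℝ) (_ : β ∈ Set.Ico (0 : ℝ) 1), β * M.grDim F .infty ξ α β)

/-- The parabolic slope. -/
def parSlope (P : Finset ℂ) (M : WeylModule.{u}) (F : M.Filtrations) : ℝ :=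
  M.parDegree P F / M.rank

/-- The map of completions induced by the inclusion of a submodule. -/
def Sub.complMap {M : WeylModule.{u}} (N : M.Sub) (v : Place) : N.toWeyl.Compl v →ₗ[ℂ] M.Compl v :=
  (N.incl.baseChange (LocalField v)).restrictScalars ℂ

/-- The filtrations induced on a submodule: `ψ^{α, β} N = ψ^α N ∩ ψ^{α, β} M`. -/
def Sub.induced {M : WeylModule.{u}} (N : M.Sub) (F : M.Filtrations) : N.toWeyl.Filtrations :=
  fun v ξ α β => N.toWeyl.psi v ξ α ⊓ (F v ξ α β).comap (N.complMap v)

/-- A submodule over the Weyl algebra is an integrable subbundle (of a meromorphic bundle with poles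
in `P ∪ {∞}`) if `x - p`, `p ∈ P`, are invertible on it. -/
def Sub.IsSubbundle {M : WeylModule.{u}} (N : M.Sub) (P : Finset ℂ) : Prop :=
  ∀ m : M, polePoly P • m ∈ N.toSubmodule → m ∈ N.toSubmodule

/-- Parabolic stability: `M` is non-zero, and all integrable subbundles other than `0` and `M`, with
the induced parabolic structure, have smaller slope. -/
def IsParStable (P : Finset ℂ) (M : WeylModule.{u}) (F : M.Filtrations) : Prop :=
  Nontrivial M ∧
  ∀ N : M.Sub, N.IsSubbundle P → N.toSubmodule ≠ ⊥ → N.toSubmodule ≠ ⊤ →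
    N.toWeyl.parSlope P (N.induced F) < M.parSlope P F

/-! ### Minimal extension and parabolic minimal Laplace transform -/

/-- `M` has no non-zero submodule supported at a point. -/
def NoPunctualSub (M : WeylModule.{u}) : Prop :=
  ∀ (p : ℂ) (N : M.Sub), (∀ m ∈ N.toSubmodule, ∃ k : ℕ, (X - C p : ℂ[X]) ^ k • m = 0) →
    N.toSubmodule = ⊥

/-- `M` has no non-zero quotient `M / N` supported at a point. -/
def NoPunctualQuotient (M : WeylModule.{u}) : Prop :=
  ∀ (p : ℂ) (N : M.Sub), (∀ m : M, ∃ k : ℕ, (X - C p : ℂ[X]) ^ k • m ∈ N.toSubmodule) →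
    N.toSubmodule = ⊤

/-- `L` is a minimal extension of the meromorphic bundle `M` with poles in `P ∪ {∞}`: its
localization at `P` is `M`, and it has no submodule and no quotient supported at a point. (Having no
submodule supported at a point, a minimal extension embeds into `M`.) -/
def Sub.IsMinimalExtension {M : WeylModule.{u}} (P : Finset ℂ) (L : M.Sub) : Prop :=
  (∀ m : M, ∃ k : ℕ, polePoly P ^ k • m ∈ L.toSubmodule) ∧
  L.toWeyl.NoPunctualSub ∧ L.toWeyl.NoPunctualQuotient

/-- The minimal Laplace transform of `M`, computed from a minimal extension `L`: the meromorphic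
bundle with poles in `Q ∪ {∞}` associated with the Laplace transform of `L`. -/
def Sub.minLaplace {M : WeylModule.{u}} (L : M.Sub) (Q : Finset ℂ) : WeylModule.{u} :=
  L.toWeyl.laplace.localize (polePoly Q)

/-- A section of the minimal extension, as a section of the minimal Laplace transform. -/
def Sub.toMinLaplace {M : WeylModule.{u}} (L : M.Sub) (Q : Finset ℂ) (m : L.toWeyl) :
    L.minLaplace Q :=
  L.toWeyl.laplace.toLocalize (polePoly Q) (L.toWeyl.toLaplace m)

/-- The image of a subspace `G` of `psi M v ξ α` under the correspondence which relates, for all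
sections `m` of the minimal extension `L`, the `α`-component of `m` at `(v, ξ)` to the `α'`-component
at `(v', ξ')` of `m` as a section of the minimal Laplace transform. -/
def Sub.phaseImage {M : WeylModule.{u}} (L : M.Sub) (Q : Finset ℂ)
    (v : Place) (ξ α : ℂ) (v' : Place) (ξ' α' : ℂ) (G : Submodule ℂ (M.Compl v)) :
    Submodule ℂ ((L.minLaplace Q).Compl v') :=
  Submodule.span ℂ {w' | ∃ (m : L.toWeyl), ∃ w ∈ G,
    M.IsComponent v ξ α (L.incl m) w ∧
    (L.minLaplace Q).IsComponent v' ξ' α' (L.toMinLaplace Q m) w'}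

open Classical in
/-- The parabolic structure of the minimal Laplace transform. For `α ∉ ℤ` it is transported by the
formal stationary phase isomorphisms
`ψ^α_{∞, η} M ≅ ψ^α_η M̂` and `ψ^α_{p} M ≅ ψ^α_{∞, -p} M̂`.
(`∂_ξ` acts as `-x`, so that the part of the completion of `M̂` at infinity coming from `p` has
exponential factor `-p`.) On sections, the Laplace transform maps the `α`-component at `p` to the
`(α + 1)`-component at infinity, and the `α`-component at infinity to the `(α - 1)`-component at
`η`, as it does for `x^α ↦ Γ(α + 1) ξ^{-α-1}`; the eigenvalue is then brought back to `α` by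
multiplication by a power of the local coordinate, which shifts the weights accordingly.
For `α ∈ ℤ` the filtration is the trivial one, with weight `α`. -/
def Sub.laplaceFiltrations {M : WeylModule.{u}} (L : M.Sub) (Q : Finset ℂ) (F : M.Filtrations) :
    (L.minLaplace Q).Filtrations
  | .fin η, ξ, α, β =>
      if ∃ n : ℤ, α = n then
        if β ≤ α.re then (L.minLaplace Q).psi (.fin η) ξ α else ⊥
      else L.phaseImage Q .infty η (α + 1) (.fin η) ξ α (F .infty η (α + 1) (β + 1))
  | .infty, η, α, β =>
      if ∃ n : ℤ, α = n then
        if β ≤ α.re then (L.minLaplace Q).psi .infty η α else ⊥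
      else L.phaseImage Q (.fin (-η)) 0 (α - 1) .infty η α (F (.fin (-η)) 0 (α - 1) (β - 1))

end WeylModule

end

/-! By non-resonance, the connection at each place is formally a direct sum of rank one pieces d + ξ
dx + α dt/t (a `Frame`). In a frame, the spaces ψ^α and the components of sections are just Laurent
coefficients (`Frame.mem_psi_iff`, `Frame.isComponent_iff`). The minimal extension also becomes
explicit: `minExt` consists of the sections whose coordinates with residue 0 at the points of P are
regular.

Multiplying Laurent coefficients by Gamma factors, as in x^α ↦ Γ(α+1) ξ^{-α-1}, turns the expansions
of a section m at p into expansions at infinity of m as a section of the transform, and those at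
infinity with factor η into expansions at η (`laplaceExpansions`). These expansions account for the
whole transform because sections of M with bounded poles at P and at infinity form a
finite-dimensional space. This finiteness makes the transform a bundle whose completion at infinity
has no more dimensions than there are expansions (`Expansions.exists_frame_infty`). At η the kernel
of the expansions contains a lattice stable under the connection, so it is a trivial connection;
non-integrality of the other exponents splits it off (`Expansions.exists_frame_fin`). So the
transform has singularities of the required type.

Stationary phase is then the map `Phase.Φ` of completions, bijective on non-integral eigenvalues. It
shifts eigenvalue and weight by the same integer, and multiplication by a power of t shifts them
back, so the graded dimensions agree pair by pair. Integral eigenvalues have the weight equal to the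
eigenvalue, so among the weights in [0, 1) they occur only at α = β = 0, where they contribute
nothing. Hence the parabolic degree is preserved, and likewise for filtrations cut down to
corresponding subspaces (`IsParabolicBundle.parDegree_minLaplace_inter`).

For stability, a subbundle N' of the transform is pulled back to the minimal extension and saturated
to a subbundle N of M. It is non-zero if N' is, and proper if N' is, because the minimal extension
has no punctual quotient. Completions of N and N' correspond under `Phase.Φ`, because vectors with
non-integral eigenvalue in the completion of a submodule are exactly the components of its sections.
So N and N' have the same parabolic degree, negative by stability of M. Their ranks may differ;
since M has degree 0, only the sign matters. -/

noncomputable section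

/-! ### Coefficients and pole orders of Laurent series. -/

namespace LocalField

variable {v : Place}

/-- The coefficient of `t ^ n`. -/
def coeff (g : LocalField v) (n : ℤ) : ℂ := HahnSeries.coeff (show LaurentSeries ℂ from g) n

@[ext]
theorem ext {g h : LocalField v} (H : ∀ n, coeff g n = coeff h n) : g = h :=
  HahnSeries.ext (funext H)

@[simp] theorem coeff_zero (n : ℤ) : coeff (0 : LocalField v) n = 0 := rfl
@[simp] theorem coeff_add (g h : LocalField v) (n : ℤ) :
    coeff (g + h) n = coeff g n + coeff h n := rfl
@[simp] theorem coeff_neg (g : LocalField v) (n : ℤ) : coeff (-g) n = -coeff g n := rfl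
@[simp] theorem coeff_sub (g h : LocalField v) (n : ℤ) :
    coeff (g - h) n = coeff g n - coeff h n := HahnSeries.coeff_sub

/-- Taking a coefficient, as an additive map. -/
def coeffHom (n : ℤ) : LocalField v →+ ℂ where
  toFun g := coeff g n
  map_zero' := rfl
  map_add' _ _ := rfl

theorem coeff_sum {ι : Type*} (s : Finset ι) (f : ι → LocalField v) (n : ℤ) :
    coeff (∑ i ∈ s, f i) n = ∑ i ∈ s, coeff (f i) n := map_sum (coeffHom n) f s

@[simp] theorem coeff_algebraMap_mul (c : ℂ) (g : LocalField v) (n : ℤ) :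
    coeff (algebraMap ℂ (LocalField v) c * g) n = c * coeff g n := by
  change HahnSeries.coeff (HahnSeries.C c * (show LaurentSeries ℂ from g)) n = _
  have h := HahnSeries.coeff_single_mul_add (r := c) (x := (show LaurentSeries ℂ from g))
    (a := n) (b := 0)
  rw [add_zero] at h
  exact h

@[simp] theorem coeff_smul (c : ℂ) (g : LocalField v) (n : ℤ) :
    coeff (c • g) n = c * coeff g n := by
  rw [Algebra.smul_def, coeff_algebraMap_mul]

theorem t_zpow (k : ℤ) : t v ^ k = (show LocalField v from (HahnSeries.single k 1 : LaurentSeries ℂ)) := by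
  have h := RatFunc.single_zpow (F := ℂ) k
  exact h.symm

@[simp] theorem coeff_t_zpow_mul (k : ℤ) (g : LocalField v) (n : ℤ) :
    coeff (t v ^ k * g) n = coeff g (n - k) := by
  rw [t_zpow]
  have h := HahnSeries.coeff_single_mul_add (r := (1 : ℂ)) (x := (show LaurentSeries ℂ from g))
    (a := n - k) (b := k)
  rw [sub_add_cancel, one_mul] at h
  exact h

@[simp] theorem coeff_t_mul (g : LocalField v) (n : ℤ) :
    coeff (t v * g) n = coeff g (n - 1) := by
  simpa using coeff_t_zpow_mul 1 g n

@[simp] theorem coeff_t_inv_mul (g : LocalField v) (n : ℤ) :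
    coeff ((t v)⁻¹ * g) n = coeff g (n + 1) := by
  simpa using coeff_t_zpow_mul (-1) g n

theorem coeff_t_zpow (k n : ℤ) : coeff (t v ^ k) n = if n = k then 1 else 0 := by
  rw [t_zpow]
  change HahnSeries.coeff (HahnSeries.single k (1 : ℂ)) n = _
  rw [HahnSeries.coeff_single]
  split_ifs <;> rfl

theorem coeff_one (n : ℤ) : coeff (1 : LocalField v) n = if n = 0 then 1 else 0 := by
  simpa using coeff_t_zpow (v := v) 0 n

theorem coeff_algebraMap (c : ℂ) (n : ℤ) :
    coeff (algebraMap ℂ (LocalField v) c) n = if n = 0 then c else 0 := by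
  rw [← mul_one (algebraMap _ _ c), coeff_algebraMap_mul, coeff_one]; simp

theorem coeff_euler (g : LocalField v) (n : ℤ) : coeff (euler v g) n = n * coeff g n := rfl

theorem coeff_der_fin {p : ℂ} (g : LocalField (.fin p)) (n : ℤ) :
    coeff (der (.fin p) g) n = (n + 1) * coeff g (n + 1) := by
  simp [der, eulerCoeff, coeff_euler]

theorem coeff_der_infty (g : LocalField .infty) (n : ℤ) :
    coeff (der .infty g) n = -((n - 1) * coeff g (n - 1)) := by
  simp [der, eulerCoeff, coeff_euler]

theorem coeff_ofPowerSeries (h : PowerSeries ℂ) (n : ℕ) :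
    coeff (ofPowerSeries v h) n = PowerSeries.coeff n h :=
  HahnSeries.ofPowerSeries_apply_coeff h n

theorem coeff_ofPowerSeries_of_neg (h : PowerSeries ℂ) {n : ℤ} (hn : n < 0) :
    coeff (ofPowerSeries v h) n = 0 := by
  change HahnSeries.coeff (HahnSeries.ofPowerSeries ℤ ℂ h) n = 0
  rw [HahnSeries.ofPowerSeries_apply]
  apply HahnSeries.embDomain_of_notMem_range
  rintro ⟨m, hm⟩
  have : (m : ℤ) = n := hm
  omega

theorem ofPowerSeries_X : ofPowerSeries v PowerSeries.X = t v := HahnSeries.ofPowerSeries_X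

theorem ofPowerSeries_C (c : ℂ) : ofPowerSeries v (PowerSeries.C c) = algebraMap ℂ _ c :=
  HahnSeries.ofPowerSeries_C c

theorem ofPowerSeries_injective : Function.Injective (ofPowerSeries v) :=
  HahnSeries.ofPowerSeries_injective

/-- The Laurent series `g` is divisible by `t ^ N`. -/
def OrdGE (g : LocalField v) (N : ℤ) : Prop := ∀ n < N, coeff g n = 0

theorem ordGE_iff {g : LocalField v} {N : ℤ} :
    OrdGE g N ↔ ∃ h : PowerSeries ℂ, g = t v ^ N * ofPowerSeries v h := by
  constructor
  · intro H
    refine ⟨PowerSeries.mk fun k => coeff g (k + N), ?_⟩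
    ext n
    rw [coeff_t_zpow_mul]
    rcases lt_or_ge n N with hn | hn
    · rw [H n hn, coeff_ofPowerSeries_of_neg _ (by omega)]
    · obtain ⟨k, hk⟩ := Int.eq_ofNat_of_zero_le (sub_nonneg.2 hn)
      rw [hk, coeff_ofPowerSeries, PowerSeries.coeff_mk, ← hk, sub_add_cancel]
  · rintro ⟨h, rfl⟩ n hn
    rw [coeff_t_zpow_mul, coeff_ofPowerSeries_of_neg _ (by omega)]

theorem ordGE_ofPowerSeries (h : PowerSeries ℂ) : OrdGE (ofPowerSeries v h) 0 :=
  ordGE_iff.2 ⟨h, by simp⟩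

theorem ordGE_zero_iff {g : LocalField v} : OrdGE g 0 ↔ ∃ h, g = ofPowerSeries v h := by
  simp [ordGE_iff]

theorem exists_ordGE (g : LocalField v) : ∃ N, OrdGE g N := by
  refine ⟨HahnSeries.order (show LaurentSeries ℂ from g), fun n hn => ?_⟩
  exact HahnSeries.coeff_eq_zero_of_lt_order hn

theorem OrdGE.mono {g : LocalField v} {N N' : ℤ} (h : OrdGE g N) (hN : N' ≤ N) : OrdGE g N' :=
  fun n hn => h n (by omega)

theorem OrdGE.add {g h : LocalField v} {N : ℤ} (hg : OrdGE g N) (hh : OrdGE h N) :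
    OrdGE (g + h) N := fun n hn => by simp [hg n hn, hh n hn]

theorem OrdGE.neg {g : LocalField v} {N : ℤ} (hg : OrdGE g N) : OrdGE (-g) N :=
  fun n hn => by simp [hg n hn]

theorem OrdGE.sum {ι : Type*} {s : Finset ι} {f : ι → LocalField v} {N : ℤ}
    (hf : ∀ i ∈ s, OrdGE (f i) N) : OrdGE (∑ i ∈ s, f i) N := fun n hn => by
  rw [coeff_sum]; exact Finset.sum_eq_zero fun i hi => hf i hi n hn

theorem ordGE_zero (N : ℤ) : OrdGE (0 : LocalField v) N := fun _ _ => rfl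

theorem OrdGE.mul {g h : LocalField v} {a b : ℤ} (hg : OrdGE g a) (hh : OrdGE h b) :
    OrdGE (g * h) (a + b) := by
  obtain ⟨g', rfl⟩ := ordGE_iff.1 hg
  obtain ⟨h', rfl⟩ := ordGE_iff.1 hh
  refine ordGE_iff.2 ⟨g' * h', ?_⟩
  rw [zpow_add₀ (t_ne_zero v), map_mul]; ring

theorem coeff_mul_of_ordGE {g h : LocalField v} {a b : ℤ} (hg : OrdGE g a) (hh : OrdGE h b) :
    coeff (g * h) (a + b) = coeff g a * coeff h b := by
  obtain ⟨g', rfl⟩ := ordGE_iff.1 hg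
  obtain ⟨h', rfl⟩ := ordGE_iff.1 hh
  have e : t v ^ a * ofPowerSeries v g' * (t v ^ b * ofPowerSeries v h')
      = t v ^ (a + b) * ofPowerSeries v (g' * h') := by
    rw [zpow_add₀ (t_ne_zero v), map_mul]; ring
  have h0 : ∀ f : PowerSeries ℂ, coeff (ofPowerSeries v f) 0 = PowerSeries.coeff 0 f := fun f =>
    coeff_ofPowerSeries f 0
  rw [e]
  simp only [coeff_t_zpow_mul, sub_self, h0]
  simp [PowerSeries.coeff_mul]

theorem ordGE_algebraMap (c : ℂ) : OrdGE (algebraMap ℂ (LocalField v) c) 0 := fun n hn => by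
  rw [coeff_algebraMap, if_neg (by omega)]

theorem OrdGE.smul {g : LocalField v} {N : ℤ} (c : ℂ) (hg : OrdGE g N) : OrdGE (c • g) N :=
  fun n hn => by simp [hg n hn]

theorem ordGE_t_zpow (k : ℤ) : OrdGE (t v ^ k) k := fun n hn => by
  rw [coeff_t_zpow, if_neg (by omega)]

theorem ordGE_t_zpow_mul_iff {g : LocalField v} {k N : ℤ} :
    OrdGE (t v ^ k * g) (N + k) ↔ OrdGE g N := by
  constructor
  · intro h n hn
    have := h (n + k) (by omega)
    simpa using this
  · intro h n hn
    rw [coeff_t_zpow_mul]; exact h _ (by omega)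

theorem OrdGE.der_fin {p : ℂ} {g : LocalField (.fin p)} {N : ℤ} (hg : OrdGE g N) :
    OrdGE (der (.fin p) g) (N - 1) := fun n hn => by
  rw [coeff_der_fin, hg _ (by omega), mul_zero]

theorem OrdGE.der_infty {g : LocalField .infty} {N : ℤ} (hg : OrdGE g N) :
    OrdGE (der .infty g) (N + 1) := fun n hn => by
  rw [coeff_der_infty, hg _ (by omega), mul_zero, neg_zero]

/-- `d/dx` of a power series at a finite point is a power series. -/
theorem der_fin_ordGE_zero {p : ℂ} {g : LocalField (.fin p)} (hg : OrdGE g 0) :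
    OrdGE (der (.fin p) g) 0 := fun n hn => by
  rw [coeff_der_fin]
  -- In order -1 the factor n + 1 kills the contribution of the constant term.
  rcases eq_or_ne n (-1) with rfl | h
  · simp
  · rw [hg _ (by omega), mul_zero]

theorem algebraMap_X : algebraMap ℂ[X] (LocalField v) X = x v := by
  rw [algebraMap_def, aeval_X]

theorem algebraMap_C (c : ℂ) :
    algebraMap ℂ[X] (LocalField v) (C c) = algebraMap ℂ (LocalField v) c := by
  rw [algebraMap_def, aeval_C]

theorem algebraMap_X_sub_C (p : ℂ) : algebraMap ℂ[X] (LocalField (.fin p)) (X - C p) = t (.fin p) := by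
  rw [map_sub, algebraMap_X, algebraMap_C, x, add_sub_cancel_left]

theorem algebraMap_X_infty : algebraMap ℂ[X] (LocalField .infty) X = (t .infty)⁻¹ :=
  algebraMap_X

theorem algebraMap_fin (p : ℂ) (f : ℂ[X]) : algebraMap ℂ[X] (LocalField (.fin p)) f
    = ofPowerSeries (.fin p) (f.comp (X + C p) : ℂ[X]) := by
  have : (aeval (x (.fin p)) : ℂ[X] →ₐ[ℂ] LocalField (.fin p)).toRingHom
      = ((ofPowerSeries (.fin p)).comp Polynomial.coeToPowerSeries.ringHom).comp
        (Polynomial.compRingHom (X + C p)) := by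
    apply Polynomial.ringHom_ext
    · intro a
      simp [ofPowerSeries_C]
    · simp [x, ofPowerSeries_X, ofPowerSeries_C, add_comm]
  exact congrArg (fun φ : ℂ[X] →+* _ => φ f) this

theorem ordGE_algebraMap_fin (p : ℂ) (f : ℂ[X]) :
    OrdGE (algebraMap ℂ[X] (LocalField (.fin p)) f) 0 := by
  rw [algebraMap_fin]; exact ordGE_ofPowerSeries _

theorem coeff_algebraMap_fin_zero (p : ℂ) (f : ℂ[X]) :
    coeff (algebraMap ℂ[X] (LocalField (.fin p)) f) 0 = f.eval p := by
  have := coeff_ofPowerSeries (v := .fin p) (f.comp (X + C p) : ℂ[X]) 0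
  rw [Nat.cast_zero] at this
  rw [algebraMap_fin, this, Polynomial.coeff_coe, Polynomial.coeff_zero_eq_eval_zero,
    Polynomial.eval_comp]
  simp

theorem coeff_algebraMap_infty (f : ℂ[X]) (n : ℤ) :
    coeff (algebraMap ℂ[X] (LocalField .infty) f) n = if n ≤ 0 then f.coeff (-n).toNat else 0 := by
  induction f using Polynomial.induction_on' with
  | add p q hp hq =>
    rw [map_add, coeff_add, hp, hq]; split_ifs <;> simp
  | monomial k a =>
    rw [← Polynomial.C_mul_X_pow_eq_monomial, map_mul, map_pow, algebraMap_C, algebraMap_X_infty,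
      coeff_algebraMap_mul, inv_pow, ← zpow_natCast, ← zpow_neg, coeff_t_zpow,
      Polynomial.coeff_C_mul_X_pow]
    split_ifs <;> first | omega | simp

/-- This makes the Laurent series torsion free, hence flat, over the principal ideal domain of
polynomials. Completions of submodules embed for that reason. -/
theorem algebraMap_polynomial_injective (v : Place) :
    Function.Injective (algebraMap ℂ[X] (LocalField v)) := by
  cases v with
  | fin p =>
    intro f g h
    rw [algebraMap_fin, algebraMap_fin] at h
    have h1 := Polynomial.coe_injective _ (ofPowerSeries_injective h)
    have h2 := congrArg (fun q : ℂ[X] => q.comp (X - C p)) h1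
    simpa [Polynomial.comp_assoc] using h2
  | infty =>
    intro f g h
    ext n
    have := congrArg (fun q => coeff q (-n)) h
    simpa [coeff_algebraMap_infty] using this

instance : FaithfulSMul ℂ[X] (LocalField v) :=
  (faithfulSMul_iff_algebraMap_injective _ _).2 (algebraMap_polynomial_injective v)

theorem algebraMap_ne_zero {f : ℂ[X]} (hf : f ≠ 0) : algebraMap ℂ[X] (LocalField v) f ≠ 0 :=
  fun h => hf (algebraMap_polynomial_injective v (by rw [h, map_zero]))

instance : Module.IsTorsionFree ℂ[X] (LocalField v) := inferInstance
instance : Module.Flat ℂ[X] (LocalField v) := inferInstance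

theorem polePoly_ne_zero (P : Finset ℂ) : polePoly P ≠ 0 :=
  Finset.prod_ne_zero_iff.2 fun p _ => Polynomial.X_sub_C_ne_zero p

end LocalField

/-! ### Formal reduction of connections -/

/-- Cutting the sequence off below n makes the recursion well founded, while `H` may still use it as
a whole power series. The cut-off disappears from coefficients of low order by
`PowerSeries.coeff_mul_congr`. -/
theorem exists_seq_of_strong_recursion {T : Type*} [Zero T] (H : ℕ → (ℕ → T) → T) :
    ∃ G : ℕ → T, ∀ n, G n = H n fun l => if l < n then G l else 0 := by
  let S : ℕ → T := fun n => Nat.strongRec (motive := fun _ => T)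
    (fun n ih => H n fun l => if h : l < n then ih l h else 0) n
  refine ⟨S, fun n => ?_⟩
  change Nat.strongRec (motive := fun _ => T)
    (fun n ih => H n fun l => if h : l < n then ih l h else 0) n = _
  rw [Nat.strongRec_eq]
  congr 1

namespace PowerSeries

/-- `X d/dX` on power series. -/
def eulerSeries (g : PowerSeries ℂ) : PowerSeries ℂ := PowerSeries.mk fun n => n * coeff n g

theorem coeff_mul_congr {A B B' : PowerSeries ℂ} {n : ℕ} (h : ∀ l ≤ n, coeff l B = coeff l B') :
    coeff n (A * B) = coeff n (A * B') := by
  rw [coeff_mul, coeff_mul]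
  refine Finset.sum_congr rfl fun ij hij => ?_
  rw [h ij.2 (by have := Finset.HasAntidiagonal.mem_antidiagonal.1 hij; omega)]

end PowerSeries

/-- The coefficient of X^{n+1} in the system gives (n + 1 + μ_i - μ_j) G_{n+1} in terms of G_0, ...,
G_n. Non-resonance says that this factor never vanishes, so the system is solved recursively from
G_0 = 1. -/
theorem exists_gauge_log {ι : Type*} [Fintype ι] [DecidableEq ι] (μ : ι → ℂ)
    (R : Matrix ι ι (PowerSeries ℂ)) (hμ : ∀ k m, ∀ n : ℤ, μ k - μ m = n → n = 0) :
    ∃ G : Matrix ι ι (PowerSeries ℂ), (∀ i j, PowerSeries.constantCoeff (G i j) = if i = j then 1 else 0) ∧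
      ∀ i j, PowerSeries.eulerSeries (G i j) + PowerSeries.C (μ i) * G i j
        + PowerSeries.X * ∑ k, R i k * G k j = PowerSeries.C (μ j) * G i j := by
  obtain ⟨G, hG⟩ := exists_seq_of_strong_recursion (T := ι → ι → ℂ)
    (fun n f => match n with
      | 0 => fun i j => if i = j then 1 else 0
      | n + 1 => fun i j => -(∑ k, PowerSeries.coeff n (R i k * PowerSeries.mk fun l => f l k j)) /
          ((n + 1 : ℕ) + μ i - μ j))
  have hsucc : ∀ n i j, ((n + 1 : ℕ) + μ i - μ j) * G (n + 1) i j
      = -∑ k, PowerSeries.coeff n (R i k * PowerSeries.mk fun l => G l k j) := by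
    intro n i j
    have hne : ((n + 1 : ℕ) + μ i - μ j : ℂ) ≠ 0 := by
      intro h
      have := hμ j i ((n + 1 : ℕ) : ℤ) (by push_cast at h ⊢; linear_combination -h)
      omega
    rw [hG (n + 1)]
    simp only
    rw [mul_div_cancel₀ _ hne]
    congr 1
    refine Finset.sum_congr rfl fun k _ => ?_
    refine PowerSeries.coeff_mul_congr fun l hl => ?_
    simp [hl]
  refine ⟨fun i j => PowerSeries.mk fun n => G n i j, fun i j => ?_, fun i j => ?_⟩
  · rw [← PowerSeries.coeff_zero_eq_constantCoeff_apply, PowerSeries.coeff_mk, hG 0]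
  · ext n
    cases n with
    | zero =>
      simp [PowerSeries.eulerSeries]
      rw [hG 0]
      by_cases h : i = j <;> simp [h]
    | succ n =>
      simp only [PowerSeries.eulerSeries, map_add, PowerSeries.coeff_mk, PowerSeries.coeff_C_mul,
        PowerSeries.coeff_succ_X_mul, map_sum]
      linear_combination hsucc n i j

/-- For a_i ≠ a_j the entry of G_{n+1} is found from the coefficient of X^{n+1}, where it is
multiplied by a_i - a_j. For a_i = a_j this term is absent, and the entry is found one order later,
from X^{n+2}, with the factor n + 1 - (c_i - c_j), non-zero by non-resonance. As the polar part is
diagonal, only G_0, ..., G_n enter in both cases. -/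
theorem exists_gauge_rankOne {ι : Type*} [Fintype ι] [DecidableEq ι] (a c : ι → ℂ)
    (R : Matrix ι ι (PowerSeries ℂ)) (hc : ∀ k m, a k = a m → ∀ n : ℤ, c k - c m = n → n = 0) :
    ∃ G : Matrix ι ι (PowerSeries ℂ), (∀ i j, PowerSeries.constantCoeff (G i j) = if i = j then 1 else 0) ∧
      ∀ i j, -(PowerSeries.X * PowerSeries.eulerSeries (G i j)) + PowerSeries.C (a i) * G i j
        + PowerSeries.X * (PowerSeries.C (c i) * G i j)
        + PowerSeries.X * (PowerSeries.X * ∑ k, R i k * G k j)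
        = PowerSeries.C (a j) * G i j + PowerSeries.X * (PowerSeries.C (c j) * G i j) := by
  obtain ⟨G, hG⟩ := exists_seq_of_strong_recursion (T := ι → ι → ℂ)
    (fun n f => match n with
      | 0 => fun i j => if i = j then 1 else 0
      | n + 1 => fun i j => if a i = a j then
          (∑ k, PowerSeries.coeff n (R i k * PowerSeries.mk fun l => f l k j)) / ((n + 1 : ℕ) - (c i - c j))
          else ((n - (c i - c j)) * f n i j
            - PowerSeries.coeff n (PowerSeries.X * ∑ k, R i k * PowerSeries.mk fun l => f l k j)) / (a i - a j))
  have hsucc : ∀ n i j, a i = a j → ((n + 1 : ℕ) - (c i - c j)) * G (n + 1) i j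
      = ∑ k, PowerSeries.coeff n (R i k * PowerSeries.mk fun l => G l k j) := by
    intro n i j hij
    have hne : ((n + 1 : ℕ) - (c i - c j) : ℂ) ≠ 0 := by
      intro h
      have := hc i j hij ((n + 1 : ℕ) : ℤ) (by push_cast at h ⊢; linear_combination -h)
      omega
    rw [hG (n + 1)]
    simp only
    rw [if_pos hij, mul_div_cancel₀ _ hne]
    refine Finset.sum_congr rfl fun k _ => ?_
    refine PowerSeries.coeff_mul_congr fun l hl => ?_
    simp [hl]
  have hsucc' : ∀ n i j, a i ≠ a j → (a i - a j) * G (n + 1) i j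
      = (n - (c i - c j)) * G n i j
        - PowerSeries.coeff n (PowerSeries.X * ∑ k, R i k * PowerSeries.mk fun l => G l k j) := by
    intro n i j hij
    rw [hG (n + 1)]
    simp only
    rw [if_neg hij, mul_div_cancel₀ _ (sub_ne_zero.2 hij), if_pos (Nat.lt_succ_self n)]
    congr 1
    cases n with
    | zero => simp
    | succ n =>
      simp only [PowerSeries.coeff_succ_X_mul, map_sum]
      refine Finset.sum_congr rfl fun k _ => ?_
      refine PowerSeries.coeff_mul_congr fun l hl => ?_
      simp [show l ≤ n + 1 by omega]
  have h0 : ∀ i j, G 0 i j = if i = j then 1 else 0 := fun i j => by rw [hG 0]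
  refine ⟨fun i j => PowerSeries.mk fun n => G n i j, fun i j => ?_, fun i j => ?_⟩
  · rw [← PowerSeries.coeff_zero_eq_constantCoeff_apply, PowerSeries.coeff_mk, h0]
  · ext n
    cases n with
    | zero =>
      simp only [map_add, map_neg, PowerSeries.coeff_zero_X_mul, PowerSeries.coeff_C_mul, PowerSeries.coeff_mk, h0]
      by_cases h : i = j <;> simp [h]
    | succ n =>
      simp only [PowerSeries.eulerSeries, map_add, map_neg, PowerSeries.coeff_mk, PowerSeries.coeff_C_mul,
        PowerSeries.coeff_succ_X_mul]
      by_cases hij : a i = a j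
      · rw [hij]
        cases n with
        | zero =>
          simp only [PowerSeries.coeff_zero_X_mul, h0]
          by_cases h : i = j <;> simp [h]
        | succ n =>
          simp only [PowerSeries.coeff_succ_X_mul, map_sum]
          linear_combination -hsucc n i j hij
      · linear_combination hsucc' n i j hij

namespace LocalField

theorem euler_ofPowerSeries {v : Place} (g : PowerSeries ℂ) :
    euler v (ofPowerSeries v g) = ofPowerSeries v (PowerSeries.eulerSeries g) := by
  ext n
  rw [coeff_euler]
  rcases lt_or_ge n 0 with hn | hn
  · rw [coeff_ofPowerSeries_of_neg _ hn, coeff_ofPowerSeries_of_neg _ hn, mul_zero]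
  · obtain ⟨k, rfl⟩ := Int.eq_ofNat_of_zero_le hn
    rw [coeff_ofPowerSeries, coeff_ofPowerSeries, PowerSeries.eulerSeries, PowerSeries.coeff_mk]
    simp

section Gauge

variable {v : Place} {V : Type*} [AddCommGroup V] [Module (LocalField v) V]
  {ι : Type*} [Fintype ι] [DecidableEq ι]

/-- A matrix of power series with constant term `1` transforms a basis into a basis. -/
theorem exists_basis_of_gauge (b : Module.Basis ι (LocalField v) V)
    (G : Matrix ι ι (PowerSeries ℂ))
    (hG : ∀ i j, PowerSeries.constantCoeff (G i j) = if i = j then 1 else 0) :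
    ∃ e : Module.Basis ι (LocalField v) V, ∀ j, e j = ∑ i, ofPowerSeries v (G i j) • b i := by
  have hdet : IsUnit ((ofPowerSeries v).mapMatrix G).det := by
    rw [← RingHom.map_det]
    apply IsUnit.map
    rw [PowerSeries.isUnit_iff_constantCoeff, RingHom.map_det]
    have : PowerSeries.constantCoeff.mapMatrix G = 1 := by
      ext i j
      simp [hG, Matrix.one_apply]
    rw [this, Matrix.det_one]
    exact isUnit_one
  refine ⟨b.map (Matrix.toLinearEquiv b _ hdet), fun j => ?_⟩
  rw [Module.Basis.map_apply]
  change Matrix.toLin b b _ (b j) = _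
  rw [Matrix.toLin_self]
  rfl

/-- A connection matrix is changed into a diagonal one by a gauge transformation solving the
corresponding differential system. -/
theorem exists_diagonal_basis_of_gauge (nab : V →+ V)
    (hnab : ∀ (g : LocalField v) z, nab (g • z) = der v g • z + g • nab z)
    (b : Module.Basis ι (LocalField v) V)
    (A : Matrix ι ι (LocalField v)) (lam : ι → LocalField v)
    (hb : ∀ j, nab (b j) = ∑ i, A i j • b i)
    (G : Matrix ι ι (PowerSeries ℂ))
    (hG : ∀ i j, PowerSeries.constantCoeff (G i j) = if i = j then 1 else 0)
    (hGA : ∀ i j, der v (ofPowerSeries v (G i j)) + ∑ k, A i k * ofPowerSeries v (G k j)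
      = lam j * ofPowerSeries v (G i j)) :
    ∃ e : Module.Basis ι (LocalField v) V, ∀ j, nab (e j) = lam j • e j := by
  obtain ⟨e, he⟩ := exists_basis_of_gauge b G hG
  refine ⟨e, fun j => ?_⟩
  rw [he, map_sum, Finset.smul_sum]
  simp only [hnab, hb, Finset.smul_sum, Finset.sum_add_distrib, smul_smul]
  rw [Finset.sum_comm (f := fun k i => (ofPowerSeries v (G k j) * A i k) • b i),
    ← Finset.sum_add_distrib]
  refine Finset.sum_congr rfl fun i _ => ?_
  rw [← Finset.sum_smul, ← add_smul, ← hGA]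
  simp only [mul_comm]

end Gauge

end LocalField

namespace LocalField

/-- A connection with a logarithmic pole and semi-simple resonance-free residue is formally
equivalent to its polar part. -/
theorem exists_diagonal_basis_log {p : ℂ} {V : Type*} [AddCommGroup V]
    [Module (LocalField (.fin p)) V] {ι : Type*} [Fintype ι] [DecidableEq ι] (nab : V →+ V)
    (hnab : ∀ (g : LocalField (.fin p)) z, nab (g • z) = der _ g • z + g • nab z)
    (b : Module.Basis ι (LocalField (.fin p)) V) (μ : ι → ℂ) (R : Matrix ι ι (PowerSeries ℂ))
    (hb : ∀ j, nab (b j) = ((t (.fin p))⁻¹ * algebraMap ℂ _ (μ j)) • b j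
      + ∑ i, ofPowerSeries (.fin p) (R i j) • b i)
    (hμ : ∀ k m, ∀ n : ℤ, μ k - μ m = n → n = 0) :
    ∃ e : Module.Basis ι (LocalField (.fin p)) V,
      ∀ j, nab (e j) = ((t (.fin p))⁻¹ * algebraMap ℂ _ (μ j)) • e j := by
  obtain ⟨G, hG, hG'⟩ := exists_gauge_log μ R hμ
  refine exists_diagonal_basis_of_gauge nab hnab b
    (fun i j => (if i = j then (t (.fin p))⁻¹ * algebraMap ℂ _ (μ j) else 0)
      + ofPowerSeries (.fin p) (R i j)) _ (fun j => ?_) G hG fun i j => ?_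
  · simp only [hb, add_smul, Finset.sum_add_distrib, ite_smul, zero_smul, Finset.sum_ite_eq',
      Finset.mem_univ, if_true]
  · have h := congrArg (ofPowerSeries (.fin p)) (hG' i j)
    simp only [map_add, map_mul, map_sum, ofPowerSeries_C, ofPowerSeries_X,
      ← euler_ofPowerSeries] at h
    have ht := t_ne_zero (.fin p)
    simp only [add_mul, Finset.sum_add_distrib, ite_mul, zero_mul, Finset.sum_ite_eq,
      Finset.mem_univ, if_true]
    rw [der, AddMonoidHom.comp_apply, AddMonoidHom.coe_mulLeft, eulerCoeff]
    field_simp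
    linear_combination h

/-- A connection of Poincaré rank one with diagonal resonance-free polar part is formally
equivalent to its polar part. -/
theorem exists_diagonal_basis_rankOne {V : Type*} [AddCommGroup V]
    [Module (LocalField .infty) V] {ι : Type*} [Fintype ι] [DecidableEq ι] (nab : V →+ V)
    (hnab : ∀ (g : LocalField .infty) z, nab (g • z) = der _ g • z + g • nab z)
    (b : Module.Basis ι (LocalField .infty) V) (a c : ι → ℂ) (R : Matrix ι ι (PowerSeries ℂ))
    (hb : ∀ j, nab (b j) = (algebraMap ℂ _ (a j) + t .infty * algebraMap ℂ _ (c j)) • b j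
      + ∑ i, (t .infty ^ 2 * ofPowerSeries .infty (R i j)) • b i)
    (hc : ∀ k m, a k = a m → ∀ n : ℤ, c k - c m = n → n = 0) :
    ∃ e : Module.Basis ι (LocalField .infty) V,
      ∀ j, nab (e j) = (algebraMap ℂ _ (a j) + t .infty * algebraMap ℂ _ (c j)) • e j := by
  obtain ⟨G, hG, hG'⟩ := exists_gauge_rankOne a c R hc
  refine exists_diagonal_basis_of_gauge nab hnab b
    (fun i j => (if i = j then algebraMap ℂ _ (a j) + t .infty * algebraMap ℂ _ (c j) else 0)
      + t .infty ^ 2 * ofPowerSeries .infty (R i j)) _ (fun j => ?_) G hG fun i j => ?_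
  · simp only [hb, add_smul, Finset.sum_add_distrib, ite_smul, zero_smul, Finset.sum_ite_eq',
      Finset.mem_univ, if_true]
  · have h := congrArg (ofPowerSeries .infty) (hG' i j)
    simp only [map_add, map_neg, map_mul, map_sum, ofPowerSeries_C, ofPowerSeries_X,
      ← euler_ofPowerSeries] at h
    have ht := t_ne_zero .infty
    simp only [add_mul, Finset.sum_add_distrib, ite_mul, zero_mul, Finset.sum_ite_eq,
      Finset.mem_univ, if_true]
    rw [der, AddMonoidHom.comp_apply, AddMonoidHom.coe_mulLeft, eulerCoeff]
    simp only [mul_assoc, ← Finset.mul_sum, inv_neg, inv_inv]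
    linear_combination h

end LocalField

/-! ### Frames: connections diagonalized over the completions. -/

namespace WeylModule

open LocalField

theorem algebraMap_smul_compl {M : WeylModule.{u}} {v : Place} (c : ℂ) (z : M.Compl v) :
    algebraMap ℂ (LocalField v) c • z = c • z := algebraMap_smul _ c z

theorem conn_tmul (M : WeylModule.{u}) (v : Place) (g : LocalField v) (m : M) :
    M.conn v (g ⊗ₜ m) = der v g ⊗ₜ[ℂ[X]] m + g ⊗ₜ[ℂ[X]] M.D m := rfl

theorem conn_smul (M : WeylModule.{u}) (v : Place) (g : LocalField v) (z : M.Compl v) :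
    M.conn v (g • z) = der v g • z + g • M.conn v z := by
  induction z using TensorProduct.induction_on with
  | zero => simp
  | add a b ha hb => simp only [smul_add, map_add, ha, hb]; abel
  | tmul h m =>
    simp only [TensorProduct.smul_tmul', conn_tmul, smul_eq_mul, der_mul, TensorProduct.add_tmul,
      smul_add]
    abel

/-- A basis of the completion of `M` at `v` in which the connection is a direct sum of connections
of rank one of the form `d + ξ dx + α dt / t`, with `ξ = 0` at finite points. -/
structure Frame (M : WeylModule.{u}) (v : Place) where
  ι : Type
  [fintype : Fintype ι]
  basis : Module.Basis ι (LocalField v) (M.Compl v)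
  fac : ι → ℂ
  exp : ι → ℂ
  fac_fin : ∀ p, v = .fin p → ∀ j, fac j = 0
  conn_basis : ∀ j, M.conn v (basis j) =
    (algebraMap ℂ _ (fac j) + (eulerCoeff v)⁻¹ * algebraMap ℂ _ (exp j)) • basis j

attribute [instance] Frame.fintype

theorem HasLogLattice.exists_frame {M : WeylModule.{u}} {p : ℂ} (h : M.HasLogLattice p) :
    ∃ fr : M.Frame (.fin p), (∀ k, fr.exp k = 0 ∨ ∀ n : ℤ, (fr.exp k).re ≠ n) ∧
      ∀ k m, ∀ n : ℤ, fr.exp k - fr.exp m = n → n = 0 := by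
  obtain ⟨r, b, μ, R, hb, h1, h2⟩ := h
  obtain ⟨e, he⟩ := exists_diagonal_basis_log (M.conn (.fin p)).toAddMonoidHom
    (M.conn_smul (.fin p)) b μ R (fun j => by
      have := hb j
      rw [mul_smul, algebraMap_smul_compl]; exact this) h2
  exact ⟨⟨Fin r, e, 0, μ, fun _ _ _ => rfl, fun j => by
    rw [Pi.zero_apply, map_zero, zero_add]; exact he j⟩, h1, h2⟩

theorem HasRankOneLattice.exists_frame {M : WeylModule.{u}} {Q : Finset ℂ}
    (h : M.HasRankOneLattice Q) :
    ∃ fr : M.Frame .infty, (∀ k, ∀ n : ℤ, (fr.exp k).re ≠ n) ∧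
      (∀ k m, fr.fac k = fr.fac m → ∀ n : ℤ, fr.exp k - fr.exp m = n → n = 0) ∧
      ∀ ξ, ξ ∈ Q ↔ ∃ j, fr.fac j = ξ := by
  obtain ⟨r, b, a, c, R, hb, h1, h2, rfl⟩ := h
  obtain ⟨e, he⟩ := exists_diagonal_basis_rankOne (M.conn .infty).toAddMonoidHom
    (M.conn_smul .infty) b a c R (fun j => by
      have := hb j
      rw [add_smul, mul_smul, algebraMap_smul_compl, algebraMap_smul_compl]; exact this) h2
  -- The Euler operator of the coordinate 1/x is -x ∂ₓ, so the exponents are the opposites of the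
  -- coefficients of 1/x.
  refine ⟨⟨Fin r, e, a, -c, fun _ h => (Place.noConfusion h), fun j => ?_⟩, fun k n hn => ?_,
    fun k m hkm n hn => ?_, fun ξ => by simp⟩
  · refine (he j).trans ?_
    simp [eulerCoeff]
  · apply h1 k (-n)
    simp only [Pi.neg_apply, Complex.neg_re] at hn
    push_cast; linarith
  · have := h2 m k hkm.symm n (by simp only [Pi.neg_apply] at hn; linear_combination hn)
    exact this

end WeylModule

/-! ### Eigenspaces and components as Laurent coefficients. -/

namespace WeylModule

open LocalField

/-- Exponential factors occur only at infinity. -/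
def _root_.Place.Adm (v : Place) (ζ : ℂ) : Prop := ∀ p, v = .fin p → ζ = 0

theorem _root_.Place.adm_infty (ζ : ℂ) : Place.Adm .infty ζ := fun _ h => Place.noConfusion h

theorem _root_.Place.adm_fin (p : ℂ) : Place.Adm (.fin p) 0 := fun _ _ => rfl

namespace Frame

variable {M : WeylModule.{u}} {v : Place} (fr : M.Frame v)

/-- The `t ^ n` coefficient of the `j`-th coordinate. -/
def cf (z : M.Compl v) (j : fr.ι) (n : ℤ) : ℂ := coeff (fr.basis.coord j z) n

theorem ext_cf {z w : M.Compl v} (h : ∀ j (n : ℤ), fr.cf z j n = fr.cf w j n) : z = w :=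
  fr.basis.ext_elem fun j => LocalField.ext (h j)

@[simp] theorem cf_zero (j : fr.ι) (n : ℤ) : fr.cf 0 j n = 0 := by simp [cf]
@[simp] theorem cf_add (z w : M.Compl v) (j : fr.ι) (n : ℤ) :
    fr.cf (z + w) j n = fr.cf z j n + fr.cf w j n := by simp [cf]
@[simp] theorem cf_sub (z w : M.Compl v) (j : fr.ι) (n : ℤ) :
    fr.cf (z - w) j n = fr.cf z j n - fr.cf w j n := by simp [cf]
@[simp] theorem cf_smul (c : ℂ) (z : M.Compl v) (j : fr.ι) (n : ℤ) :
    fr.cf (c • z) j n = c * fr.cf z j n := by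
  rw [← algebraMap_smul_compl, cf, map_smul, smul_eq_mul, coeff_algebraMap_mul]; rfl
@[simp] theorem cf_t_zpow_smul (N : ℤ) (z : M.Compl v) (j : fr.ι) (n : ℤ) :
    fr.cf (t v ^ N • z) j n = fr.cf z j (n - N) := by
  rw [cf, map_smul, smul_eq_mul, coeff_t_zpow_mul]; rfl

theorem coord_conn (z : M.Compl v) (j : fr.ι) :
    fr.basis.coord j (M.conn v z) = der v (fr.basis.coord j z)
      + (algebraMap ℂ _ (fr.fac j) + (eulerCoeff v)⁻¹ * algebraMap ℂ _ (fr.exp j))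
        * fr.basis.coord j z := by
  classical
  conv_lhs => rw [← fr.basis.sum_repr z]
  simp only [map_sum, conn_smul, conn_basis, map_add, map_smul, smul_eq_mul,
    Module.Basis.coord_apply, Module.Basis.repr_self, Finsupp.single_apply]
  simp [Finset.sum_add_distrib, mul_comm]

theorem eulerCoeff_ne_zero (v : Place) : eulerCoeff v ≠ 0 := by
  cases v with
  | fin p => exact t_ne_zero _
  | infty => simp [eulerCoeff, t_ne_zero]

theorem coord_eulerOp (ζ : ℂ) (z : M.Compl v) (j : fr.ι) :
    fr.basis.coord j (M.eulerOp v ζ z) = euler v (fr.basis.coord j z)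
      + algebraMap ℂ _ (fr.exp j) * fr.basis.coord j z
      + eulerCoeff v * (algebraMap ℂ _ (fr.fac j - ζ) * fr.basis.coord j z) := by
  have h1 : M.eulerOp v ζ z
      = eulerCoeff v • (M.conn v z - algebraMap ℂ (LocalField v) ζ • z) := by
    rw [algebraMap_smul_compl]; rfl
  have h2 := eulerCoeff_ne_zero v
  rw [h1, map_smul, map_sub, map_smul, coord_conn, der, AddMonoidHom.comp_apply,
    AddMonoidHom.coe_mulLeft, map_sub]
  simp only [smul_eq_mul]
  field_simp
  ring

theorem cf_eulerOp {ζ : ℂ} (hζ : v.Adm ζ) (z : M.Compl v) (j : fr.ι) (n : ℤ) :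
    fr.cf (M.eulerOp v ζ z) j n
      = (n + fr.exp j) * fr.cf z j n - (fr.fac j - ζ) * fr.cf z j (n + 1) := by
  rw [cf, coord_eulerOp]
  cases v with
  | fin p =>
    rw [fr.fac_fin p rfl, hζ p rfl]
    simp [coeff_euler, cf, add_mul]
  | infty =>
    simp only [coeff_add, coeff_euler, coeff_algebraMap_mul, eulerCoeff, neg_mul, coeff_neg,
      coeff_t_inv_mul, cf]
    ring

/-- The operator minus α multiplies the coefficient of order n by n + exp j - α and subtracts (fac j
- ζ) times the coefficient of order n + 1. Where the factor is ζ this is diagonal, so generalized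
eigenvectors are eigenvectors. Where it is not, each coefficient of an eigenvector determines the
next one, and vanishing propagates upwards from the order of the pole. -/
theorem mem_psi_iff {ζ : ℂ} (hζ : v.Adm ζ) (α : ℂ) (z : M.Compl v) :
    z ∈ M.psi v ζ α ↔ ∀ j (n : ℤ), ¬ (fr.fac j = ζ ∧ n + fr.exp j = α) → fr.cf z j n = 0 := by
  have key : ∀ w : M.Compl v, ∀ j (n : ℤ), fr.cf ((M.eulerOp v ζ - algebraMap ℂ (Module.End ℂ (M.Compl v)) α) w) j n
      = (n + fr.exp j - α) * fr.cf w j n - (fr.fac j - ζ) * fr.cf w j (n + 1) := by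
    intro w j n
    rw [LinearMap.sub_apply, cf_sub, fr.cf_eulerOp hζ, Module.algebraMap_end_apply, cf_smul]
    ring
  constructor
  · intro hz
    obtain ⟨k, hk⟩ := (Module.End.mem_maxGenEigenspace _ _ _).1 hz
    rw [← Algebra.algebraMap_eq_smul_one] at hk
    induction k generalizing z with
    | zero =>
      have : z = 0 := by simpa using hk
      simp [this]
    | succ k ih =>
      have ih' := ih ((M.eulerOp v ζ - algebraMap ℂ (Module.End ℂ (M.Compl v)) α) z)
        ((Module.End.mem_maxGenEigenspace _ _ _).2 ⟨k, by
          rw [← Algebra.algebraMap_eq_smul_one, ← Module.End.mul_apply, ← pow_succ]; exact hk⟩)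
        (by rw [← Module.End.mul_apply, ← pow_succ]; exact hk)
      simp only [key] at ih'
      intro j n hn
      by_cases hj : fr.fac j = ζ
      · have h1 := ih' j n hn
        rw [hj, sub_self, zero_mul, sub_zero] at h1
        refine (mul_eq_zero.1 h1).resolve_left fun h => hn ⟨hj, ?_⟩
        linear_combination h
      · have h0 : ∀ n : ℤ, (n + fr.exp j - α) * fr.cf z j n - (fr.fac j - ζ) * fr.cf z j (n + 1) = 0 :=
          fun n => ih' j n fun h => hj h.1
        obtain ⟨N, hN⟩ := exists_ordGE (fr.basis.coord j z)
        have hall : ∀ k : ℕ, fr.cf z j (N + k) = 0 := by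
          intro k
          induction k with
          | zero =>
            have := h0 (N - 1)
            rw [show fr.cf z j (N - 1) = 0 from hN _ (by omega), mul_zero, zero_sub, neg_eq_zero,
              sub_add_cancel] at this
            simpa using (mul_eq_zero.1 this).resolve_left (sub_ne_zero.2 hj)
          | succ k ihk =>
            have := h0 (N + k)
            rw [ihk, mul_zero, zero_sub, neg_eq_zero] at this
            have := (mul_eq_zero.1 this).resolve_left (sub_ne_zero.2 hj)
            rw [← this]; push_cast; ring_nf
        rcases lt_or_ge n N with h | h
        · exact hN n h
        · obtain ⟨k, hk⟩ := Int.eq_ofNat_of_zero_le (sub_nonneg.2 h)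
          have := hall k
          rwa [← hk, add_sub_cancel] at this
  · intro h
    refine (Module.End.mem_maxGenEigenspace _ _ _).2 ⟨1, ?_⟩
    rw [← Algebra.algebraMap_eq_smul_one, pow_one]
    apply fr.ext_cf
    intro j n
    rw [key, cf_zero]
    by_cases hj : fr.fac j = ζ
    · rw [hj, sub_self, zero_mul, sub_zero]
      by_cases hn : n + fr.exp j = α
      · rw [hn, sub_self, zero_mul]
      · rw [h j n fun h => hn h.2, mul_zero]
    · rw [h j n fun h => hj h.1, h j (n + 1) fun h => hj h.1, mul_zero, mul_zero, sub_zero]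

theorem cf_smul_basis (g : LocalField v) (i j : fr.ι) (n : ℤ) [Decidable (i = j)] :
    fr.cf (g • fr.basis i) j n = if i = j then coeff g n else 0 := by
  classical
  rw [cf, map_smul, smul_eq_mul, Module.Basis.coord_apply, Module.Basis.repr_self,
    Finsupp.single_apply]
  by_cases h : i = j <;> simp [h]

theorem smul_basis_mem_psi (j : fr.ι) (n : ℤ) (c : ℂ) (hζ : v.Adm (fr.fac j)) :
    (algebraMap ℂ (LocalField v) c * t v ^ n) • fr.basis j
      ∈ M.psi v (fr.fac j) (n + fr.exp j) := by
  classical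
  rw [fr.mem_psi_iff hζ]
  intro i k hik
  rw [cf_smul_basis]
  split_ifs with h
  · subst h
    rw [coeff_algebraMap_mul, coeff_t_zpow, if_neg, mul_zero]
    rintro rfl
    exact hik ⟨rfl, rfl⟩
  · rfl

theorem adm_fac (j : fr.ι) : v.Adm (fr.fac j) := fun p hp => fr.fac_fin p hp j

/-- The condition on coefficients is linear and holds on each of the three spaces that span
`offPsi`. Conversely, a coordinate with factor ζ is cut into finitely many monomials, which are
eigenvectors, and a tail with exponents of real part larger than that of α, which is a power series
multiple of one eigenvector. A coordinate with another factor is a Laurent multiple of an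
eigenvector for that factor. -/
theorem mem_offPsi_iff {ζ : ℂ} (hζ : v.Adm ζ) (α : ℂ) (z : M.Compl v) :
    z ∈ M.offPsi v ζ α ↔ ∀ j (n : ℤ), fr.fac j = ζ → n + fr.exp j = α → fr.cf z j n = 0 := by
  classical
  constructor
  · let S : Submodule ℂ (M.Compl v) :=
      { carrier := {z | ∀ j (n : ℤ), fr.fac j = ζ → n + fr.exp j = α → fr.cf z j n = 0}
        add_mem' := fun ha hb j n h1 h2 => by rw [cf_add, ha j n h1 h2, hb j n h1 h2, add_zero]
        zero_mem' := fun j n _ _ => fr.cf_zero j n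
        smul_mem' := fun c z hz j n h1 h2 => by rw [cf_smul, hz j n h1 h2, mul_zero] }
    suffices h : M.offPsi v ζ α ≤ S from fun hz => h hz
    refine sup_le (sup_le ?_ ?_) ?_
    · refine iSup₂_le fun α' hα' w hw j n hj hn => ?_
      rw [fr.mem_psi_iff hζ] at hw
      exact hw j n fun h => hα' (h.2.symm.trans hn)
    · refine Submodule.span_le.2 ?_
      rintro _ ⟨g, α', w, hre, hw, rfl⟩ j n hj hn
      rw [fr.mem_psi_iff hζ] at hw
      have hord : OrdGE (fr.basis.coord j w) (n + 1) := by
        intro k hk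
        refine hw j k fun h => ?_
        have h1 := congrArg Complex.re h.2
        have h2 := congrArg Complex.re hn
        simp only [Complex.add_re, Complex.intCast_re] at h1 h2
        have : (k : ℝ) ≤ n := by exact_mod_cast (by omega : k ≤ n)
        linarith
      have := (ordGE_ofPowerSeries (v := v) g).mul hord
      rw [cf, map_smul, smul_eq_mul]
      exact this n (by omega)
    · cases v with
      | fin p => exact bot_le
      | infty =>
        refine Submodule.span_le.2 ?_
        rintro _ ⟨g, ξ', α', w, hξ, hw, rfl⟩ j n hj hn
        rw [fr.mem_psi_iff (Place.adm_infty ξ')] at hw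
        have : fr.basis.coord j w = 0 := by
          ext k
          exact hw j k fun h => hξ (h.1.symm.trans hj)
        rw [cf, map_smul, this, smul_zero, LocalField.coeff_zero]
  · intro hz
    rw [← fr.basis.sum_repr z]
    refine Submodule.sum_mem _ fun j _ => ?_
    by_cases hj : fr.fac j = ζ
    · set g := fr.basis.repr z j with hg
      obtain ⟨N0, hN0⟩ := exists_ordGE g
      obtain ⟨N1, hN1⟩ := exists_int_gt ((α - fr.exp j).re)
      set N := max N0 N1
      have hfin : g = ∑ n ∈ Finset.Ico N0 N, algebraMap ℂ _ (coeff g n) * t v ^ n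
          + (g - ∑ n ∈ Finset.Ico N0 N, algebraMap ℂ _ (coeff g n) * t v ^ n) := by abel
      have hord : OrdGE (g - ∑ n ∈ Finset.Ico N0 N, algebraMap ℂ _ (coeff g n) * t v ^ n) N := by
        intro k hk
        simp only [LocalField.coeff_sub, LocalField.coeff_sum, coeff_algebraMap_mul, coeff_t_zpow, mul_ite, mul_one,
          mul_zero, Finset.sum_ite_eq]
        split_ifs with h
        · exact sub_self _
        · rw [hN0 k (by
            simp only [Finset.mem_Ico, not_and, not_lt] at h
            by_contra h'
            exact absurd (h (by omega)) (by omega)), sub_zero]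
      obtain ⟨h, hh⟩ := ordGE_iff.1 hord
      rw [hfin, hh, add_smul, Finset.sum_smul]
      refine Submodule.add_mem _ (Submodule.sum_mem _ fun n hn => ?_) ?_
      · by_cases hα : n + fr.exp j = α
        · have : coeff g n = 0 := hz j n hj hα
          rw [this, map_zero, zero_mul, zero_smul]
          exact Submodule.zero_mem _
        · refine Submodule.mem_sup_left (Submodule.mem_sup_left ?_)
          refine Submodule.mem_iSup_of_mem (n + fr.exp j) (Submodule.mem_iSup_of_mem hα ?_)
          rw [← hj]
          exact fr.smul_basis_mem_psi j n _ (fr.adm_fac j)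
      · refine Submodule.mem_sup_left (Submodule.mem_sup_right (Submodule.subset_span ?_))
        refine ⟨h, N + fr.exp j, t v ^ N • fr.basis j, ?_, ?_, ?_⟩
        · rw [Complex.add_re, Complex.intCast_re]
          rw [Complex.sub_re] at hN1
          have : (N1 : ℝ) ≤ N := by exact_mod_cast le_max_right _ _
          linarith
        · rw [← hj]
          simpa using fr.smul_basis_mem_psi j N 1 (fr.adm_fac j)
        · rw [smul_smul, mul_comm]
    · cases v with
      | fin p => exact absurd ((fr.fac_fin p rfl j).trans (hζ p rfl).symm) hj
      | infty =>
        refine Submodule.mem_sup_right (Submodule.subset_span ?_)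
        refine ⟨_, fr.fac j, fr.exp j, fr.basis j, hj, ?_, rfl⟩
        simpa using fr.smul_basis_mem_psi j 0 1 (fr.adm_fac j)

theorem isComponent_iff {ζ : ℂ} (hζ : v.Adm ζ) (α : ℂ) (m : M) (w : M.Compl v) :
    M.IsComponent v ζ α m w ↔ w ∈ M.psi v ζ α ∧ ∀ j (n : ℤ), fr.fac j = ζ → n + fr.exp j = α →
      fr.cf w j n = fr.cf (1 ⊗ₜ m) j n := by
  rw [IsComponent, fr.mem_offPsi_iff hζ]
  refine and_congr_right fun _ => forall_congr' fun j => forall_congr' fun n =>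
    imp_congr_right fun _ => imp_congr_right fun _ => ?_
  rw [cf_sub, sub_eq_zero, eq_comm]

/-- A vector of `psi` is determined by its coefficients with the right eigenvalue. -/
theorem psi_ext {ζ : ℂ} (hζ : v.Adm ζ) {α : ℂ} {w w' : M.Compl v} (hw : w ∈ M.psi v ζ α)
    (hw' : w' ∈ M.psi v ζ α)
    (h : ∀ j (n : ℤ), fr.fac j = ζ → n + fr.exp j = α → fr.cf w j n = fr.cf w' j n) : w = w' := by
  rw [fr.mem_psi_iff hζ] at hw hw'
  refine fr.ext_cf fun j n => ?_
  by_cases hj : fr.fac j = ζ ∧ n + fr.exp j = α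
  · exact h j n hj.1 hj.2
  · rw [hw j n hj, hw' j n hj]

/-- There is a vector of `psi` with the same coefficients of the given eigenvalue as `z`. -/
theorem exists_psi_part {ζ : ℂ} (hζ : v.Adm ζ) (α : ℂ) (z : M.Compl v) :
    ∃ w ∈ M.psi v ζ α, ∀ j (n : ℤ), fr.fac j = ζ → n + fr.exp j = α → fr.cf w j n = fr.cf z j n := by
  classical
  have hex : ∀ j, ∃ g : LocalField v, ∀ n : ℤ, coeff g n =
      if fr.fac j = ζ ∧ n + fr.exp j = α then fr.cf z j n else 0 := by
    intro j
    by_cases h : fr.fac j = ζ ∧ ∃ n : ℤ, n + fr.exp j = α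
    · obtain ⟨hj, k, hk⟩ := h
      refine ⟨algebraMap ℂ _ (fr.cf z j k) * t v ^ k, fun n => ?_⟩
      rw [coeff_algebraMap_mul, coeff_t_zpow]
      have : n = k ↔ n + fr.exp j = α := by
        rw [← hk, add_left_inj, Int.cast_inj]
      by_cases hn : n = k
      · rw [if_pos hn, if_pos ⟨hj, this.1 hn⟩, mul_one, hn]
      · rw [if_neg hn, if_neg fun h => hn (this.2 h.2), mul_zero]
    · exact ⟨0, fun n => by rw [if_neg fun h' => h ⟨h'.1, n, h'.2⟩, LocalField.coeff_zero]⟩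
  choose g hg using hex
  have hc : ∀ j (n : ℤ), fr.cf (∑ i, g i • fr.basis i) j n = coeff (g j) n := by
    intro j n
    rw [cf, Module.Basis.coord_apply, Module.Basis.repr_sum_self]
  refine ⟨∑ i, g i • fr.basis i, ?_, ?_⟩
  · rw [fr.mem_psi_iff hζ]
    intro j n h
    rw [hc, hg, if_neg h]
  · intro j n h1 h2
    rw [hc, hg, if_pos ⟨h1, h2⟩]

end Frame

end WeylModule

/-! ### Units at a point, and completions of localizations. -/

namespace LocalField

theorem polePoly_eq_mul {P : Finset ℂ} {p : ℂ} (hp : p ∈ P) :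
    polePoly P = (X - C p) * polePoly (P.erase p) := by
  classical exact (Finset.mul_prod_erase P _ hp).symm

theorem eval_polePoly_erase_ne_zero (P : Finset ℂ) (p : ℂ) : (polePoly (P.erase p)).eval p ≠ 0 := by
  rw [polePoly, Polynomial.eval_prod, Finset.prod_ne_zero_iff]
  intro q hq
  simpa [sub_eq_zero] using (Finset.ne_of_mem_erase hq).symm

theorem ordGE_polePoly_fin {P : Finset ℂ} {p : ℂ} (hp : p ∈ P) :
    OrdGE (algebraMap ℂ[X] (LocalField (.fin p)) (polePoly P)) 1 := by
  rw [polePoly_eq_mul hp, map_mul, algebraMap_X_sub_C]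
  simpa using (ordGE_t_zpow (v := .fin p) 1).mul (ordGE_algebraMap_fin p _)

theorem ordGE_algebraMap_infty (f : ℂ[X]) :
    OrdGE (algebraMap ℂ[X] (LocalField .infty) f) (-f.natDegree) := by
  intro n hn
  rw [coeff_algebraMap_infty]
  split_ifs
  · exact Polynomial.coeff_eq_zero_of_natDegree_lt (by omega)
  · rfl

/-- A power series at `p` with non-zero constant term has an inverse. -/
theorem exists_inv_of_eval_ne_zero {p : ℂ} {f : ℂ[X]} (hf : f.eval p ≠ 0) :
    ∃ h : PowerSeries ℂ,
      ofPowerSeries (.fin p) h * algebraMap ℂ[X] (LocalField (.fin p)) f = 1 := by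
  have hu : IsUnit ((f.comp (X + C p) : ℂ[X]) : PowerSeries ℂ) := by
    rw [PowerSeries.isUnit_iff_constantCoeff, Polynomial.constantCoeff_coe,
      Polynomial.coeff_zero_eq_eval_zero, Polynomial.eval_comp]
    simpa using hf
  obtain ⟨h, hh⟩ := hu.exists_left_inv
  exact ⟨h, by rw [algebraMap_fin, ← map_mul, hh, map_one]⟩

/-- Multiplication of the coefficients by given scalars, from the Laurent series at a place to those
at another one. -/
def rescale (v v' : Place) (c : ℤ → ℂ) : LocalField v →ₗ[ℂ] LocalField v' where
  toFun g := (show LocalField v' from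
    { coeff := fun n => c n * coeff g n
      isPWO_support' := (HahnSeries.isPWO_support (show LaurentSeries ℂ from g)).mono
        fun n hn h => hn (by
          change c n * HahnSeries.coeff (show LaurentSeries ℂ from g) n = 0
          rw [h, mul_zero]) } : LocalField v')
  map_add' g h := by
    apply LocalField.ext
    intro n
    exact mul_add _ _ _
  map_smul' a g := by
    apply LocalField.ext
    intro n
    rw [RingHom.id_apply, coeff_smul]
    change c n * coeff (a • g) n = a * (c n * coeff g n)
    rw [coeff_smul]; ring

@[simp] theorem coeff_rescale {v v' : Place} (c : ℤ → ℂ) (g : LocalField v) (n : ℤ) :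
    coeff (rescale v v' c g) n = c n * coeff g n := rfl

end LocalField

namespace WeylModule

open LocalField

theorem smul_one_tmul {M : WeylModule.{u}} {v : Place} (f : ℂ[X]) (m : M) :
    (1 : LocalField v) ⊗ₜ[ℂ[X]] (f • m) = algebraMap ℂ[X] (LocalField v) f • (1 ⊗ₜ[ℂ[X]] m) := by
  rw [TensorProduct.smul_tmul', ← TensorProduct.smul_tmul, Algebra.smul_def, smul_eq_mul]

theorem tmul_eq_smul {M : WeylModule.{u}} {v : Place} (g : LocalField v) (m : M) :
    g ⊗ₜ[ℂ[X]] m = g • ((1 : LocalField v) ⊗ₜ[ℂ[X]] m) := by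
  rw [TensorProduct.smul_tmul', smul_eq_mul, mul_one]

theorem one_tmul_mem_of_smul_mem {M : WeylModule.{u}} {v : Place}
    {S : Submodule (LocalField v) (M.Compl v)} {f : ℂ[X]} (hf : f ≠ 0) {m : M}
    (h : (1 : LocalField v) ⊗ₜ[ℂ[X]] (f • m) ∈ S) : (1 : LocalField v) ⊗ₜ[ℂ[X]] m ∈ S := by
  rw [smul_one_tmul] at h
  have := S.smul_mem (algebraMap ℂ[X] (LocalField v) f)⁻¹ h
  rwa [smul_smul, inv_mul_cancel₀ (algebraMap_ne_zero hf), one_smul] at this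

theorem eq_top_of_one_tmul_mem {M : WeylModule.{u}} {v : Place}
    {S : Submodule (LocalField v) (M.Compl v)}
    (h : ∀ m : M, (1 : LocalField v) ⊗ₜ[ℂ[X]] m ∈ S) : S = ⊤ := by
  rw [eq_top_iff]
  intro z _
  induction z using TensorProduct.induction_on with
  | zero => exact S.zero_mem
  | add a b ha hb => exact S.add_mem (ha trivial) (hb trivial)
  | tmul g m => rw [tmul_eq_smul]; exact S.smul_mem _ (h m)

section Localize

variable (A : WeylModule.{u}) (g : ℂ[X])

/-- The canonical map into the localization, as a linear map. -/
def toLocalizeLin : A →ₗ[ℂ[X]] A.localize g :=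
  LocalizedModule.mkLinearMap (Submonoid.powers g) A

theorem D_toLocalizeLin (a : A) :
    (A.localize g).D (A.toLocalizeLin g a) = A.toLocalizeLin g (A.D a) := by
  change LocalizedModule.mk (((1 : Submonoid.powers g) : ℂ[X]) • A.D a
    - derivative ((1 : Submonoid.powers g) : ℂ[X]) • a) (1 * 1) = LocalizedModule.mk _ 1
  simp

theorem localize_bijective : Function.Bijective (fun z : A.localize g => g • z) := by
  have h := IsLocalizedModule.map_units (LocalizedModule.mkLinearMap (Submonoid.powers g) A)
    ⟨g, Submonoid.mem_powers g⟩
  exact (Module.End.isUnit_iff _).1 h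

theorem exists_pow_smul_eq (z : A.localize g) : ∃ (k : ℕ) (a : A), g ^ k • z = A.toLocalizeLin g a := by
  obtain ⟨⟨a, s⟩, h⟩ := IsLocalizedModule.surj (Submonoid.powers g)
    (LocalizedModule.mkLinearMap (Submonoid.powers g) A) z
  obtain ⟨k, hk⟩ := s.2
  refine ⟨k, a, ?_⟩
  have h' : (s : ℂ[X]) • z = A.toLocalizeLin g a := h
  rw [← h']
  exact congrArg (· • z) hk

variable {A g}

theorem localize_eq_top (hg : g ≠ 0) {v : Place}
    {S : Submodule (LocalField v) ((A.localize g).Compl v)}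
    (h : ∀ a, (1 : LocalField v) ⊗ₜ[ℂ[X]] A.toLocalizeLin g a ∈ S) : S = ⊤ := by
  refine eq_top_of_one_tmul_mem fun m => ?_
  obtain ⟨k, a, hk⟩ := A.exists_pow_smul_eq g m
  exact one_tmul_mem_of_smul_mem (pow_ne_zero k hg) (hk ▸ h a)

/-- Non-zero polynomials are invertible in the field of Laurent series, so expansions defined on `A`
extend to the localization, and then linearly to its completion. -/
theorem exists_extension (hg : g ≠ 0) {v : Place} {ι : Type} (θ : ι → (A →ₗ[ℂ[X]] LocalField v)) :
    ∃ Θ : (A.localize g).Compl v →ₗ[LocalField v] (ι → LocalField v),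
      ∀ a i, Θ (1 ⊗ₜ A.toLocalizeLin g a) i = θ i a := by
  have hu : ∀ x : Submonoid.powers g,
      IsUnit ((algebraMap ℂ[X] (Module.End ℂ[X] (ι → LocalField v))) x) := by
    rintro ⟨_, k, rfl⟩
    rw [Module.End.isUnit_iff]
    have hk := algebraMap_ne_zero (v := v) (pow_ne_zero k hg)
    constructor
    · intro a b hab
      funext i
      have := congrFun hab i
      simp only [Module.algebraMap_end_apply, Pi.smul_apply, Algebra.smul_def] at this
      exact mul_left_cancel₀ hk this
    · intro b
      refine ⟨fun i => (algebraMap ℂ[X] (LocalField v) (g ^ k))⁻¹ * b i, ?_⟩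
      funext i
      simp only [Module.algebraMap_end_apply, Pi.smul_apply, Algebra.smul_def]
      rw [mul_inv_cancel_left₀ hk]
  let φ : A.localize g →ₗ[ℂ[X]] (ι → LocalField v) :=
    LocalizedModule.lift (Submonoid.powers g) (LinearMap.pi θ) hu
  refine ⟨LinearMap.liftBaseChange (LocalField v) φ, fun a i => ?_⟩
  rw [LinearMap.liftBaseChange_tmul, one_smul]
  have := LocalizedModule.lift_comp (Submonoid.powers g) (LinearMap.pi θ) hu
  exact congrFun (congrArg (fun ψ : A →ₗ[ℂ[X]] (ι → LocalField v) => ψ a) this) i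

/-- Coordinates that are compatible with the connection on `A` are so on the completion. -/
theorem extension_conn (hg : g ≠ 0) {v : Place} {ι : Type} {θ : ι → (A →ₗ[ℂ[X]] LocalField v)}
    (lam : ι → LocalField v) (hθ : ∀ i a, θ i (A.D a) = der v (θ i a) + lam i * θ i a)
    {Θ : (A.localize g).Compl v →ₗ[LocalField v] (ι → LocalField v)}
    (hΘ : ∀ a i, Θ (1 ⊗ₜ A.toLocalizeLin g a) i = θ i a) (z : (A.localize g).Compl v) (i : ι) :
    Θ ((A.localize g).conn v z) i = der v (Θ z i) + lam i * Θ z i := by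
  let S : Submodule (LocalField v) ((A.localize g).Compl v) :=
    { carrier := {z | Θ ((A.localize g).conn v z) i = der v (Θ z i) + lam i * Θ z i}
      add_mem' := fun {a b} ha hb => by
        simp only [Set.mem_ofPred_eq, map_add, Pi.add_apply] at *
        rw [ha, hb]; ring
      zero_mem' := by simp
      smul_mem' := fun c z hz => by
        simp only [Set.mem_ofPred_eq, conn_smul, map_add, map_smul, Pi.add_apply, Pi.smul_apply,
          smul_eq_mul, der_mul] at *
        rw [hz]; ring }
  have : S = ⊤ := localize_eq_top hg fun a => by
    change Θ ((A.localize g).conn v _) i = der v (Θ _ i) + lam i * Θ _ i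
    have h1 : der v (1 : LocalField v) = 0 := by simpa using der_algebraMap v 1
    rw [conn_tmul, h1, TensorProduct.zero_tmul, zero_add, D_toLocalizeLin, hΘ, hΘ, hθ]
  exact (this ▸ Submodule.mem_top : z ∈ S)

end Localize

end WeylModule

/-! ### From formal expansions to a bundle: finite generation and the frame at infinity. -/

namespace WeylModule

open LocalField

/-- Formal expansions of the elements of a module over the Weyl algebra, at infinity and at the
points of a finite set `Q`, which are compatible with connections of rank one, such that the
elements whose expansions have bounded poles form a finite-dimensional space. -/
structure Expansions (A : WeylModule.{u}) (Q : Finset ℂ) where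
  I : Type
  [fintypeI : Fintype I]
  facI : I → ℂ
  expI : I → ℂ
  θI : I → (A →ₗ[ℂ[X]] LocalField .infty)
  θI_D : ∀ i a, θI i (A.D a) = der .infty (θI i a)
    + (algebraMap ℂ _ (facI i) + (eulerCoeff .infty)⁻¹ * algebraMap ℂ _ (expI i)) * θI i a
  J : ℂ → Type
  [fintypeJ : ∀ η, Fintype (J η)]
  expJ : ∀ η, J η → ℂ
  θJ : ∀ η, J η → (A →ₗ[ℂ[X]] LocalField (.fin η))
  θJ_D : ∀ η j a, θJ η j (A.D a) = der (.fin η) (θJ η j a)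
    + ((eulerCoeff (.fin η))⁻¹ * algebraMap ℂ _ (expJ η j)) * θJ η j a
  expJ_ne : ∀ η j, ∀ n : ℤ, expJ η j ≠ n
  finite : ∀ n k : ℤ, ∃ s : Finset A, ∀ a : A, (∀ i, OrdGE (θI i a) (-k)) →
    (∀ η ∈ Q, ∀ j, OrdGE (θJ η j a) (-n)) → a ∈ Submodule.span ℂ (s : Set A)
  spanI : Submodule.span (LocalField .infty) (Set.range fun (a : A) i => θI i a) = ⊤
  spanJ : ∀ η ∈ Q, Submodule.span (LocalField (.fin η)) (Set.range fun (a : A) j => θJ η j a) = ⊤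

attribute [instance] Expansions.fintypeI Expansions.fintypeJ

instance (A : WeylModule.{u}) : IsScalarTower ℂ ℂ[X] A := ⟨fun c f a => by
  rw [complex_smul_def, smul_smul, Polynomial.smul_eq_C_mul]⟩

namespace Expansions

variable {A : WeylModule.{u}} {Q : Finset ℂ} (E : A.Expansions Q)

theorem θI_smul (i : E.I) (c : ℂ) (a : A) : E.θI i (c • a) = c • E.θI i a := by
  rw [complex_smul_def, map_smul, Algebra.smul_def, algebraMap_C, ← Algebra.smul_def]

theorem θJ_smul (η : ℂ) (j : E.J η) (c : ℂ) (a : A) : E.θJ η j (c • a) = c • E.θJ η j a := by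
  rw [complex_smul_def, map_smul, Algebra.smul_def, algebraMap_C, ← Algebra.smul_def]

/-- The elements with poles of order at most `k` at infinity and at most `n` at the points
of `Q`. -/
def W (n k : ℤ) : Submodule ℂ A where
  carrier := {a | (∀ i, OrdGE (E.θI i a) (-k)) ∧ ∀ η ∈ Q, ∀ j, OrdGE (E.θJ η j a) (-n)}
  add_mem' := fun ha hb => ⟨fun i => by rw [map_add]; exact (ha.1 i).add (hb.1 i),
    fun η hη j => by rw [map_add]; exact (ha.2 η hη j).add (hb.2 η hη j)⟩
  zero_mem' := ⟨fun i => by rw [map_zero]; exact ordGE_zero _,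
    fun η _ j => by rw [map_zero]; exact ordGE_zero _⟩
  smul_mem' := fun c a ha => ⟨fun i => by rw [θI_smul]; exact (ha.1 i).smul c,
    fun η hη j => by rw [θJ_smul]; exact (ha.2 η hη j).smul c⟩

theorem W_mono {n k n' k' : ℤ} (hn : n ≤ n') (hk : k ≤ k') : E.W n k ≤ E.W n' k' :=
  fun _ ha => ⟨fun i => (ha.1 i).mono (by omega), fun η hη j => (ha.2 η hη j).mono (by omega)⟩

theorem exists_mem_W (a : A) : ∃ n k : ℕ, a ∈ E.W n k := by
  choose N hN using fun i => exists_ordGE (E.θI i a)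
  choose K hK using fun η j => exists_ordGE (E.θJ η j a)
  refine ⟨∑ η ∈ Q, ∑ j, (K η j).natAbs, ∑ i, (N i).natAbs, fun i => (hN i).mono ?_,
    fun η hη j => (hK η j).mono ?_⟩
  · have := Finset.single_le_sum (f := fun i => (N i).natAbs) (fun _ _ => Nat.zero_le _)
      (Finset.mem_univ i)
    omega
  · have h1 := Finset.single_le_sum (f := fun j => (K η j).natAbs) (fun _ _ => Nat.zero_le _)
      (Finset.mem_univ j)
    have h2 := Finset.single_le_sum (f := fun η => ∑ j, (K η j).natAbs)
      (fun _ _ => Nat.zero_le _) hη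
    omega

instance (n k : ℤ) : FiniteDimensional ℂ (E.W n k) := by
  obtain ⟨s, hs⟩ := E.finite n k
  have : FiniteDimensional ℂ (Submodule.span ℂ (s : Set A)) := inferInstance
  exact Submodule.finiteDimensional_of_le (fun a ha => hs a ha.1 ha.2)

theorem smul_mem_W {n k : ℤ} {a : A} (ha : a ∈ E.W n k) (f : ℂ[X]) :
    f • a ∈ E.W n (k + f.natDegree) := by
  refine ⟨fun i => ?_, fun η hη j => ?_⟩
  · rw [map_smul, Algebra.smul_def]
    exact ((ordGE_algebraMap_infty f).mul (ha.1 i)).mono (by omega)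
  · rw [map_smul, Algebra.smul_def]
    exact ((ordGE_algebraMap_fin η f).mul (ha.2 η hη j)).mono (by omega)

theorem natDegree_polePoly (P : Finset ℂ) : (polePoly P).natDegree = P.card := by
  rw [polePoly, Polynomial.natDegree_prod_of_monic _ _ fun p _ => Polynomial.monic_X_sub_C p]
  simp

theorem polePoly_smul_mem_W {n k : ℤ} {a : A} (ha : a ∈ E.W n k) :
    polePoly Q • a ∈ E.W (n - 1) (k + Q.card) := by
  refine ⟨fun i => ?_, fun η hη j => ?_⟩
  · have := (E.smul_mem_W ha (polePoly Q)).1 i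
    rwa [natDegree_polePoly] at this
  · rw [map_smul, Algebra.smul_def]
    exact ((ordGE_polePoly_fin hη).mul (ha.2 η hη j)).mono (by omega)

theorem polePoly_pow_smul_mem_W {n k : ℤ} {a : A} (ha : a ∈ E.W n k) (l : ℕ) :
    polePoly Q ^ l • a ∈ E.W (n - l) (k + l * Q.card) := by
  induction l with
  | zero => simpa using ha
  | succ l ih =>
    rw [pow_succ', mul_smul]
    have := E.polePoly_smul_mem_W ih
    push_cast
    convert this using 2 <;> ring

theorem D_mem_W {n k : ℤ} {a : A} (ha : a ∈ E.W n k) : A.D a ∈ E.W (n + 1) k := by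
  have ht : ∀ v, OrdGE (t v) 1 := fun v => by simpa using ordGE_t_zpow (v := v) 1
  refine ⟨fun i => ?_, fun η hη j => ?_⟩
  · rw [E.θI_D]
    refine ((ha.1 i).der_infty.mono (by omega)).add ?_
    have h1 : OrdGE (algebraMap ℂ (LocalField .infty) (E.facI i)
        + (eulerCoeff .infty)⁻¹ * algebraMap ℂ _ (E.expI i)) 0 := by
      refine (ordGE_algebraMap _).add ?_
      simp only [eulerCoeff, inv_neg, inv_inv, neg_mul]
      exact ((((ht _).mul (ordGE_algebraMap _))).mono (by omega)).neg
    exact (h1.mul (ha.1 i)).mono (by omega)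
  · rw [E.θJ_D]
    refine ((ha.2 η hη j).der_fin.mono (by omega)).add ?_
    have h1 : OrdGE ((eulerCoeff (.fin η))⁻¹ * algebraMap ℂ _ (E.expJ η j)) (-1) := by
      have := (ordGE_t_zpow (v := .fin η) (-1)).mul (ordGE_algebraMap (E.expJ η j))
      simpa [eulerCoeff] using this
    exact (h1.mul (ha.2 η hη j)).mono (by omega)

/-- The coefficients of order `-k` at infinity. -/
def lead (k : ℤ) : A →ₗ[ℂ] (E.I → ℂ) where
  toFun a i := coeff (E.θI i a) (-k)
  map_add' a b := by funext i; simp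
  map_smul' c a := by funext i; simp

theorem lead_X_pow_smul (k : ℤ) (l : ℕ) (a : A) :
    E.lead (k + l) ((X : ℂ[X]) ^ l • a) = E.lead k a := by
  funext i
  change coeff (E.θI i _) _ = coeff (E.θI i a) _
  rw [map_smul, Algebra.smul_def, map_pow, algebraMap_X_infty, inv_pow, ← zpow_natCast,
    ← zpow_neg, coeff_t_zpow_mul]
  congr 1; ring

theorem mem_W_of_lead_eq_zero {n k : ℤ} {a : A} (ha : a ∈ E.W n k) (h : E.lead k a = 0) :
    a ∈ E.W n (k - 1) := by
  refine ⟨fun i m hm => ?_, ha.2⟩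
  rcases eq_or_ne m (-k) with rfl | hne
  · exact congrFun h i
  · exact ha.1 i m (by omega)

/-- Up to a finite-dimensional space, the elements with poles of order at most `n` at the points
of `Q` are generated by at most `|I|` of them. -/
theorem exists_generators (n : ℤ) : ∃ (B : Finset A) (k₀ : ℕ), B.card ≤ Fintype.card E.I ∧
    ∀ (k : ℤ), ∀ a ∈ E.W n k, ∃ b ∈ Submodule.span ℂ[X] (B : Set A), b ∈ E.W n (max k k₀) ∧
      a - b ∈ E.W n k₀ := by
  classical
  -- The spaces of leading coefficients at infinity. They increase, because multiplication by X
  -- raises the pole order by one and keeps the leading coefficient, and they stabilize. Multiples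
  -- by powers of X of lifts of a basis of the stable space then cancel any leading coefficient of
  -- order beyond k₀.
  let S : ℕ →o Submodule ℂ (E.I → ℂ) :=
    { toFun := fun k => (E.W n k).map (E.lead k)
      monotone' := monotone_nat_of_le_succ fun k => by
        rintro _ ⟨a, ha, rfl⟩
        refine ⟨(X : ℂ[X]) ^ 1 • a, ?_, ?_⟩
        · have := E.smul_mem_W ha ((X : ℂ[X]) ^ 1)
          simpa using this
        · have := E.lead_X_pow_smul k 1 a
          simpa using this }
  obtain ⟨k₀, hk₀⟩ := monotone_stabilizes_iff_noetherian.2 (inferInstance :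
    IsNoetherian ℂ (E.I → ℂ)) S
  let c := Module.finBasis ℂ (S k₀)
  have hl : ∀ l, ∃ b ∈ E.W n k₀, E.lead k₀ b = c l := fun l => (c l).2
  choose b hbW hb using hl
  refine ⟨Finset.univ.image b, k₀, ?_, ?_⟩
  · refine Finset.card_image_le.trans ?_
    rw [Finset.card_univ, Fintype.card_fin]
    exact (Submodule.finrank_le _).trans (by simp)
  · have key : ∀ d : ℕ, ∀ a ∈ E.W n (k₀ + d),
        ∃ b' ∈ Submodule.span ℂ[X] ((Finset.univ.image b : Finset A) : Set A),
          b' ∈ E.W n (k₀ + d) ∧ a - b' ∈ E.W n k₀ := by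
      intro d
      induction d with
      | zero =>
        intro a ha
        exact ⟨0, Submodule.zero_mem _, Submodule.zero_mem _, by simpa using ha⟩
      | succ d ih =>
        intro a ha
        have h1 : E.lead (k₀ + (d + 1 : ℕ)) a ∈ S k₀ := by
          rw [hk₀ (k₀ + (d + 1)) (by omega)]
          exact ⟨a, by exact_mod_cast ha, by push_cast; rfl⟩
        set y : S k₀ := ⟨_, h1⟩
        set b₁ : A := ∑ l, c.repr y l • ((X : ℂ[X]) ^ (d + 1) • b l) with hb₁
        have hb₁W : b₁ ∈ E.W n (k₀ + (d + 1 : ℕ)) := by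
          refine Submodule.sum_mem _ fun l _ => Submodule.smul_mem _ _ ?_
          have := E.smul_mem_W (hbW l) ((X : ℂ[X]) ^ (d + 1))
          rwa [Polynomial.natDegree_X_pow] at this
        have hb₁s : b₁ ∈ Submodule.span ℂ[X] ((Finset.univ.image b : Finset A) : Set A) := by
          refine Submodule.sum_mem _ fun l _ => ?_
          rw [complex_smul_def]
          refine Submodule.smul_mem _ _ (Submodule.smul_mem _ _ (Submodule.subset_span ?_))
          simp
        have hlead : E.lead (k₀ + (d + 1 : ℕ)) b₁ = E.lead (k₀ + (d + 1 : ℕ)) a := by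
          rw [hb₁, map_sum]
          simp only [map_smul, lead_X_pow_smul, hb]
          have := congrArg Subtype.val (c.sum_repr y)
          simp only [Submodule.coe_sum, Submodule.coe_smul] at this
          exact this
        have h2 := E.mem_W_of_lead_eq_zero (Submodule.sub_mem _ ha hb₁W)
          (by rw [map_sub, hlead, sub_self])
        obtain ⟨b₂, hb₂s, hb₂W, hb₂⟩ := ih _ (by convert h2 using 2; push_cast; ring)
        refine ⟨b₁ + b₂, Submodule.add_mem _ hb₁s hb₂s, Submodule.add_mem _ hb₁W
          (E.W_mono le_rfl (by push_cast; omega) hb₂W), by rwa [← sub_sub]⟩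
    intro k a ha
    obtain ⟨d, hd⟩ : ∃ d : ℕ, max k k₀ = k₀ + d :=
      ⟨(max k k₀ - k₀).toNat, by omega⟩
    rw [hd]
    exact key d a (E.W_mono le_rfl (by omega) ha)

/-- The elements with poles of order at most `n` at the points of `Q` are finitely generated. -/
theorem exists_finite_generators (n : ℤ) : ∃ s : Finset A, ∀ (k : ℤ), ∀ a ∈ E.W n k,
    a ∈ Submodule.span ℂ[X] (s : Set A) := by
  classical
  obtain ⟨B, k₀, -, h⟩ := E.exists_generators n
  obtain ⟨s, hs⟩ := E.finite n k₀
  refine ⟨B ∪ s, fun k a ha => ?_⟩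
  obtain ⟨b, hb, -, hab⟩ := h k a ha
  rw [← sub_add_cancel a b]
  refine Submodule.add_mem _ ?_ (Submodule.span_mono (by simp) hb)
  have := hs _ hab.1 hab.2
  have h2 := Submodule.span_le_restrictScalars ℂ ℂ[X] (s : Set A) this
  exact Submodule.span_mono (by simp) h2

/-- A power of the pole polynomial removes the poles at Q of any given element, at the cost of poles
at infinity; and the elements without poles at Q lie in one finitely generated module, whatever
their order at infinity. -/
theorem isMeromorphicBundle (E : A.Expansions Q) :
    IsMeromorphicBundle Q (A.localize (polePoly Q)) := by
  classical
  refine ⟨A.localize_bijective _, ?_⟩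
  obtain ⟨s, hs⟩ := E.exists_finite_generators 0
  refine ⟨s.image (A.toLocalizeLin (polePoly Q)), fun z => ?_⟩
  obtain ⟨k, a, hk⟩ := A.exists_pow_smul_eq (polePoly Q) z
  obtain ⟨n, k', ha⟩ := E.exists_mem_W a
  refine ⟨n + k, ?_⟩
  rw [pow_add, mul_smul, hk, ← map_smul, Finset.coe_image, Submodule.span_image]
  refine Submodule.mem_map_of_mem (hs (k' + n * Q.card) _ ?_)
  have := E.polePoly_pow_smul_mem_W ha n
  rwa [sub_self] at this

/-- Elements of a finite-dimensional space modulo `span B` are torsion modulo `span B`. -/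
theorem exists_smul_mem_span (n : ℤ) {B : Finset A} {k₀ : ℕ}
    (h : ∀ (k : ℤ), ∀ a ∈ E.W n k, ∃ b ∈ Submodule.span ℂ[X] (B : Set A), b ∈ E.W n (max k k₀) ∧
      a - b ∈ E.W n k₀) {k : ℤ} {a : A} (ha : a ∈ E.W n k) :
    ∃ f : ℂ[X], f ≠ 0 ∧ f • a ∈ Submodule.span ℂ[X] (B : Set A) := by
  have hl : ∀ l : ℕ, ∃ b ∈ Submodule.span ℂ[X] (B : Set A),
      (X : ℂ[X]) ^ l • a - b ∈ E.W n k₀ := fun l => by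
    obtain ⟨b, hb, -, h'⟩ := h _ _ (E.smul_mem_W ha ((X : ℂ[X]) ^ l))
    exact ⟨b, hb, h'⟩
  choose b hb hW using hl
  -- The remainders of all X^l a lie in one finite-dimensional space, so they satisfy a linear
  -- relation; its coefficients are those of f.
  let w : ℕ → E.W n k₀ := fun l => ⟨_, hW l⟩
  have hdep : ¬ LinearIndependent ℂ w := fun hli => by
    have := hli.lt_aleph0_of_finite
    simp at this
  rw [linearIndependent_iff] at hdep
  push Not at hdep
  obtain ⟨c, hc0, hc⟩ := hdep
  refine ⟨∑ l ∈ c.support, C (c l) * X ^ l, fun hf => hc ?_, ?_⟩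
  · ext l
    have := congrArg (fun q : ℂ[X] => q.coeff l) hf
    simp only [Polynomial.finsetSum_coeff, Polynomial.coeff_C_mul_X_pow, Finset.sum_ite_eq,
      Polynomial.coeff_zero] at this
    by_contra hne
    rw [if_pos (Finsupp.mem_support_iff.2 hne)] at this
    exact hne this
  · have h1 : ∑ l ∈ c.support, c l • ((X : ℂ[X]) ^ l • a - b l) = 0 := by
      have := congrArg Subtype.val hc0
      rw [Finsupp.linearCombination_apply, Finsupp.sum] at this
      simpa [w] using this
    have h2 : (∑ l ∈ c.support, C (c l) * X ^ l : ℂ[X]) • a = ∑ l ∈ c.support, C (c l) • b l := by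
      rw [Finset.sum_smul, ← sub_eq_zero, ← Finset.sum_sub_distrib, ← h1]
      refine Finset.sum_congr rfl fun l _ => ?_
      rw [complex_smul_def, smul_sub, mul_smul]
    rw [h2]
    exact Submodule.sum_mem _ fun l _ => Submodule.smul_mem _ _ (hb l)

/-- The expansions at infinity are the coordinates of a frame of the localization. -/
theorem exists_frame_infty : ∃ (fr : (A.localize (polePoly Q)).Frame .infty) (e : E.I ≃ fr.ι),
    (∀ i, fr.fac (e i) = E.facI i) ∧ (∀ i, fr.exp (e i) = E.expI i) ∧
    ∀ a i, fr.basis.coord (e i) (1 ⊗ₜ A.toLocalizeLin (polePoly Q) a) = E.θI i a := by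
  classical
  have hQ := polePoly_ne_zero Q
  obtain ⟨Θ, hΘ⟩ := exists_extension (A := A) hQ E.θI
  have hconn := extension_conn hQ _ E.θI_D hΘ
  have hsurj : Function.Surjective Θ := by
    rw [← LinearMap.range_eq_top, eq_top_iff, ← E.spanI, Submodule.span_le]
    rintro _ ⟨a, rfl⟩
    exact ⟨1 ⊗ₜ A.toLocalizeLin (polePoly Q) a, funext (hΘ a)⟩
  obtain ⟨B, k₀, hcard, hB⟩ := E.exists_generators 0
  set T : Finset ((A.localize (polePoly Q)).Compl .infty) :=
    B.image fun b => (1 : LocalField .infty) ⊗ₜ[ℂ[X]] A.toLocalizeLin (polePoly Q) b with hT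
  have hspan : Submodule.span (LocalField .infty)
      (T : Set ((A.localize (polePoly Q)).Compl .infty)) = ⊤ := by
    refine localize_eq_top hQ fun a => ?_
    obtain ⟨n, k, ha⟩ := E.exists_mem_W a
    refine one_tmul_mem_of_smul_mem (pow_ne_zero n hQ) ?_
    have h1 := E.polePoly_pow_smul_mem_W ha n
    rw [sub_self] at h1
    obtain ⟨f, hf, hfa⟩ := E.exists_smul_mem_span 0 hB h1
    refine one_tmul_mem_of_smul_mem hf ?_
    rw [← map_smul, ← map_smul]
    have hle : Submodule.span ℂ[X] (B : Set A) ≤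
        ((Submodule.span (LocalField .infty)
          (T : Set ((A.localize (polePoly Q)).Compl .infty))).restrictScalars ℂ[X]).comap
          ((TensorProduct.mk ℂ[X] (LocalField .infty) (A.localize (polePoly Q)) 1).comp
            (A.toLocalizeLin (polePoly Q))) := by
      rw [Submodule.span_le]
      intro b hb
      exact Submodule.subset_span (Finset.mem_coe.2 (Finset.mem_image_of_mem _ hb))
    exact hle hfa
  have hfd : Module.Finite (LocalField .infty) ((A.localize (polePoly Q)).Compl .infty) :=
    ⟨⟨T, hspan⟩⟩
  -- The images of at most |I| generators span, since elements that are torsion modulo these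
  -- generators come into their span over the Laurent series. So the surjection Θ onto a space of
  -- dimension |I| is bijective.
  have hle : Module.finrank (LocalField .infty) ((A.localize (polePoly Q)).Compl .infty)
      ≤ Fintype.card E.I := by
    rw [← finrank_top (LocalField .infty) ((A.localize (polePoly Q)).Compl .infty), ← hspan]
    exact (finrank_span_finset_le_card T).trans (Finset.card_image_le.trans hcard)
  have hge := LinearMap.finrank_le_finrank_of_surjective hsurj
  have heq : Module.finrank (LocalField .infty) ((A.localize (polePoly Q)).Compl .infty)
      = Module.finrank (LocalField .infty) (E.I → LocalField .infty) := by
    refine le_antisymm ?_ hge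
    simpa using hle
  have hinj := (LinearMap.injective_iff_surjective_of_finrank_eq_finrank heq).2 hsurj
  let Ψ := LinearEquiv.ofBijective Θ ⟨hinj, hsurj⟩
  refine ⟨⟨E.I, Module.Basis.ofEquivFun Ψ, E.facI, E.expI, fun _ h => Place.noConfusion h,
    fun i => hinj (funext fun i' => ?_)⟩, Equiv.refl _, fun _ => rfl, fun _ => rfl, fun a i => ?_⟩
  · have h1 : Θ (Module.Basis.ofEquivFun Ψ i) = Pi.single i 1 := by
      rw [Module.Basis.coe_ofEquivFun]
      exact Ψ.apply_symm_apply _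
    have hd : der .infty (1 : LocalField .infty) = 0 := by simpa using der_algebraMap .infty 1
    rw [hconn, map_smul, h1, Pi.smul_apply]
    by_cases hi : i' = i
    · subst hi; simp [hd]
    · simp [hi]
  · rw [← hΘ]
    rfl

end Expansions

end WeylModule

/-! ### Lattices at a finite point, and the frame there. -/

namespace LocalField

variable {v : Place}

instance : Algebra (PowerSeries ℂ) (LocalField v) := (ofPowerSeries v).toAlgebra

instance : IsFractionRing (PowerSeries ℂ) (LocalField v) :=
  (inferInstance : IsFractionRing (PowerSeries ℂ) (LaurentSeries ℂ))

/-- A lattice of power series contained in a finitely generated one has a basis. -/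
theorem exists_lattice_basis {V : Type*} [AddCommGroup V] [Module (LocalField v) V]
    (K : Submodule (LocalField v) V) (Λ : AddSubgroup V)
    (hΛ : ∀ (h : PowerSeries ℂ), ∀ z ∈ Λ, ofPowerSeries v h • z ∈ Λ)
    {ι : Type*} [Fintype ι] (s : ι → V)
    (hs : ∀ z ∈ Λ, ∃ c : ι → PowerSeries ℂ, z = ∑ i, ofPowerSeries v (c i) • s i)
    (hspan : ∀ z, ∃ N : ℕ, t v ^ N • z ∈ Λ) :
    ∃ (d : ℕ) (b : Module.Basis (Fin d) (LocalField v) K), (∀ i, (b i : V) ∈ Λ) ∧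
      ∀ z : K, (z : V) ∈ Λ → ∃ c : Fin d → PowerSeries ℂ, z = ∑ i, ofPowerSeries v (c i) • b i := by
  classical
  let : Module (PowerSeries ℂ) V := Module.compHom V (ofPowerSeries v)
  have hsmul : ∀ (h : PowerSeries ℂ) (z : V), h • z = ofPowerSeries v h • z := fun _ _ => rfl
  have : IsScalarTower (PowerSeries ℂ) (LocalField v) V := ⟨fun h g z => by
    rw [hsmul, Algebra.smul_def, mul_smul]; rfl⟩
  let : Module (PowerSeries ℂ) K := Module.compHom K (ofPowerSeries v)
  have hsmul' : ∀ (h : PowerSeries ℂ) (z : K), h • z = ofPowerSeries v h • z := fun _ _ => rfl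
  have : IsScalarTower (PowerSeries ℂ) (LocalField v) K := ⟨fun h g z => by
    rw [hsmul', Algebra.smul_def, mul_smul]; rfl⟩
  -- The part of the lattice in K embeds into a finitely generated module over the principal ideal
  -- domain of power series, so it is free of finite rank. Its basis is one of K over the fraction
  -- field, since a power of t moves any vector into the lattice.
  let Λ' : Submodule (PowerSeries ℂ) K :=
    { carrier := {z | (z : V) ∈ Λ}
      add_mem' := fun ha hb => Λ.add_mem ha hb
      zero_mem' := Λ.zero_mem
      smul_mem' := fun h z hz => hΛ h z hz }
  let S : Submodule (PowerSeries ℂ) V := Submodule.span _ (Set.range s)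
  have : IsNoetherian (PowerSeries ℂ) S :=
    isNoetherian_of_fg_of_noetherian S (Submodule.fg_span (Set.finite_range s))
  let f : Λ' →ₗ[PowerSeries ℂ] S :=
    { toFun := fun z => ⟨z.1, by
        obtain ⟨c, hc⟩ := hs z.1 z.2
        rw [hc]
        exact Submodule.sum_mem _ fun i _ => by
          rw [← hsmul]
          exact Submodule.smul_mem _ _ (Submodule.subset_span ⟨i, rfl⟩)⟩
      map_add' := fun _ _ => rfl
      map_smul' := fun _ _ => rfl }
  have hf : Function.Injective f := fun a b hab => by
    have := congrArg (fun x : S => (x : V)) hab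
    exact Subtype.ext (Subtype.ext this)
  have : IsNoetherian (PowerSeries ℂ) Λ' := isNoetherian_of_injective f hf
  have : Module.IsTorsionFree (PowerSeries ℂ) K :=
    Module.IsTorsionFree.trans_faithfulSMul (PowerSeries ℂ) (LocalField v) K
  have : Module.Free (PowerSeries ℂ) Λ' := inferInstance
  let b := Module.finBasis (PowerSeries ℂ) Λ'
  have hli : LinearIndependent (PowerSeries ℂ) (fun i => (b i : K)) :=
    b.linearIndependent.map' Λ'.subtype (Submodule.ker_subtype _)
  have hli' : LinearIndependent (LocalField v) (fun i => (b i : K)) :=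
    (LinearIndependent.iff_fractionRing (PowerSeries ℂ) (LocalField v)).1 hli
  have hrepr : ∀ z : K, (z : V) ∈ Λ →
      ∃ c : _ → PowerSeries ℂ, z = ∑ i, ofPowerSeries v (c i) • (b i : K) := by
    intro z hz
    refine ⟨b.repr ⟨z, hz⟩, ?_⟩
    have := congrArg Subtype.val (b.sum_repr ⟨z, (hz : z ∈ Λ')⟩)
    rw [Submodule.coe_sum] at this
    exact this.symm
  have htop : ⊤ ≤ Submodule.span (LocalField v) (Set.range fun i => (b i : K)) := by
    intro z _
    obtain ⟨N, hN⟩ := hspan z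
    have h1 : t v ^ N • z ∈ Submodule.span (LocalField v) (Set.range fun i => (b i : K)) := by
      obtain ⟨c, hc⟩ := hrepr (t v ^ N • z) hN
      rw [hc]
      exact Submodule.sum_mem _ fun i _ =>
        Submodule.smul_mem _ _ (Submodule.subset_span ⟨i, rfl⟩)
    have h2 := Submodule.smul_mem _ (t v ^ N)⁻¹ h1
    rwa [smul_smul, inv_mul_cancel₀ (pow_ne_zero _ (t_ne_zero v)), one_smul] at h2
  refine ⟨_, Module.Basis.mk hli' htop, fun i => ?_, fun z hz => ?_⟩
  · rw [Module.Basis.mk_apply]; exact (b i).2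
  · simp only [Module.Basis.mk_apply]
    exact hrepr z hz

end LocalField

namespace WeylModule

open LocalField

namespace Expansions

variable {A : WeylModule.{u}} {Q : Finset ℂ} (E : A.Expansions Q)

/-- The lattice in the completion at `η` generated by the elements with poles of order at most `n`
at the points of `Q`. -/
def lat (η : ℂ) (n : ℤ) : AddSubgroup ((A.localize (polePoly Q)).Compl (.fin η)) :=
  AddSubgroup.closure {z | ∃ (h : PowerSeries ℂ) (k : ℤ), ∃ a ∈ E.W n k,
    z = ofPowerSeries (.fin η) h • (1 ⊗ₜ[ℂ[X]] A.toLocalizeLin (polePoly Q) a)}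

variable {η : ℂ} {n : ℤ}

theorem smul_mem_lat (h : PowerSeries ℂ) {k : ℤ} {a : A} (ha : a ∈ E.W n k) :
    ofPowerSeries (.fin η) h • ((1 : LocalField (.fin η)) ⊗ₜ[ℂ[X]] A.toLocalizeLin (polePoly Q) a)
      ∈ E.lat η n := AddSubgroup.subset_closure ⟨h, k, a, ha, rfl⟩

theorem one_tmul_mem_lat {k : ℤ} {a : A} (ha : a ∈ E.W n k) :
    (1 : LocalField (.fin η)) ⊗ₜ[ℂ[X]] A.toLocalizeLin (polePoly Q) a ∈ E.lat η n := by
  simpa using E.smul_mem_lat 1 ha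

theorem ofPowerSeries_smul_mem_lat (h : PowerSeries ℂ)
    {z : (A.localize (polePoly Q)).Compl (.fin η)} (hz : z ∈ E.lat η n) :
    ofPowerSeries (.fin η) h • z ∈ E.lat η n := by
  induction hz using AddSubgroup.closure_induction with
  | mem z hz =>
    obtain ⟨h', k, a, ha, rfl⟩ := hz
    rw [smul_smul, ← map_mul]
    exact E.smul_mem_lat _ ha
  | zero => rw [smul_zero]; exact AddSubgroup.zero_mem _
  | add x y _ _ hx hy => rw [smul_add]; exact AddSubgroup.add_mem _ hx hy
  | neg x _ hx => rw [smul_neg]; exact AddSubgroup.neg_mem _ hx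

theorem conn_mem_lat {z : (A.localize (polePoly Q)).Compl (.fin η)} (hz : z ∈ E.lat η n) :
    (A.localize (polePoly Q)).conn (.fin η) z ∈ E.lat η (n + 1) := by
  induction hz using AddSubgroup.closure_induction with
  | mem z hz =>
    obtain ⟨h', k, a, ha, rfl⟩ := hz
    have h1 : der (.fin η) (1 : LocalField (.fin η)) = 0 := by simpa using der_algebraMap (.fin η) 1
    rw [conn_smul, conn_tmul, h1, TensorProduct.zero_tmul, zero_add, D_toLocalizeLin]
    obtain ⟨g, hg⟩ := ordGE_zero_iff.1 (der_fin_ordGE_zero (ordGE_ofPowerSeries (v := .fin η) h'))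
    rw [hg]
    exact AddSubgroup.add_mem _ (E.smul_mem_lat g (E.W_mono (by omega) le_rfl ha))
      (E.smul_mem_lat h' (E.D_mem_W ha))
  | zero => rw [map_zero]; exact AddSubgroup.zero_mem _
  | add x y _ _ hx hy => rw [map_add]; exact AddSubgroup.add_mem _ hx hy
  | neg x _ hx => rw [map_neg]; exact AddSubgroup.neg_mem _ hx

theorem one_tmul_mem_lat_of_smul {f : ℂ[X]} (hf : f.eval η ≠ 0) {k : ℤ} {a : A}
    (ha : f • a ∈ E.W n k) :
    (1 : LocalField (.fin η)) ⊗ₜ[ℂ[X]] A.toLocalizeLin (polePoly Q) a ∈ E.lat η n := by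
  obtain ⟨h, hh⟩ := exists_inv_of_eval_ne_zero hf
  have := E.smul_mem_lat (η := η) h ha
  rwa [map_smul, smul_one_tmul, smul_smul, hh, one_smul] at this

/-- At η the coordinate x - η is a unit times the pole polynomial, and multiplication by the latter
lowers the pole order at all points of Q at once. -/
theorem t_smul_mem_lat (hη : η ∈ Q) {z : (A.localize (polePoly Q)).Compl (.fin η)}
    (hz : z ∈ E.lat η n) : t (.fin η) • z ∈ E.lat η (n - 1) := by
  induction hz using AddSubgroup.closure_induction with
  | mem z hz =>
    obtain ⟨h', k, a, ha, rfl⟩ := hz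
    rw [smul_comm]
    refine E.ofPowerSeries_smul_mem_lat h' ?_
    rw [← algebraMap_X_sub_C, ← smul_one_tmul, ← map_smul]
    refine E.one_tmul_mem_lat_of_smul (eval_polePoly_erase_ne_zero Q η) (k := k + Q.card) ?_
    rw [smul_smul, mul_comm, ← polePoly_eq_mul hη]
    exact E.polePoly_smul_mem_W ha
  | zero => rw [smul_zero]; exact AddSubgroup.zero_mem _
  | add x y _ _ hx hy => rw [smul_add]; exact AddSubgroup.add_mem _ hx hy
  | neg x _ hx => rw [smul_neg]; exact AddSubgroup.neg_mem _ hx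

theorem t_pow_smul_mem_lat (hη : η ∈ Q) {z : (A.localize (polePoly Q)).Compl (.fin η)}
    (hz : z ∈ E.lat η n) (l : ℕ) : t (.fin η) ^ l • z ∈ E.lat η (n - l) := by
  induction l with
  | zero => simpa using hz
  | succ l ih =>
    rw [pow_succ', mul_smul]
    have := E.t_smul_mem_lat hη ih
    rwa [sub_sub, ← Nat.cast_succ] at this

theorem exists_t_pow_smul_mem_lat (hη : η ∈ Q) (z : (A.localize (polePoly Q)).Compl (.fin η)) :
    ∃ N : ℕ, t (.fin η) ^ N • z ∈ E.lat η 0 := by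
  have hmono : ∀ {z : (A.localize (polePoly Q)).Compl (.fin η)} {N N' : ℕ}, N ≤ N' →
      t (.fin η) ^ N • z ∈ E.lat η 0 → t (.fin η) ^ N' • z ∈ E.lat η 0 := by
    intro z N N' h hz
    obtain ⟨d, rfl⟩ := Nat.exists_eq_add_of_le h
    have := E.ofPowerSeries_smul_mem_lat (PowerSeries.X ^ d) hz
    rwa [map_pow, ofPowerSeries_X, smul_smul, ← pow_add, add_comm] at this
  let S : Submodule (LocalField (.fin η)) ((A.localize (polePoly Q)).Compl (.fin η)) :=
    { carrier := {z | ∃ N : ℕ, t (.fin η) ^ N • z ∈ E.lat η 0}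
      add_mem' := by
        rintro a b ⟨N, hN⟩ ⟨N', hN'⟩
        refine ⟨max N N', ?_⟩
        rw [smul_add]
        exact AddSubgroup.add_mem _ (hmono (le_max_left _ _) hN) (hmono (le_max_right _ _) hN')
      zero_mem' := ⟨0, by rw [smul_zero]; exact AddSubgroup.zero_mem _⟩
      smul_mem' := by
        rintro g z ⟨N, hN⟩
        obtain ⟨l, hl⟩ := exists_ordGE g
        obtain ⟨h, hh⟩ := ordGE_iff.1 (hl.mono (show -(l.natAbs : ℤ) ≤ l by omega))
        refine ⟨l.natAbs + N, ?_⟩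
        have := E.ofPowerSeries_smul_mem_lat h hN
        rw [smul_smul] at this ⊢
        convert this using 2
        have ht := pow_ne_zero l.natAbs (t_ne_zero (.fin η))
        rw [hh, zpow_neg, zpow_natCast, pow_add]
        field_simp }
  have : S = ⊤ := localize_eq_top (polePoly_ne_zero Q) fun a => by
    obtain ⟨n, k, ha⟩ := E.exists_mem_W a
    refine ⟨n, ?_⟩
    have := E.t_pow_smul_mem_lat hη (E.one_tmul_mem_lat (η := η) ha) n
    rwa [sub_self] at this
  exact (this ▸ Submodule.mem_top : z ∈ S)

/-- Modulo t only the constant terms of the power series coefficients matter, and constants can be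
absorbed into the sections. -/
theorem exists_eq_one_tmul_add {z : (A.localize (polePoly Q)).Compl (.fin η)}
    (hz : z ∈ E.lat η n) : ∃ k, ∃ a ∈ E.W n k, ∃ z' ∈ E.lat η n,
      z = (1 : LocalField (.fin η)) ⊗ₜ[ℂ[X]] A.toLocalizeLin (polePoly Q) a + t (.fin η) • z' := by
  induction hz using AddSubgroup.closure_induction with
  | mem z hz =>
    obtain ⟨h, k, a, ha, rfl⟩ := hz
    refine ⟨k, C (PowerSeries.constantCoeff h) • a, ?_, _,
      E.smul_mem_lat (PowerSeries.mk fun p => PowerSeries.coeff (p + 1) h) ha, ?_⟩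
    · rw [← complex_smul_def]; exact Submodule.smul_mem _ _ ha
    · rw [map_smul, smul_one_tmul, smul_smul, ← add_smul, algebraMap_C, ← ofPowerSeries_C,
        ← ofPowerSeries_X, ← map_mul, ← map_add]
      congr 2
      conv_lhs => rw [PowerSeries.eq_X_mul_shift_add_const h]
      rw [add_comm]
  | zero => exact ⟨0, 0, Submodule.zero_mem _, 0, AddSubgroup.zero_mem _, by simp⟩
  | add x y _ _ hx hy =>
    obtain ⟨k, a, ha, z, hz, rfl⟩ := hx
    obtain ⟨k', a', ha', z', hz', rfl⟩ := hy
    refine ⟨max k k', a + a', Submodule.add_mem _ (E.W_mono le_rfl (le_max_left _ _) ha)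
      (E.W_mono le_rfl (le_max_right _ _) ha'), z + z', AddSubgroup.add_mem _ hz hz', ?_⟩
    rw [map_add, TensorProduct.tmul_add, smul_add]
    abel
  | neg x _ hx =>
    obtain ⟨k, a, ha, z, hz, rfl⟩ := hx
    refine ⟨k, -a, Submodule.neg_mem _ ha, -z, AddSubgroup.neg_mem _ hz, ?_⟩
    rw [map_neg, TensorProduct.tmul_neg, smul_neg]
    abel

section Kernel

variable {Θ : (A.localize (polePoly Q)).Compl (.fin η) →ₗ[LocalField (.fin η)]
    (E.J η → LocalField (.fin η))}

theorem ordGE_of_mem_lat (hη : η ∈ Q)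
    (hΘ : ∀ a j, Θ (1 ⊗ₜ A.toLocalizeLin (polePoly Q) a) j = E.θJ η j a)
    {z : (A.localize (polePoly Q)).Compl (.fin η)} (hz : z ∈ E.lat η n) (j : E.J η) :
    OrdGE (Θ z j) (-n) := by
  induction hz using AddSubgroup.closure_induction with
  | mem z hz =>
    obtain ⟨h, k, a, ha, rfl⟩ := hz
    rw [map_smul, Pi.smul_apply, hΘ, smul_eq_mul]
    exact ((ordGE_ofPowerSeries h).mul (ha.2 η hη j)).mono (by omega)
  | zero => rw [map_zero]; exact ordGE_zero _
  | add x y _ _ hx hy => rw [map_add]; exact hx.add hy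
  | neg x _ hx => rw [map_neg]; exact hx.neg

/-- In the kernel of the expansions at `η`, the lattices `lat η n` do not depend on `n`. -/
theorem mem_lat_sub_one (hη : η ∈ Q)
    (hΘ : ∀ a j, Θ (1 ⊗ₜ A.toLocalizeLin (polePoly Q) a) j = E.θJ η j a)
    {z : (A.localize (polePoly Q)).Compl (.fin η)} (hz : z ∈ E.lat η n) (h0 : Θ z = 0) :
    z ∈ E.lat η (n - 1) := by
  obtain ⟨k, a, ha, z', hz', rfl⟩ := E.exists_eq_one_tmul_add hz
  refine AddSubgroup.add_mem _ ?_ (E.t_smul_mem_lat hη hz')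
  -- As Θ z = 0, the expansion of a at η is -t Θ z', one order better than required of a. The same
  -- gain at the other points of Q comes from the remaining factors of the pole polynomial, whose
  -- product is a unit at η.
  have hord : ∀ j, OrdGE (E.θJ η j a) (-n + 1) := by
    intro j
    have h1 := congrFun h0 j
    rw [map_add, Pi.add_apply, hΘ, map_smul, Pi.smul_apply, smul_eq_mul, Pi.zero_apply] at h1
    have h2 : E.θJ η j a = -(t (.fin η) * Θ z' j) := by linear_combination h1
    rw [h2]
    have := ((ordGE_t_zpow (v := .fin η) 1).mul (E.ordGE_of_mem_lat hη hΘ hz' j)).neg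
    rw [zpow_one] at this
    exact this.mono (by omega)
  refine E.one_tmul_mem_lat_of_smul (eval_polePoly_erase_ne_zero Q η)
    (k := k + (polePoly (Q.erase η)).natDegree) ⟨(E.smul_mem_W ha _).1, fun η' hη' j => ?_⟩
  rw [map_smul, Algebra.smul_def]
  by_cases h : η' = η
  · subst h
    exact ((ordGE_algebraMap_fin η' _).mul (hord j)).mono (by omega)
  · exact ((ordGE_polePoly_fin (Finset.mem_erase.2 ⟨h, hη'⟩)).mul (ha.2 η' hη' j)).mono (by omega)

/-- The kernel of the expansions at `η` has a horizontal basis. -/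
theorem exists_horizontal_basis (hη : η ∈ Q)
    (hΘ : ∀ a j, Θ (1 ⊗ₜ A.toLocalizeLin (polePoly Q) a) j = E.θJ η j a) :
    ∃ (d : ℕ) (b : Module.Basis (Fin d) (LocalField (.fin η)) (LinearMap.ker Θ)),
      ∀ i, (A.localize (polePoly Q)).conn (.fin η) (b i) = 0 := by
  classical
  have hconn := extension_conn (polePoly_ne_zero Q) _ (E.θJ_D η) hΘ
  have hker : ∀ z ∈ LinearMap.ker Θ,
      (A.localize (polePoly Q)).conn (.fin η) z ∈ LinearMap.ker Θ := by
    intro z hz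
    rw [LinearMap.mem_ker] at hz ⊢
    funext j
    rw [hconn, hz]
    simp
  obtain ⟨s, hs⟩ := E.exists_finite_generators 0
  obtain ⟨d, b, hb, hb'⟩ := exists_lattice_basis (LinearMap.ker Θ) (E.lat η 0)
    (fun h z hz => E.ofPowerSeries_smul_mem_lat h hz)
    (fun a : s => (1 : LocalField (.fin η)) ⊗ₜ[ℂ[X]] A.toLocalizeLin (polePoly Q) (a : A))
    (fun z hz => by
      induction hz using AddSubgroup.closure_induction with
      | mem z hz =>
        obtain ⟨h, k, a, ha, rfl⟩ := hz
        obtain ⟨c, hc⟩ := (Submodule.mem_span_finset'.1 (hs k a ha))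
        refine ⟨fun i => h * ((c i).comp (X + C η) : ℂ[X]), ?_⟩
        rw [← hc, map_sum, TensorProduct.tmul_sum, Finset.smul_sum]
        refine Finset.sum_congr rfl fun i _ => ?_
        rw [map_smul, smul_one_tmul, smul_smul, map_mul, ← algebraMap_fin]
      | zero => exact ⟨0, by simp⟩
      | add x y _ _ hx hy =>
        obtain ⟨c, hc⟩ := hx
        obtain ⟨c', hc'⟩ := hy
        refine ⟨c + c', ?_⟩
        rw [hc, hc', ← Finset.sum_add_distrib]
        simp only [Pi.add_apply, map_add, add_smul]
      | neg x _ hx =>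
        obtain ⟨c, hc⟩ := hx
        refine ⟨-c, ?_⟩
        rw [hc, ← Finset.sum_neg_distrib]
        simp only [Pi.neg_apply, map_neg, neg_smul])
    (E.exists_t_pow_smul_mem_lat hη)
  let nab : LinearMap.ker Θ →+ LinearMap.ker Θ :=
    { toFun := fun z => ⟨(A.localize (polePoly Q)).conn (.fin η) z, hker z z.2⟩
      map_zero' := by ext; simp
      map_add' := fun x y => by ext; simp }
  have hR : ∀ j, ∃ c : Fin d → PowerSeries ℂ, nab (b j) = ∑ i, ofPowerSeries (.fin η) (c i) • b i := by
    intro j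
    refine hb' _ ?_
    -- The connection may raise the pole order by one, but inside the kernel the lattices all agree.
    -- So the connection preserves this lattice; it is logarithmic with residue 0 there, and the
    -- formal reduction with μ = 0 produces horizontal vectors.
    have := E.mem_lat_sub_one hη hΘ (E.conn_mem_lat (hb j)) (nab (b j)).2
    rw [add_sub_cancel_right] at this
    exact this
  choose R hR using hR
  obtain ⟨e, he⟩ := exists_diagonal_basis_log nab 
    (fun g z => Subtype.ext ((A.localize (polePoly Q)).conn_smul (.fin η) g z)) b
    0 (fun i j => R j i) (fun j => by simp [hR]) (by intro k m n hn; simpa using hn.symm)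
  refine ⟨d, e, fun i => ?_⟩
  have := congrArg Subtype.val (he i)
  simpa [nab] using this

end Kernel

/-- On the formal Laurent series, `d/dt - α / t` is bijective if `α` is not an integer. -/
theorem exists_der_sub_eq {α : ℂ} (hα : ∀ n : ℤ, α ≠ n) (y : LocalField (.fin η)) :
    ∃ u, der (.fin η) u - (eulerCoeff (.fin η))⁻¹ * algebraMap ℂ _ α * u = y := by
  refine ⟨t (.fin η) * rescale _ _ (fun n => ((n : ℂ) + 1 - α)⁻¹) y, ?_⟩
  ext n
  rw [LocalField.coeff_sub, coeff_der_fin, eulerCoeff, mul_assoc]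
  simp only [coeff_t_mul, coeff_t_inv_mul, coeff_algebraMap_mul, coeff_rescale,
    add_sub_cancel_right]
  have : (n : ℂ) + 1 - α ≠ 0 := fun h => hα (n + 1) (by push_cast; linear_combination -h)
  field_simp

/-- The expansions at `η ∈ Q` are coordinates of a frame of the localization, the other elements of
which are horizontal. -/
theorem exists_frame_fin (hη : η ∈ Q) :
    ∃ (fr : (A.localize (polePoly Q)).Frame (.fin η)) (d : ℕ) (e : Fin d ⊕ E.J η ≃ fr.ι),
    (∀ i, fr.exp (e (.inl i)) = 0) ∧ (∀ j, fr.exp (e (.inr j)) = E.expJ η j) ∧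
    ∀ a j, fr.basis.coord (e (.inr j)) (1 ⊗ₜ A.toLocalizeLin (polePoly Q) a) = E.θJ η j a := by
  classical
  have hQ := polePoly_ne_zero Q
  obtain ⟨Θ, hΘ⟩ := exists_extension (A := A) hQ (E.θJ η)
  have hconn := extension_conn hQ _ (E.θJ_D η) hΘ
  have hsurj : Function.Surjective Θ := by
    rw [← LinearMap.range_eq_top, eq_top_iff, ← E.spanJ η hη, Submodule.span_le]
    rintro _ ⟨a, rfl⟩
    exact ⟨1 ⊗ₜ A.toLocalizeLin (polePoly Q) a, funext (hΘ a)⟩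
  obtain ⟨d, b, hb⟩ := E.exists_horizontal_basis hη hΘ
  have hd : der (.fin η) (1 : LocalField (.fin η)) = 0 := by simpa using der_algebraMap (.fin η) 1
  -- Any lift of the unit vector satisfies the eigenvector equation up to an error in the kernel of
  -- Θ. Coordinatewise in the horizontal basis, the error is removed by solving du/dt - α u / t = y,
  -- which is possible because α is not an integer.
  have hlift : ∀ j, ∃ f, Θ f = Pi.single j 1 ∧ (A.localize (polePoly Q)).conn (.fin η) f
      = ((eulerCoeff (.fin η))⁻¹ * algebraMap ℂ _ (E.expJ η j)) • f := by
    intro j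
    obtain ⟨f, hf⟩ := hsurj (Pi.single j 1)
    have hy : (A.localize (polePoly Q)).conn (.fin η) f
        - ((eulerCoeff (.fin η))⁻¹ * algebraMap ℂ _ (E.expJ η j)) • f ∈ LinearMap.ker Θ := by
      rw [LinearMap.mem_ker]
      funext j'
      rw [map_sub, Pi.sub_apply, hconn, map_smul, hf, Pi.smul_apply]
      by_cases h : j' = j
      · subst h; simp [hd]
      · simp [h]
    choose w hw using fun i => exists_der_sub_eq (η := η) (E.expJ_ne η j) (b.repr ⟨_, hy⟩ i)
    have hy' := congrArg Subtype.val (b.sum_repr ⟨_, hy⟩)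
    rw [Submodule.coe_sum] at hy'
    simp only [Submodule.coe_smul] at hy'
    have hk : Θ (∑ i, w i • (b i : (A.localize (polePoly Q)).Compl (.fin η))) = 0 := by
      rw [map_sum]
      refine Finset.sum_eq_zero fun i _ => ?_
      rw [map_smul, LinearMap.mem_ker.1 (b i).2, smul_zero]
    refine ⟨f - ∑ i, w i • (b i : (A.localize (polePoly Q)).Compl (.fin η)), ?_, ?_⟩
    · rw [map_sub, hk, sub_zero, hf]
    · rw [map_sub, map_sum, smul_sub, sub_eq_sub_iff_sub_eq_sub, ← hy', Finset.smul_sum,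
        ← Finset.sum_sub_distrib]
      refine Finset.sum_congr rfl fun i _ => ?_
      rw [conn_smul, hb, smul_zero, add_zero, smul_smul, ← sub_smul, hw]
  choose f hf hfc using hlift
  let σ : (E.J η → LocalField (.fin η)) →ₗ[LocalField (.fin η)]
      (A.localize (polePoly Q)).Compl (.fin η) := (Pi.basisFun (LocalField (.fin η)) (E.J η)).constr ℕ f
  have hσ : ∀ j, σ (Pi.single j 1) = f j := fun j => by
    have := (Pi.basisFun (LocalField (.fin η)) (E.J η)).constr_basis ℕ f j
    rwa [Pi.basisFun_apply] at this
  have hΘσ : ∀ y, Θ (σ y) = y := by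
    intro y
    have : Θ ∘ₗ σ = LinearMap.id := by
      refine (Pi.basisFun (LocalField (.fin η)) (E.J η)).ext fun j => ?_
      simp [hσ, hf]
    exact congrArg (fun φ : (E.J η → LocalField (.fin η)) →ₗ[LocalField (.fin η)] _ => φ y) this
  let Φ := (LinearMap.ker Θ).subtype.coprod σ
  have hΦ : ∀ k y, Φ (k, y) = k + σ y := fun k y => LinearMap.coprod_apply _ _ _
  have hΘΦ : ∀ k y, Θ (Φ (k, y)) = y := fun k y => by
    rw [hΦ, map_add, hΘσ, LinearMap.mem_ker.1 k.2, zero_add]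
  have hbij : Function.Bijective Φ := by
    constructor
    · rintro ⟨k, y⟩ ⟨k', y'⟩ h
      have hy : y = y' := by rw [← hΘΦ k y, h, hΘΦ]
      subst hy
      rw [hΦ, hΦ, add_left_inj] at h
      rw [Subtype.ext h]
    · intro z
      refine ⟨(⟨z - σ (Θ z), ?_⟩, Θ z), ?_⟩
      · rw [LinearMap.mem_ker, map_sub, hΘσ, sub_self]
      · rw [hΦ]; exact sub_add_cancel _ _
  let Ψ := LinearEquiv.ofBijective Φ hbij
  let bas := (b.prod (Pi.basisFun (LocalField (.fin η)) (E.J η))).map Ψ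
  have hinl : ∀ i, bas (.inl i) = b i := fun i => by
    rw [Module.Basis.map_apply]
    change Φ _ = _
    simp [hΦ, Module.Basis.prod_apply]
  have hinr : ∀ j, bas (.inr j) = f j := fun j => by
    rw [Module.Basis.map_apply]
    change Φ _ = _
    simp [hΦ, Module.Basis.prod_apply, hσ]
  refine ⟨⟨Fin d ⊕ E.J η, bas, 0, Sum.elim 0 (E.expJ η), fun _ _ _ => rfl, ?_⟩, d, Equiv.refl _,
    fun _ => rfl, fun _ => rfl, fun a j => ?_⟩
  · rintro (i | j)
    · rw [hinl, hb]; simp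
    · rw [hinr, hfc]; simp
  · rw [← hΘ]
    set z : (A.localize (polePoly Q)).Compl (.fin η) := 1 ⊗ₜ A.toLocalizeLin (polePoly Q) a
    obtain ⟨⟨k, y⟩, hz⟩ := hbij.2 z
    have h1 : Ψ.symm z = (k, y) := by
      rw [LinearEquiv.symm_apply_eq]; exact hz.symm
    rw [← hz, hΘΦ]
    rw [Equiv.refl_apply, Module.Basis.coord_apply, hz]
    change (b.prod (Pi.basisFun (LocalField (.fin η)) (E.J η))).repr (Ψ.symm z) (.inr j) = _
    rw [h1]
    simp

end Expansions

end WeylModule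

/-! ### Torsion-freeness, and finiteness of sections with bounded poles. -/

namespace WeylModule

open LocalField

section TorsionFree

variable {M : WeylModule.{u}} {P : Finset ℂ}

/-- The element is ∂ₓ^{k+1} applied to (x - q) m. -/
theorem Sub.D_smul_sub_mem {N : M.Sub} {q : ℂ} {m : M} (hm : (X - C q : ℂ[X]) • m ∈ N.toSubmodule)
    (k : ℕ) : (X - C q : ℂ[X]) • M.D^[k + 1] m + C ((k : ℂ) + 1) • M.D^[k] m ∈ N.toSubmodule := by
  induction k with
  | zero =>
    have := N.D_mem _ hm
    rw [M.leibniz] at this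
    simpa [add_comm] using this
  | succ k ih =>
    have := N.D_mem _ ih
    rw [map_add, M.leibniz, M.leibniz] at this
    rw [Function.iterate_succ_apply' M.D (k + 1) m]
    convert this using 1
    simp only [derivative_sub, derivative_X, derivative_C, derivative_one, sub_zero, one_smul, zero_smul,
      zero_add, ← Function.iterate_succ_apply' M.D, map_add, map_one, add_smul, Nat.cast_add,
      Nat.cast_one]
    abel

/-- Modulo N, each step replaces (x - q) ∂ₓ^{k+1} m by -(k + 1) ∂ₓ^k m, so that c is (-1)^k k!. -/
theorem Sub.exists_pow_smul_iterate_D {N : M.Sub} {q : ℂ} {m : M}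
    (hm : (X - C q : ℂ[X]) • m ∈ N.toSubmodule) (k : ℕ) :
    ∃ c : ℂ, c ≠ 0 ∧ (X - C q : ℂ[X]) ^ k • M.D^[k] m - C c • m ∈ N.toSubmodule := by
  induction k with
  | zero => exact ⟨1, one_ne_zero, by simp⟩
  | succ k ih =>
    obtain ⟨c, hc, h⟩ := ih
    have hk : (k : ℂ) + 1 ≠ 0 := Nat.cast_add_one_ne_zero k
    refine ⟨-((k + 1) * c), neg_ne_zero.2 (mul_ne_zero hk hc), ?_⟩
    have h1 := N.toSubmodule.smul_mem ((X - C q : ℂ[X]) ^ k) (N.D_smul_sub_mem hm k)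
    have h2 := N.toSubmodule.smul_mem (C ((k : ℂ) + 1)) h
    have := N.toSubmodule.sub_mem h1 h2
    convert this using 1
    simp only [smul_add, smul_sub, smul_smul, map_neg, map_mul, pow_succ, neg_smul]
    rw [mul_comm (C ((k : ℂ) + 1)) ((X - C q) ^ k)]
    abel

theorem Sub.IsSubbundle.mem_of_pow {N : M.Sub} (hN : N.IsSubbundle P) {k : ℕ} {m : M}
    (h : polePoly P ^ k • m ∈ N.toSubmodule) : m ∈ N.toSubmodule := by
  induction k with
  | zero => simpa using h
  | succ k ih =>
    rw [pow_succ', mul_smul] at h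
    exact ih (hN _ h)

theorem Sub.C_smul_mem_iff {N : M.Sub} {c : ℂ} (hc : c ≠ 0) {m : M} :
    (C c : ℂ[X]) • m ∈ N.toSubmodule ↔ m ∈ N.toSubmodule := by
  refine ⟨fun h => ?_, fun h => N.toSubmodule.smul_mem _ h⟩
  have := N.toSubmodule.smul_mem (C c⁻¹) h
  rwa [smul_smul, ← map_mul, inv_mul_cancel₀ hc, map_one, one_smul] at this

/-- If m were not in N, the derivatives ∂ₓ^k m would be torsion modulo N of exact order k + 1 at q,
by `Sub.exists_pow_smul_iterate_D`. But up to powers of the pole polynomial, which do not matter for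
a subbundle, they all lie in one noetherian module, where the order of torsion is bounded. -/
theorem IsMeromorphicBundle.mem_of_X_sub_C_smul_mem (hM : IsMeromorphicBundle P M) {N : M.Sub}
    (hN : N.IsSubbundle P) {q : ℂ} {m : M} (hm : (X - C q : ℂ[X]) • m ∈ N.toSubmodule) :
    m ∈ N.toSubmodule := by
  obtain ⟨-, s, hs⟩ := hM
  let U := Submodule.span ℂ[X] (s : Set M)
  have : IsNoetherian ℂ[X] U :=
    isNoetherian_of_fg_of_noetherian U (Submodule.fg_span s.finite_toSet)
  let T : ℕ →o Submodule ℂ[X] U :=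
    { toFun := fun k => N.toSubmodule.comap
        (LinearMap.lsmul ℂ[X] M ((X - C q : ℂ[X]) ^ k) ∘ₗ U.subtype)
      monotone' := monotone_nat_of_le_succ fun k z hz => by
        simp only [Submodule.mem_comap, LinearMap.comp_apply, LinearMap.lsmul_apply] at hz ⊢
        rw [pow_succ', mul_smul]
        exact N.toSubmodule.smul_mem _ hz }
  obtain ⟨k, hk⟩ := monotone_stabilizes_iff_noetherian.2 this T
  obtain ⟨c, hc, h⟩ := N.exists_pow_smul_iterate_D hm k
  obtain ⟨a, ha⟩ := hs (M.D^[k] m)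
  have h1 : (⟨_, ha⟩ : U) ∈ T (k + 1) := by
    change (X - C q : ℂ[X]) ^ (k + 1) • polePoly P ^ a • M.D^[k] m ∈ N.toSubmodule
    have h2 := N.toSubmodule.smul_mem ((X - C q : ℂ[X]) * polePoly P ^ a) h
    have h3 := N.toSubmodule.smul_mem (polePoly P ^ a * C c) hm
    convert N.toSubmodule.add_mem h2 h3 using 1
    simp only [smul_sub, smul_smul]
    rw [show (X - C q) * polePoly P ^ a * C c = polePoly P ^ a * C c * (X - C q) by ring,
      sub_add_cancel]
    congr 1; ring
  rw [← hk (k + 1) (Nat.le_succ k)] at h1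
  have h4 : (X - C q : ℂ[X]) ^ k • polePoly P ^ a • M.D^[k] m ∈ N.toSubmodule := h1
  have h5 := N.toSubmodule.smul_mem (polePoly P ^ a) h
  rw [smul_sub, smul_smul, mul_comm, ← smul_smul] at h5
  have h6 := (Submodule.sub_mem_iff_right _ h4).1 h5
  exact (N.C_smul_mem_iff hc).1 (hN.mem_of_pow h6)

/-- Quotients of meromorphic bundles by subbundles are torsion free. -/
theorem IsMeromorphicBundle.mem_of_smul_mem (hM : IsMeromorphicBundle P M) {N : M.Sub}
    (hN : N.IsSubbundle P) {f : ℂ[X]} (hf : f ≠ 0) {m : M} (hm : f • m ∈ N.toSubmodule) :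
    m ∈ N.toSubmodule := by
  induction hd : f.natDegree generalizing f with
  | zero =>
    rw [Polynomial.eq_C_of_natDegree_eq_zero hd] at hm hf
    exact (N.C_smul_mem_iff (by simpa using hf)).1 hm
  | succ d ih =>
    obtain ⟨q, hq⟩ := IsAlgClosed.exists_root f (by
      rw [Polynomial.degree_eq_natDegree hf, hd]; exact_mod_cast Nat.succ_ne_zero d)
    obtain ⟨g, rfl⟩ := Polynomial.dvd_iff_isRoot.2 hq
    have hg : g ≠ 0 := right_ne_zero_of_mul hf
    rw [mul_smul] at hm
    refine ih hg (hM.mem_of_X_sub_C_smul_mem hN hm) ?_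
    rw [Polynomial.natDegree_mul (Polynomial.X_sub_C_ne_zero q) hg,
      Polynomial.natDegree_X_sub_C] at hd
    omega

/-- The zero submodule. -/
def botSub (M : WeylModule.{u}) : M.Sub := ⟨⊥, fun m hm => by
  rw [Submodule.mem_bot] at hm ⊢; rw [hm, map_zero]⟩

theorem IsMeromorphicBundle.smul_eq_zero (hM : IsMeromorphicBundle P M) {f : ℂ[X]} (hf : f ≠ 0)
    {m : M} (hm : f • m = 0) : m = 0 := by
  have h1 : M.botSub.IsSubbundle P := fun m hm => by
    change m ∈ (⊥ : Submodule ℂ[X] M)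
    rw [Submodule.mem_bot]
    refine hM.1.1 ?_
    change polePoly P • m = polePoly P • 0
    rw [smul_zero]
    exact (Submodule.mem_bot _).1 hm
  exact (Submodule.mem_bot _).1 (hM.mem_of_smul_mem h1 hf ((Submodule.mem_bot _).2 hm))

theorem IsMeromorphicBundle.isTorsionFree (hM : IsMeromorphicBundle P M) :
    Module.IsTorsionFree ℂ[X] M := by
  refine ⟨fun f hf a b hab => ?_⟩
  have h0 : f ≠ 0 := hf.ne_zero
  have : f • (a - b) = 0 := by rw [smul_sub]; exact sub_eq_zero.2 hab
  exact sub_eq_zero.1 (hM.smul_eq_zero h0 this)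

theorem IsMeromorphicBundle.pow_smul_injective (hM : IsMeromorphicBundle P M) (k : ℕ) {a b : M}
    (h : polePoly P ^ k • a = polePoly P ^ k • b) : a = b := by
  have : polePoly P ^ k • (a - b) = 0 := by rw [smul_sub]; exact sub_eq_zero.2 h
  exact sub_eq_zero.1 (hM.smul_eq_zero (pow_ne_zero k (polePoly_ne_zero P)) this)

theorem IsMeromorphicBundle.exists_pow_smul_eq (hM : IsMeromorphicBundle P M) (k : ℕ) (a : M) :
    ∃ b, polePoly P ^ k • b = a := by
  induction k with
  | zero => exact ⟨a, by simp⟩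
  | succ k ih =>
    obtain ⟨b, hb⟩ := ih
    obtain ⟨b', hb'⟩ := hM.1.2 b
    exact ⟨b', by rw [pow_succ, mul_smul]; exact (congrArg _ hb').trans hb⟩

/-- There is a finite family of sections which is a basis of all completions, and generates the
bundle. -/
theorem IsMeromorphicBundle.exists_sections (hM : IsMeromorphicBundle P M) :
    ∃ (r : ℕ) (w : Fin r → M),
      (∀ m, ∃ (a : ℕ) (h : Fin r → ℂ[X]), polePoly P ^ a • m = ∑ i, h i • w i) ∧
      ∀ v, ∃ b : Module.Basis (Fin r) (LocalField v) (M.Compl v), ∀ i, b i = 1 ⊗ₜ w i := by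
  have := hM.isTorsionFree
  have hM' := hM
  obtain ⟨-, s, hs⟩ := hM
  let U := Submodule.span ℂ[X] (s : Set M)
  have : Module.Finite ℂ[X] U := Module.Finite.span_of_finite _ s.finite_toSet
  -- Finitely generated and torsion free over a principal ideal domain, U is free. Its completion
  -- injects by flatness and is everything, since the pole polynomial is invertible in Laurent
  -- series.
  let c := Module.finBasis ℂ[X] U
  refine ⟨_, fun i => c i, fun m => ?_, fun v => ?_⟩
  · obtain ⟨a, ha⟩ := hs m
    refine ⟨a, c.repr ⟨_, ha⟩, ?_⟩
    have := congrArg Subtype.val (c.sum_repr ⟨_, ha⟩)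
    rw [Submodule.coe_sum] at this
    exact this.symm
  · have hinj : Function.Injective (U.subtype.baseChange (LocalField v)) :=
      Module.Flat.lTensor_preserves_injective_linearMap U.subtype U.injective_subtype
    have hsurj : Function.Surjective (U.subtype.baseChange (LocalField v)) := by
      rw [← LinearMap.range_eq_top]
      refine eq_top_of_one_tmul_mem fun m => ?_
      obtain ⟨a, ha⟩ := hs m
      refine one_tmul_mem_of_smul_mem (pow_ne_zero a (polePoly_ne_zero P)) ?_
      exact ⟨1 ⊗ₜ ⟨_, ha⟩, by simp⟩
    refine ⟨(c.baseChange (LocalField v)).map (LinearEquiv.ofBijective _ ⟨hinj, hsurj⟩),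
      fun i => ?_⟩
    rw [Module.Basis.map_apply, Module.Basis.baseChange_apply]
    exact LinearMap.baseChange_tmul _ _ _

theorem polePoly_pow_dvd {a : ℕ} {h : ℂ[X]}
    (hh : ∀ p ∈ P, OrdGE (algebraMap ℂ[X] (LocalField (.fin p)) h) a) : polePoly P ^ a ∣ h := by
  rw [polePoly, ← Finset.prod_pow]
  refine Finset.prod_dvd_of_coprime ?_ fun p hp => ?_
  · intro p _ q _ hpq
    exact (Polynomial.isCoprime_X_sub_C_of_isUnit_sub (sub_ne_zero.2 hpq).isUnit).pow
  · rw [Polynomial.X_sub_C_pow_dvd_iff, Polynomial.X_pow_dvd_iff]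
    intro d hd
    have := hh p hp d (by exact_mod_cast hd)
    rwa [algebraMap_fin, coeff_ofPowerSeries, Polynomial.coeff_coe] at this

theorem exists_ordGE_change_basis {v : Place} {V : Type*} [AddCommGroup V] [Module (LocalField v) V]
    {ι κ : Type*} [Fintype ι] [Fintype κ] (e : Module.Basis ι (LocalField v) V)
    (b : Module.Basis κ (LocalField v) V) : ∃ d : ℕ, ∀ (z : V) (N : ℤ),
      (∀ j, OrdGE (e.coord j z) N) → ∀ i, OrdGE (b.coord i z) (N - d) := by
  choose d hd using fun (ij : κ × ι) => exists_ordGE (b.coord ij.1 (e ij.2))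
  refine ⟨∑ ij, (d ij).natAbs, fun z N hz i => ?_⟩
  conv => rw [← e.sum_repr z]
  rw [map_sum]
  refine OrdGE.sum fun j _ => ?_
  rw [map_smul, smul_eq_mul]
  refine ((hz j).mul (hd (i, j))).mono ?_
  have := Finset.single_le_sum (f := fun ij => (d ij).natAbs) (fun _ _ => Nat.zero_le _)
    (Finset.mem_univ (i, j))
  omega

end TorsionFree

section Bounded

variable {M : WeylModule.{u}} {P : Finset ℂ}

/-- The sections with poles of order at most `K` at the points of `P`, with respect to given
frames. -/
def boundedSections (fr : ∀ p : P, M.Frame (.fin p)) (K : ℤ) : Submodule ℂ[X] M where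
  carrier := {m | ∀ p j, OrdGE ((fr p).basis.coord j (1 ⊗ₜ m)) (-K)}
  add_mem' := fun ha hb p j => by
    rw [TensorProduct.tmul_add, map_add]; exact (ha p j).add (hb p j)
  zero_mem' := fun p j => by rw [TensorProduct.tmul_zero, map_zero]; exact ordGE_zero _
  smul_mem' := fun f m hm p j => by
    rw [smul_one_tmul, map_smul, smul_eq_mul]
    exact ((ordGE_algebraMap_fin _ f).mul (hm p j)).mono (by omega)

/-- The exponent of the pole polynomial needed to clear denominators depends on m at first. The
bound K and the change of basis from the frames to `w` bound the poles of the coefficients at P, and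
a polynomial vanishing to order a at all points of P is divisible by the a-th power of the pole
polynomial. This makes the exponent uniform. -/
theorem IsMeromorphicBundle.exists_bound (hM : IsMeromorphicBundle P M)
    (fr : ∀ p : P, M.Frame (.fin p)) {r : ℕ} {w : Fin r → M}
    (hw : ∀ m, ∃ (a : ℕ) (h : Fin r → ℂ[X]), polePoly P ^ a • m = ∑ i, h i • w i)
    (hb : ∀ v, ∃ b : Module.Basis (Fin r) (LocalField v) (M.Compl v), ∀ i, b i = 1 ⊗ₜ w i)
    (K : ℕ) : ∃ K' : ℕ, ∀ m ∈ boundedSections fr K, ∃ h : Fin r → ℂ[X],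
      polePoly P ^ K' • m = ∑ i, h i • w i := by
  choose b hb using hb
  choose d hd using fun p : P => exists_ordGE_change_basis (fr p).basis (b (.fin p))
  refine ⟨K + ∑ p, d p, fun m hm => ?_⟩
  obtain ⟨a, h, hh⟩ := hw m
  set K' := K + ∑ p, d p with hK'
  have hcoord : ∀ v i, algebraMap ℂ[X] (LocalField v) (polePoly P ^ a) * (b v).coord i (1 ⊗ₜ m)
      = algebraMap ℂ[X] (LocalField v) (h i) := by
    intro v i
    rw [← smul_eq_mul, ← map_smul, ← smul_one_tmul, hh, TensorProduct.tmul_sum]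
    simp only [smul_one_tmul, ← hb]
    rw [Module.Basis.coord_apply, Module.Basis.repr_sum_self]
  have hpow : ∀ p ∈ P, ∀ k : ℕ, OrdGE (algebraMap ℂ[X] (LocalField (.fin p)) (polePoly P ^ k)) k := by
    intro p hp k
    induction k with
    | zero => simpa using ordGE_algebraMap_fin p 1
    | succ k ih =>
      rw [pow_succ, map_mul]
      exact_mod_cast ih.mul (ordGE_polePoly_fin hp)
  have hdvd : ∀ i, polePoly P ^ a ∣ polePoly P ^ K' * h i := by
    intro i
    refine polePoly_pow_dvd fun p hp => ?_
    rw [map_mul, ← hcoord]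
    have h1 := hd ⟨p, hp⟩ (1 ⊗ₜ m) (-K) (hm ⟨p, hp⟩) i
    have h2 := (hpow p hp K').mul ((hpow p hp a).mul h1)
    refine h2.mono ?_
    have := Finset.single_le_sum (f := d) (fun _ _ => Nat.zero_le _) (Finset.mem_univ ⟨p, hp⟩)
    push_cast [hK']
    have h3 : (d ⟨p, hp⟩ : ℤ) ≤ ∑ p, (d p : ℤ) := by exact_mod_cast this
    linarith
  choose h' hh' using hdvd
  refine ⟨h', hM.pow_smul_injective a ?_⟩
  rw [smul_comm, hh, Finset.smul_sum, Finset.smul_sum]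
  refine Finset.sum_congr rfl fun i _ => ?_
  rw [smul_smul, hh', mul_smul]

theorem IsMeromorphicBundle.isNoetherian_boundedSections (hM : IsMeromorphicBundle P M)
    (fr : ∀ p : P, M.Frame (.fin p)) (K : ℕ) : IsNoetherian ℂ[X] (boundedSections fr K) := by
  obtain ⟨r, w, hw, hb⟩ := hM.exists_sections
  obtain ⟨K', hK'⟩ := hM.exists_bound fr hw hb K
  let U := Submodule.span ℂ[X] (Set.range w)
  have : IsNoetherian ℂ[X] U :=
    isNoetherian_of_fg_of_noetherian U (Submodule.fg_span (Set.finite_range w))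
  refine isNoetherian_of_injective (LinearMap.codRestrict U
    (LinearMap.lsmul ℂ[X] M (polePoly P ^ K') ∘ₗ (boundedSections fr K).subtype) ?_) ?_
  · rintro ⟨m, hm⟩
    obtain ⟨h, hh⟩ := hK' m hm
    change polePoly P ^ K' • m ∈ U
    rw [hh]
    exact Submodule.sum_mem _ fun i _ => Submodule.smul_mem _ _ (Submodule.subset_span ⟨i, rfl⟩)
  · intro x y hxy
    exact Subtype.ext (hM.pow_smul_injective K' (congrArg Subtype.val hxy))

/-- Sections with bounded poles form a finite-dimensional space. -/
theorem IsMeromorphicBundle.exists_finite_span (hM : IsMeromorphicBundle P M)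
    (fr : ∀ p : P, M.Frame (.fin p)) (fi : M.Frame .infty) (K n : ℕ) :
    ∃ s : Finset M, ∀ m ∈ boundedSections fr K, (∀ j, OrdGE (fi.basis.coord j (1 ⊗ₜ m)) (-n)) →
      m ∈ Submodule.span ℂ (s : Set M) := by
  classical
  obtain ⟨r, w, hw, hb⟩ := hM.exists_sections
  obtain ⟨K', hK'⟩ := hM.exists_bound fr hw hb K
  choose b hb using hb
  obtain ⟨d, hd⟩ := exists_ordGE_change_basis fi.basis (b .infty)
  choose y hy using fun (x : ℕ × Fin r) => hM.exists_pow_smul_eq K' ((X : ℂ[X]) ^ x.1 • w x.2)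
  -- Pole order at infinity bounds the degrees of the coefficients: n is the bound on m, d the loss
  -- in the change of basis, and the first term comes from clearing the poles at P.
  set D := (polePoly P ^ K').natDegree + n + d with hD
  refine ⟨(Finset.range (D + 1) ×ˢ Finset.univ).image y, fun m hm hmi => ?_⟩
  obtain ⟨h, hh⟩ := hK' m hm
  have hdeg : ∀ i, (h i).natDegree < D + 1 := by
    intro i
    have h1 : algebraMap ℂ[X] (LocalField .infty) (h i)
        = algebraMap ℂ[X] (LocalField .infty) (polePoly P ^ K') * (b .infty).coord i (1 ⊗ₜ m) := by
      rw [← smul_eq_mul, ← map_smul, ← smul_one_tmul, hh, TensorProduct.tmul_sum]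
      simp only [smul_one_tmul, ← hb]
      rw [Module.Basis.coord_apply, Module.Basis.repr_sum_self]
    have h2 := (ordGE_algebraMap_infty (polePoly P ^ K')).mul (hd _ _ hmi i)
    rw [← h1] at h2
    rw [Nat.lt_succ_iff, Polynomial.natDegree_le_iff_coeff_eq_zero]
    intro k hk
    have h3 := h2 (-k) (by push_cast [hD] at hk ⊢; omega)
    rw [coeff_algebraMap_infty] at h3
    simpa using h3
  have hm' : m = ∑ i, ∑ l ∈ Finset.range (D + 1), (h i).coeff l • y (l, i) := by
    refine hM.pow_smul_injective K' ?_
    rw [hh, Finset.smul_sum]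
    refine Finset.sum_congr rfl fun i _ => ?_
    rw [Finset.smul_sum]
    conv_lhs => rw [(h i).as_sum_range' _ (hdeg i), Finset.sum_smul]
    refine Finset.sum_congr rfl fun l _ => ?_
    rw [complex_smul_def, smul_comm, hy, smul_smul, Polynomial.C_mul_X_pow_eq_monomial]
  rw [hm']
  refine Submodule.sum_mem _ fun i _ => Submodule.sum_mem _ fun l hl =>
    Submodule.smul_mem _ _ (Submodule.subset_span ?_)
  rw [Finset.coe_image]
  exact ⟨(l, i), by simpa using hl, rfl⟩

end Bounded

end WeylModule

/-! ### The minimal extension: uniqueness and construction. -/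

namespace WeylModule

open LocalField

variable {M : WeylModule.{u}} {P : Finset ℂ}

theorem one_tmul_D (v : Place) (m : M) :
    (1 : LocalField v) ⊗ₜ[ℂ[X]] M.D m = M.conn v (1 ⊗ₜ m) := by
  have h1 : der v (1 : LocalField v) = 0 := by simpa using der_algebraMap v 1
  rw [conn_tmul, h1, TensorProduct.zero_tmul, zero_add]

namespace Sub

theorem incl_mem (L : M.Sub) (m : L.toWeyl) : L.incl m ∈ L.toSubmodule :=
  (show L.toSubmodule from m).2

/-- A submodule of a submodule. -/
def push {L : M.Sub} (N : L.toWeyl.Sub) : M.Sub where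
  toSubmodule := N.toSubmodule.map L.incl
  D_mem := by
    rintro _ ⟨m, hm, rfl⟩
    exact ⟨L.toWeyl.D m, N.D_mem m hm, rfl⟩

theorem mem_push {L : M.Sub} (N : L.toWeyl.Sub) {m : L.toWeyl} :
    L.incl m ∈ (push N).toSubmodule ↔ m ∈ N.toSubmodule := by
  refine ⟨?_, fun h => ⟨m, h, rfl⟩⟩
  rintro ⟨m', hm', h⟩
  rwa [← Subtype.ext h]

/-- The elements with a multiple by a power of `f` in a given submodule. -/
def saturation (f : ℂ[X]) (N : M.Sub) : M.Sub where
  toSubmodule :=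
    { carrier := {m | ∃ k : ℕ, f ^ k • m ∈ N.toSubmodule}
      add_mem' := by
        rintro a b ⟨k, hk⟩ ⟨l, hl⟩
        refine ⟨k + l, ?_⟩
        rw [smul_add]
        refine N.toSubmodule.add_mem ?_ ?_
        · rw [add_comm, pow_add, mul_smul]; exact N.toSubmodule.smul_mem _ hk
        · rw [pow_add, mul_smul]; exact N.toSubmodule.smul_mem _ hl
      zero_mem' := ⟨0, by simp⟩
      smul_mem' := by
        rintro g m ⟨k, hk⟩
        exact ⟨k, by rw [smul_comm]; exact N.toSubmodule.smul_mem _ hk⟩ }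
  D_mem := by
    rintro m ⟨k, hk⟩
    refine ⟨k + 1, ?_⟩
    have h1 := N.toSubmodule.smul_mem f (N.D_mem _ hk)
    have h2 := N.toSubmodule.smul_mem (C (k : ℂ) * derivative f) hk
    convert N.toSubmodule.sub_mem h1 h2 using 1
    rw [M.leibniz, smul_add, smul_smul, smul_smul, smul_smul, pow_succ']
    have : f * derivative (f ^ k) = C (k : ℂ) * derivative f * f ^ k := by
      rw [Polynomial.derivative_pow]
      cases k with
      | zero => simp
      | succ k => rw [Nat.add_sub_cancel, pow_succ]; ring
    rw [this, add_sub_cancel_left]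

theorem mem_saturation {f : ℂ[X]} {N : M.Sub} {m : M} :
    m ∈ (N.saturation f).toSubmodule ↔ ∃ k : ℕ, f ^ k • m ∈ N.toSubmodule := Iff.rfl

theorem isSubbundle_saturation (N : M.Sub) : (N.saturation (polePoly P)).IsSubbundle P := by
  rintro m ⟨k, hk⟩
  exact ⟨k + 1, by rw [pow_succ, mul_smul]; exact hk⟩

end Sub

/-- A module without quotients supported at a point has no quotients supported on a finite set. -/
theorem NoPunctualQuotient.eq_top {L : WeylModule.{u}} (hL : L.NoPunctualQuotient) (P : Finset ℂ)
    (N : L.Sub) (h : ∀ m : L, ∃ k : ℕ, polePoly P ^ k • m ∈ N.toSubmodule) :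
    N.toSubmodule = ⊤ := by
  classical
  induction P using Finset.induction_on with
  | empty =>
    rw [eq_top_iff]
    intro m _
    obtain ⟨k, hk⟩ := h m
    simpa [polePoly] using hk
  | insert p P hp ih =>
    refine ih fun m => ?_
    have h1 : polePoly (insert p P) = (X - C p) * polePoly P := Finset.prod_insert hp
    have h2 := hL p (N.saturation (polePoly P)) fun m => by
      obtain ⟨k, hk⟩ := h m
      exact ⟨k, k, by rw [smul_smul, ← mul_pow, mul_comm, ← h1]; exact hk⟩
    exact (h2 ▸ Submodule.mem_top : m ∈ (N.saturation (polePoly P)).toSubmodule)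

/-- Each element of the quotient of L by its intersection with L' is killed by a power of the pole
polynomial, because L' generates M up to such powers. As L has no punctual quotient, this quotient
is zero. -/
theorem Sub.IsMinimalExtension.le {L L' : M.Sub} (hL : L.IsMinimalExtension P)
    (hL' : L'.IsMinimalExtension P) : L.toSubmodule ≤ L'.toSubmodule := by
  let N : L.toWeyl.Sub := ⟨L'.toSubmodule.comap L.incl, fun m hm => L'.D_mem _ hm⟩
  have := hL.2.2.eq_top P N fun m => by
    obtain ⟨k, hk⟩ := hL'.1 (L.incl m)
    exact ⟨k, hk⟩
  have h : ∀ x : L.toWeyl, x ∈ N.toSubmodule := fun x => by rw [this]; exact Submodule.mem_top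
  exact fun m hm => h ⟨m, hm⟩

theorem Sub.IsMinimalExtension.unique {L L' : M.Sub} (hL : L.IsMinimalExtension P)
    (hL' : L'.IsMinimalExtension P) : L = L' := by
  have := le_antisymm (hL.le hL') (hL'.le hL)
  cases L; cases L'; congr

/-- The sections whose components with residue `0` at the points of `P` are regular, for given
frames. -/
def minExt (fr : ∀ p : P, M.Frame (.fin p)) : M.Sub where
  toSubmodule :=
    { carrier := {m | ∀ p j, (fr p).exp j = 0 → OrdGE ((fr p).basis.coord j (1 ⊗ₜ m)) 0}
      add_mem' := fun ha hb p j h => by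
        rw [TensorProduct.tmul_add, map_add]; exact (ha p j h).add (hb p j h)
      zero_mem' := fun p j _ => by rw [TensorProduct.tmul_zero, map_zero]; exact ordGE_zero _
      smul_mem' := fun f m hm p j h => by
        rw [smul_one_tmul, map_smul, smul_eq_mul]
        exact ((ordGE_algebraMap_fin _ f).mul (hm p j h)).mono (by omega) }
  D_mem := fun m hm p j h => by
    rw [one_tmul_D, Frame.coord_conn, h, (fr p).fac_fin p rfl, map_zero, mul_zero, add_zero,
      zero_mul, add_zero]
    exact der_fin_ordGE_zero (hm p j h)

theorem mem_minExt {fr : ∀ p : P, M.Frame (.fin p)} {m : M} : m ∈ (minExt fr).toSubmodule ↔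
    ∀ p j, (fr p).exp j = 0 → OrdGE ((fr p).basis.coord j (1 ⊗ₜ m)) 0 := Iff.rfl

theorem exists_mem_boundedSections (fr : ∀ p : P, M.Frame (.fin p)) (m : M) :
    ∃ K : ℕ, m ∈ boundedSections fr K := by
  choose N hN using fun p j => exists_ordGE ((fr p).basis.coord j (1 ⊗ₜ m))
  refine ⟨∑ p, ∑ j, (N p j).natAbs, fun p j => (hN p j).mono ?_⟩
  have h1 := Finset.single_le_sum (f := fun j => (N p j).natAbs) (fun _ _ => Nat.zero_le _)
    (Finset.mem_univ j)
  have h2 := Finset.single_le_sum (f := fun p => ∑ j, (N p j).natAbs)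
    (fun _ _ => Nat.zero_le _) (Finset.mem_univ p)
  omega

theorem ordGE_polePoly_pow_fin {p : ℂ} (hp : p ∈ P) (k : ℕ) :
    OrdGE (algebraMap ℂ[X] (LocalField (.fin p)) (polePoly P ^ k)) k := by
  induction k with
  | zero => simpa using ordGE_algebraMap_fin p 1
  | succ k ih =>
    rw [pow_succ, map_mul]
    exact_mod_cast ih.mul (ordGE_polePoly_fin hp)

theorem exists_pow_smul_mem_minExt (fr : ∀ p : P, M.Frame (.fin p)) (m : M) :
    ∃ k : ℕ, polePoly P ^ k • m ∈ (minExt fr).toSubmodule := by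
  obtain ⟨K, hK⟩ := exists_mem_boundedSections fr m
  refine ⟨K, fun p j _ => ?_⟩
  rw [smul_one_tmul, map_smul, smul_eq_mul]
  exact ((ordGE_polePoly_pow_fin p.2 K).mul (hK p j)).mono (by omega)

theorem ordGE_of_mul {p : ℂ} {f : ℂ[X]} (hf : f.eval p ≠ 0) {g : LocalField (.fin p)} {N : ℤ}
    (h : OrdGE (algebraMap ℂ[X] (LocalField (.fin p)) f * g) N) : OrdGE g N := by
  obtain ⟨u, hu⟩ := exists_inv_of_eval_ne_zero hf
  have := (ordGE_ofPowerSeries (v := .fin p) u).mul h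
  rwa [← mul_assoc, hu, one_mul, zero_add] at this

theorem IsMeromorphicBundle.exists_X_sub_C_pow_smul_eq (hM : IsMeromorphicBundle P M) {p : ℂ}
    (hp : p ∈ P) (k : ℕ) (m : M) : ∃ y, (X - C p : ℂ[X]) ^ k • y = m := by
  obtain ⟨b, hb⟩ := hM.exists_pow_smul_eq k m
  refine ⟨polePoly (P.erase p) ^ k • b, ?_⟩
  rw [smul_smul, ← mul_pow, ← polePoly_eq_mul hp, hb]

/-- The coordinates of `∏ (x - p) ∂ₓ m`. -/
theorem coord_polePoly_smul_D {p : ℂ} (hp : p ∈ P) (fr : M.Frame (.fin p)) (m : M) (j : fr.ι) :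
    fr.basis.coord j (1 ⊗ₜ (polePoly P • M.D m))
      = algebraMap ℂ[X] (LocalField (.fin p)) (polePoly (P.erase p))
        * (euler (.fin p) (fr.basis.coord j (1 ⊗ₜ m))
          + algebraMap ℂ _ (fr.exp j) * fr.basis.coord j (1 ⊗ₜ m)) := by
  have ht := t_ne_zero (.fin p)
  rw [smul_one_tmul, map_smul, smul_eq_mul, one_tmul_D, Frame.coord_conn, fr.fac_fin p rfl,
    polePoly_eq_mul hp, map_mul, algebraMap_X_sub_C, der, AddMonoidHom.comp_apply,
    AddMonoidHom.coe_mulLeft, eulerCoeff, map_zero, zero_add]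
  field_simp

theorem ordGE_euler_add {v : Place} {g : LocalField v} {N : ℤ} (hg : OrdGE g N) (c : ℂ) :
    OrdGE (euler v g + algebraMap ℂ _ c * g) N := fun n hn => by
  rw [LocalField.coeff_add, coeff_euler, coeff_algebraMap_mul, hg n hn]; ring

section Quotient

variable (fr : ∀ p : P, M.Frame (.fin p))

theorem polePoly_smul_D_mem_boundedSections {K : ℤ} {m : M} (hm : m ∈ boundedSections fr K) :
    polePoly P • M.D m ∈ boundedSections fr K := fun p j => by
  rw [coord_polePoly_smul_D p.2]
  exact ((ordGE_algebraMap_fin _ _).mul (ordGE_euler_add (hm p j) _)).mono (by omega)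

/-- Modulo a submodule `N` containing `(x - p) m`, the section `m` is equivalent, up to a non-zero
factor, to sections vanishing to arbitrary order at `p`. -/
theorem exists_congr_vanishing (hfr : ∀ p j, (fr p).exp j = 0 ∨ ∀ n : ℤ, ((fr p).exp j).re ≠ n)
    {N : M.Sub} (p : P) {m : M} (hmL : m ∈ (minExt fr).toSubmodule)
    (hm : (X - C (p : ℂ) : ℂ[X]) • m ∈ N.toSubmodule) {K : ℕ} (hK : m ∈ boundedSections fr K)
    (d : ℕ) :
    ∃ c : ℂ, c ≠ 0 ∧ ∃ m' ∈ (minExt fr).toSubmodule, m' ∈ boundedSections fr K ∧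
      m' - C c • m ∈ N.toSubmodule ∧
      ∀ j, OrdGE ((fr p).basis.coord j (1 ⊗ₜ m')) (-K + d) := by
  classical
  induction d with
  | zero =>
    exact ⟨1, one_ne_zero, m, hmL, hK, by simp, fun j => by simpa using hK p j⟩
  | succ d ih =>
    set i : ℤ := -K + d with hi
    set q := polePoly (P.erase p) with hq
    have hq0 : q.eval (p : ℂ) ≠ 0 := eval_polePoly_erase_ne_zero P p
    suffices h : ∀ s : Finset (fr p).ι, ∃ c : ℂ, c ≠ 0 ∧ ∃ m' ∈ (minExt fr).toSubmodule,
        m' ∈ boundedSections fr K ∧ m' - C c • m ∈ N.toSubmodule ∧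
        (∀ j, OrdGE ((fr p).basis.coord j (1 ⊗ₜ m')) i) ∧
        ∀ j ∈ s, coeff ((fr p).basis.coord j (1 ⊗ₜ m')) i = 0 by
      obtain ⟨c, hc, m', h1, h2, h3, h4, h5⟩ := h Finset.univ
      refine ⟨c, hc, m', h1, h2, h3, fun j n hn => ?_⟩
      rcases eq_or_ne n i with rfl | hne
      · exact h5 j (Finset.mem_univ j)
      · exact h4 j n (by push_cast at hn; omega)
    intro s
    induction s using Finset.induction_on with
    | empty =>
      obtain ⟨c, hc, m', h1, h2, h3, h4⟩ := ih
      exact ⟨c, hc, m', h1, h2, h3, h4, by simp⟩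
    | insert j₀ s _ ihs =>
      obtain ⟨c, hc, m', h1, h2, h3, h4, h5⟩ := ihs
      -- In this case the coefficient vanishes already, by the definition of `minExt`. In the other
      -- one, 1 + i + exp j₀ is non-zero, which is the only obstruction to removing the coefficient.
      by_cases hcase : (fr p).exp j₀ = 0 ∧ i < 0
      · refine ⟨c, hc, m', h1, h2, h3, h4, fun j hj => ?_⟩
        rcases Finset.mem_insert.1 hj with rfl | hj
        · exact h1 p j hcase.1 i hcase.2
        · exact h5 j hj
      · have hne : (1 : ℂ) + i + (fr p).exp j₀ ≠ 0 := by
          rcases hfr p j₀ with h0 | h0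
          · rw [h0, add_zero]
            have : 0 ≤ i := by by_contra h; exact hcase ⟨h0, by omega⟩
            have h' : (1 + i : ℤ) ≠ 0 := by omega
            exact_mod_cast h'
          · intro h
            apply h0 (-(1 + i))
            have := congrArg Complex.re h
            simp only [Complex.add_re, Complex.one_re, Complex.intCast_re, Complex.zero_re] at this
            push_cast; linarith
        -- The operator ∏ (x - p) ∂ₓ - e multiplies the coefficients of order i by q(p) (exp j - exp
        -- j₀), so it kills that of j₀ and keeps the zeros already obtained. Modulo N it acts on m
        -- by a scalar, because (x - p) ∂ₓ m ≡ -m; the scalar is -q(p) (1 + i + exp j₀).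
        set e : ℂ := q.eval (p : ℂ) * (i + (fr p).exp j₀) with he
        have hcf : ∀ j, coeff ((fr p).basis.coord j (1 ⊗ₜ (polePoly P • M.D m' - C e • m'))) i
            = q.eval (p : ℂ) * ((fr p).exp j - (fr p).exp j₀)
              * coeff ((fr p).basis.coord j (1 ⊗ₜ m')) i := by
          intro j
          have h6 := coeff_mul_of_ordGE (ordGE_algebraMap_fin (p : ℂ) q)
            (ordGE_euler_add (h4 j) ((fr p).exp j))
          rw [zero_add, coeff_algebraMap_fin_zero, LocalField.coeff_add, coeff_euler,
            coeff_algebraMap_mul] at h6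
          rw [TensorProduct.tmul_sub, map_sub, LocalField.coeff_sub, coord_polePoly_smul_D p.2,
            h6, smul_one_tmul, map_smul, smul_eq_mul, algebraMap_C, coeff_algebraMap_mul, he]
          ring
        refine ⟨c * (-(q.eval (p : ℂ) * (1 + i + (fr p).exp j₀))),
          mul_ne_zero hc (neg_ne_zero.2 (mul_ne_zero hq0 hne)),
          polePoly P • M.D m' - C e • m', ?_, ?_, ?_, ?_, ?_⟩
        · exact Submodule.sub_mem _ (Submodule.smul_mem _ _ ((minExt fr).D_mem _ h1))
            (Submodule.smul_mem _ _ h1)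
        · exact Submodule.sub_mem _ (polePoly_smul_D_mem_boundedSections fr h2)
            (Submodule.smul_mem _ _ h2)
        · obtain ⟨g, hg⟩ : (X - C (p : ℂ)) ∣ q - C (q.eval (p : ℂ)) :=
            Polynomial.X_sub_C_dvd_sub_C_eval
          have k1 := N.toSubmodule.smul_mem (polePoly P) (N.D_mem _ h3)
          have k2 := N.toSubmodule.smul_mem (C e) h3
          have k3 := N.toSubmodule.smul_mem (C c * q) (N.D_mem _ hm)
          have k4 := N.toSubmodule.smul_mem (C c * g) hm
          have hqg : q = C (q.eval (p : ℂ)) + (X - C (p : ℂ)) * g := by rw [← hg]; ring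
          convert N.toSubmodule.sub_mem (N.toSubmodule.add_mem (N.toSubmodule.sub_mem k1 k2) k3)
            k4 using 1
          simp only [M.leibniz, map_sub, smul_add, smul_sub, smul_smul, 
            derivative_X, derivative_C, sub_zero, zero_smul, zero_add, mul_one]
          rw [show polePoly P * C c = C c * q * (X - C (p : ℂ)) by
            rw [polePoly_eq_mul p.2]; ring]
          have hm1 : (C c * q) • m = (C c * C (q.eval (p : ℂ))) • m
              + (C c * g * (X - C (p : ℂ))) • m := by
            rw [← add_smul]; congr 1
            conv_lhs => rw [hqg]
            ring
          rw [hm1]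
          have hm2 : C (c * -(eval (↑p) q * (1 + ↑i + (fr p).exp j₀))) • m
              = -((C c * C (q.eval (p : ℂ))) • m) - (C e * C c) • m := by
            rw [← neg_smul, ← sub_smul]; congr 1
            rw [he]; simp only [map_mul, map_neg, map_add, map_one]; ring
          rw [hm2]
          abel
        · intro j n hn
          rw [TensorProduct.tmul_sub, map_sub, coord_polePoly_smul_D p.2, smul_one_tmul, map_smul,
            smul_eq_mul, algebraMap_C, LocalField.coeff_sub, coeff_algebraMap_mul, h4 j n hn,
            mul_zero, sub_zero]
          exact ((ordGE_algebraMap_fin (p : ℂ) q).mul (ordGE_euler_add (h4 j) _)) n (by omega)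
        · intro j hj
          rw [hcf]
          rcases Finset.mem_insert.1 hj with rfl | hj
          · rw [sub_self, mul_zero, zero_mul]
          · rw [h5 j hj, mul_zero]

/-- Elements of the minimal extension with poles of order at most K form a noetherian module Λ, so a
single power k of x - p carries Λ into N. By `exists_congr_vanishing`, a non-zero multiple of m is
congruent modulo N to a section vanishing to order k at p. This section is (x - p)^k y with y again
in Λ, hence it lies in N. -/
theorem IsMeromorphicBundle.mem_of_punctual_quotient (hM : IsMeromorphicBundle P M)
    (hfr : ∀ p j, (fr p).exp j = 0 ∨ ∀ n : ℤ, ((fr p).exp j).re ≠ n) {N : M.Sub} (p : P)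
    (hN : ∀ m ∈ (minExt fr).toSubmodule, ∃ k : ℕ, (X - C (p : ℂ) : ℂ[X]) ^ k • m ∈ N.toSubmodule)
    {m : M} (hmL : m ∈ (minExt fr).toSubmodule)
    (hm : (X - C (p : ℂ) : ℂ[X]) • m ∈ N.toSubmodule) : m ∈ N.toSubmodule := by
  obtain ⟨K, hK⟩ := exists_mem_boundedSections fr m
  have := hM.isNoetherian_boundedSections fr K
  let Λ := (minExt fr).toSubmodule ⊓ boundedSections fr K
  have hΛ : IsNoetherian ℂ[X] Λ :=
    isNoetherian_of_le (inf_le_right : Λ ≤ boundedSections fr K)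
  obtain ⟨s, hs⟩ := (isNoetherian_submodule.1 hΛ Λ le_rfl)
  have hk : ∃ k : ℕ, ∀ y ∈ Λ, (X - C (p : ℂ) : ℂ[X]) ^ k • y ∈ N.toSubmodule := by
    have hsL : ∀ y ∈ s, y ∈ (minExt fr).toSubmodule := fun y hy =>
      ((hs ▸ Submodule.subset_span hy : y ∈ Λ)).1
    choose! k hk using hN
    refine ⟨∑ y ∈ s, k y, fun y hy => ?_⟩
    rw [← hs] at hy
    induction hy using Submodule.span_induction with
    | mem y hy =>
      have hle := Finset.single_le_sum (f := k) (fun _ _ => Nat.zero_le _) (Finset.mem_coe.1 hy)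
      obtain ⟨l, hl⟩ := Nat.exists_eq_add_of_le hle
      rw [hl, add_comm, pow_add, mul_smul]
      exact N.toSubmodule.smul_mem _ (hk y (hsL y hy))
    | zero => rw [smul_zero]; exact N.toSubmodule.zero_mem
    | add a b _ _ ha hb => rw [smul_add]; exact N.toSubmodule.add_mem ha hb
    | smul f a _ ha => rw [smul_comm]; exact N.toSubmodule.smul_mem _ ha
  obtain ⟨k, hk⟩ := hk
  obtain ⟨c, hc, m', h1, h2, h3, h4⟩ := exists_congr_vanishing fr hfr p hmL hm hK (K + k)
  obtain ⟨y, rfl⟩ := hM.exists_X_sub_C_pow_smul_eq p.2 k m'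
  have hy0 : ∀ j, OrdGE ((fr p).basis.coord j (1 ⊗ₜ y)) 0 := by
    intro j
    have := h4 j
    rw [smul_one_tmul, map_smul, smul_eq_mul, map_pow, algebraMap_X_sub_C, ← zpow_natCast] at this
    refine (ordGE_t_zpow_mul_iff (k := (k : ℤ))).1 (this.mono ?_)
    push_cast; omega
  have hy1 : ∀ (p' : P), p' ≠ p → ∀ j N', OrdGE ((fr p').basis.coord j
      (1 ⊗ₜ ((X - C (p : ℂ) : ℂ[X]) ^ k • y))) N' → OrdGE ((fr p').basis.coord j (1 ⊗ₜ y)) N' := by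
    intro p' hp' j N' h
    rw [smul_one_tmul, map_smul, smul_eq_mul] at h
    refine ordGE_of_mul ?_ h
    rw [eval_pow, eval_sub, eval_X, eval_C]
    exact pow_ne_zero _ (sub_ne_zero.2 fun h => hp' (Subtype.ext h))
  have hyΛ : y ∈ Λ := by
    constructor
    · intro p' j hj
      by_cases h : p' = p
      · subst h; exact hy0 j
      · exact hy1 p' h j 0 (h1 p' j hj)
    · intro p' j
      by_cases h : p' = p
      · subst h; exact (hy0 j).mono (by omega)
      · exact hy1 p' h j _ (h2 p' j)
  have := (Submodule.sub_mem_iff_right _ (hk y hyΛ)).1 h3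
  exact (N.C_smul_mem_iff hc).1 this

theorem IsMeromorphicBundle.isMinimalExtension_minExt (hM : IsMeromorphicBundle P M)
    (hfr : ∀ p j, (fr p).exp j = 0 ∨ ∀ n : ℤ, ((fr p).exp j).re ≠ n) :
    (minExt fr).IsMinimalExtension P := by
  refine ⟨exists_pow_smul_mem_minExt fr, fun p N hN => ?_, fun p N hN => ?_⟩
  · rw [eq_bot_iff]
    intro m hm
    obtain ⟨k, hk⟩ := hN m hm
    have h1 : (X - C p : ℂ[X]) ^ k • (minExt fr).incl m = 0 := by rw [← map_smul, hk, map_zero]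
    have h2 := hM.smul_eq_zero (pow_ne_zero k (Polynomial.X_sub_C_ne_zero p)) h1
    rw [Submodule.mem_bot]
    exact Subtype.ext h2
  · rw [eq_top_iff]
    intro m _
    by_cases hp : p ∈ P
    · have hN' : ∀ m ∈ (minExt fr).toSubmodule, ∃ k : ℕ,
          (X - C p : ℂ[X]) ^ k • m ∈ (Sub.push N).toSubmodule := fun m hm => by
        obtain ⟨k, hk⟩ := hN ⟨m, hm⟩
        exact ⟨k, _, hk, rfl⟩
      obtain ⟨k, hk⟩ := hN m
      induction k with
      | zero => simpa using hk
      | succ k ih =>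
        apply ih
        rw [pow_succ', mul_smul] at hk
        refine (Sub.mem_push N).1 (hM.mem_of_punctual_quotient fr hfr ⟨p, hp⟩ hN' ?_ ?_)
        · exact Sub.incl_mem _ _
        · exact ⟨_, hk, rfl⟩
    -- Away from P there is no torsion modulo the saturation of N. So a power of the pole polynomial
    -- sends m into N as well, and it is coprime to the power of x - p.
    · obtain ⟨k, hk⟩ := hN m
      have h1 : (X - C p : ℂ[X]) ^ k • (minExt fr).incl m
          ∈ ((Sub.push N).saturation (polePoly P)).toSubmodule :=
        ⟨0, by rw [pow_zero, one_smul]; exact ⟨_, hk, rfl⟩⟩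
      obtain ⟨l, hl⟩ := hM.mem_of_smul_mem (Sub.isSubbundle_saturation _)
        (pow_ne_zero k (Polynomial.X_sub_C_ne_zero p)) h1
      rw [← map_smul, Sub.mem_push] at hl
      have hcop : IsCoprime ((X - C p : ℂ[X]) ^ k) (polePoly P ^ l) := by
        refine IsCoprime.pow (IsCoprime.prod_right fun q hq => ?_)
        exact Polynomial.isCoprime_X_sub_C_of_isUnit_sub
          (sub_ne_zero.2 fun h : p = q => hp (h ▸ hq)).isUnit
      obtain ⟨a, b, hab⟩ := hcop
      rw [← one_smul ℂ[X] m, ← hab, add_smul, mul_smul, mul_smul]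
      exact N.toSubmodule.add_mem (N.toSubmodule.smul_mem _ hk) (N.toSubmodule.smul_mem _ hl)

end Quotient

end WeylModule

/-! ### Approximation by sections, and components of sections of a submodule. -/

namespace LocalField

/-- The polynomial which is, up to inversion, the local coordinate. -/
def coordPoly : Place → ℂ[X]
  | .fin p => X - C p
  | .infty => X

/-- The order of `coordPoly v` at `v`. -/
def coordSign : Place → ℤ
  | .fin _ => 1
  | .infty => -1

theorem algebraMap_coordPoly (v : Place) :
    algebraMap ℂ[X] (LocalField v) (coordPoly v) = t v ^ coordSign v := by
  cases v with
  | fin p => simp [coordPoly, coordSign, algebraMap_X_sub_C, -map_sub]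
  | infty => simp [coordPoly, coordSign, algebraMap_X_infty]

theorem algebraMap_coordPoly_pow (v : Place) (n : ℕ) :
    algebraMap ℂ[X] (LocalField v) (coordPoly v ^ n) = t v ^ (coordSign v * n) := by
  rw [map_pow, algebraMap_coordPoly, zpow_mul, zpow_natCast]

/-- Approximation of Laurent series by polynomials. -/
theorem exists_polynomial_approx {v : Place} (g : LocalField v) (N : ℤ) :
    ∃ n₀ : ℕ, ∀ n ≥ n₀, ∃ (f : ℂ[X]) (r : LocalField v), OrdGE r N ∧
      algebraMap ℂ[X] (LocalField v) f = algebraMap ℂ[X] _ (coordPoly v ^ n) * (g + r) := by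
  obtain ⟨a, ha⟩ := exists_ordGE g
  cases v with
  | fin p =>
    refine ⟨a.natAbs, fun n hn => ?_⟩
    have h0 : OrdGE (t (.fin p) ^ (n : ℤ) * g) 0 :=
      ((ordGE_t_zpow (n : ℤ)).mul ha).mono (by omega)
    obtain ⟨h, hh⟩ := ordGE_zero_iff.1 h0
    set f : ℂ[X] := (PowerSeries.trunc (N + n).toNat h).comp (X - C p) with hf
    have hf' : algebraMap ℂ[X] (LocalField (.fin p)) f
        = ofPowerSeries (.fin p) (PowerSeries.trunc (N + n).toNat h : ℂ[X]) := by
      rw [algebraMap_fin, hf, Polynomial.comp_assoc]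
      simp
    have ht := zpow_ne_zero n (t_ne_zero (.fin p))
    refine ⟨f, t (.fin p) ^ (-n : ℤ) * algebraMap ℂ[X] _ f - g, ?_, ?_⟩
    · rw [← ordGE_t_zpow_mul_iff (k := (n : ℤ))]
      intro k hk
      rw [mul_sub, ← mul_assoc, ← zpow_add₀ (t_ne_zero _), add_neg_cancel, zpow_zero, one_mul, hh,
        hf', ← map_sub]
      rcases lt_or_ge k 0 with hk0 | hk0
      · exact coeff_ofPowerSeries_of_neg _ hk0
      · obtain ⟨l, rfl⟩ := Int.eq_ofNat_of_zero_le hk0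
        rw [coeff_ofPowerSeries, map_sub, Polynomial.coeff_coe, PowerSeries.coeff_trunc,
          if_pos (by omega), sub_self]
    · rw [algebraMap_coordPoly_pow, coordSign, one_mul, add_sub_cancel, ← mul_assoc,
        ← zpow_add₀ (t_ne_zero _), add_neg_cancel, zpow_zero, one_mul]
  | infty =>
    refine ⟨N.natAbs, fun n hn => ?_⟩
    set D := n + a.natAbs + 1 with hD
    set f : ℂ[X] := ∑ i ∈ Finset.range D, C (coeff g (n - i)) * X ^ i with hf
    refine ⟨f, t .infty ^ (n : ℤ) * algebraMap ℂ[X] _ f - g, ?_, ?_⟩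
    · intro k hk
      rw [LocalField.coeff_sub, coeff_t_zpow_mul, coeff_algebraMap_infty, if_pos (by omega), hf]
      simp only [Polynomial.finsetSum_coeff, Polynomial.coeff_C_mul_X_pow, Finset.sum_ite_eq,
        Finset.mem_range]
      split_ifs with h
      · rw [show (n : ℤ) - ((-(k - n)).toNat : ℤ) = k by omega, sub_self]
      · rw [ha k (by omega), sub_zero]
    · rw [algebraMap_coordPoly_pow, coordSign, add_sub_cancel, ← mul_assoc,
        ← zpow_add₀ (t_ne_zero _)]
      simp

end LocalField

namespace WeylModule

open LocalField

variable {M : WeylModule.{u}} {v : Place}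

/-- The span of the expansions of the elements of a submodule. -/
def complSpan (v : Place) (B : Submodule ℂ[X] M) : Submodule (LocalField v) (M.Compl v) :=
  Submodule.span (LocalField v) ((fun m => (1 : LocalField v) ⊗ₜ[ℂ[X]] m) '' (B : Set M))

theorem one_tmul_mem_complSpan {B : Submodule ℂ[X] M} {m : M} (hm : m ∈ B) :
    (1 : LocalField v) ⊗ₜ[ℂ[X]] m ∈ complSpan v B := Submodule.subset_span ⟨m, hm, rfl⟩

/-- Elements of the completion are approximated by sections, up to a power of the local
coordinate. -/
theorem Frame.exists_approx (fr : M.Frame v) {B : Submodule ℂ[X] M} {z : M.Compl v}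
    (hz : z ∈ complSpan v B) (N : ℤ) : ∃ n₀ : ℕ, ∀ n ≥ n₀, ∃ m ∈ B, ∃ y : M.Compl v,
      (∀ j, OrdGE (fr.basis.coord j y) N) ∧
      (1 : LocalField v) ⊗ₜ[ℂ[X]] m = algebraMap ℂ[X] (LocalField v) (coordPoly v ^ n) • (z + y) := by
  have hz' : z ∈ (Submodule.span (LocalField v)
    ((fun m => (1 : LocalField v) ⊗ₜ[ℂ[X]] m) '' (B : Set M))).toAddSubmonoid := hz
  rw [Submodule.span_eq_closure] at hz'
  induction hz' using AddSubmonoid.closure_induction with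
  | mem z h =>
    obtain ⟨g, -, _, ⟨m, hm, rfl⟩, rfl⟩ := h
    choose l hl using fun j => exists_ordGE (fr.basis.coord j (1 ⊗ₜ m))
    obtain ⟨n₀, hn₀⟩ := exists_polynomial_approx g (N + ∑ j, (l j).natAbs)
    refine ⟨n₀, fun n hn => ?_⟩
    obtain ⟨f, r, hr, hf⟩ := hn₀ n hn
    refine ⟨f • m, B.smul_mem f hm, r • (1 ⊗ₜ m), fun j => ?_, ?_⟩
    · rw [map_smul, smul_eq_mul]
      refine (hr.mul (hl j)).mono ?_
      have := Finset.single_le_sum (f := fun j => (l j).natAbs) (fun _ _ => Nat.zero_le _)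
        (Finset.mem_univ j)
      have h3 : ((l j).natAbs : ℤ) ≤ ∑ j, ((l j).natAbs : ℤ) := by exact_mod_cast this
      omega
    · rw [smul_one_tmul, hf]
      change _ = _ • (g • _ + _)
      rw [← add_smul, smul_smul]
  | zero =>
    exact ⟨0, fun n _ => ⟨0, B.zero_mem, 0, fun j => by rw [map_zero]; exact ordGE_zero _,
      by simp⟩⟩
  | add a b ha' hb' ha hb =>
    obtain ⟨n₁, h₁⟩ := ha (by
      have : a ∈ (Submodule.span (LocalField v)
        ((fun m => (1 : LocalField v) ⊗ₜ[ℂ[X]] m) '' (B : Set M))).toAddSubmonoid := by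
        rw [Submodule.span_eq_closure]; exact ha'
      exact this)
    obtain ⟨n₂, h₂⟩ := hb (by
      have : b ∈ (Submodule.span (LocalField v)
        ((fun m => (1 : LocalField v) ⊗ₜ[ℂ[X]] m) '' (B : Set M))).toAddSubmonoid := by
        rw [Submodule.span_eq_closure]; exact hb'
      exact this)
    refine ⟨max n₁ n₂, fun n hn => ?_⟩
    obtain ⟨m, hm, y, hy, e⟩ := h₁ n (le_trans (le_max_left _ _) hn)
    obtain ⟨m', hm', y', hy', e'⟩ := h₂ n (le_trans (le_max_right _ _) hn)
    refine ⟨m + m', B.add_mem hm hm', y + y', fun j => ?_, ?_⟩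
    · rw [map_add]; exact (hy j).add (hy' j)
    · rw [TensorProduct.tmul_add, e, e', ← smul_add]
      congr 1; abel

namespace Frame

variable (fr : M.Frame v)

/-- On the part with factor ζ, the operator ∂ₓ - ζ shifts orders by one, with a scalar that vanishes
only if the eigenvalue of the source is 0. Non-integral eigenvalues can thus be lowered at a finite
point, and raised at infinity, within a submodule over the Weyl algebra. -/
theorem cf_conn_sub {ζ : ℂ} (hζ : v.Adm ζ) (z : M.Compl v) {j : fr.ι} (hj : fr.fac j = ζ) (k : ℤ) :
    fr.cf (M.conn v z - ζ • z) j k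
      = coordSign v * (k + coordSign v + fr.exp j) * fr.cf z j (k + coordSign v) := by
  rw [cf_sub, cf_smul, cf, fr.coord_conn, hj]
  cases v with
  | fin p =>
    rw [hζ p rfl]
    simp only [map_zero, zero_add, LocalField.coeff_add, coeff_der_fin, eulerCoeff, mul_assoc,
      coeff_t_inv_mul, coeff_algebraMap_mul, coordSign, cf]
    push_cast; ring
  | infty =>
    simp only [LocalField.coeff_add, coeff_der_infty, eulerCoeff, add_mul, inv_neg, inv_inv,
      mul_assoc, neg_mul, coeff_neg, coeff_t_mul, coeff_algebraMap_mul, coordSign, cf]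
    push_cast
    rw [← sub_eq_add_neg]
    ring_nf

theorem coordSign_ne_zero (v : Place) : (coordSign v : ℂ) ≠ 0 := by
  cases v <;> simp [coordSign]

/-- A vector of the completion of a submodule with a non-integral eigenvalue is the component of a
section of the submodule. -/
theorem exists_isComponent (fr : M.Frame v) {ζ : ℂ} (hζ : v.Adm ζ) {N : M.Sub} {α : ℂ} (hα : ∀ n : ℤ, α ≠ n)
    {w : M.Compl v} (hw : w ∈ M.psi v ζ α) (hwN : w ∈ complSpan v N.toSubmodule) :
    ∃ m ∈ N.toSubmodule, M.IsComponent v ζ α m w := by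
  -- Approximation yields a section with the right coefficients displaced by n powers of the
  -- coordinate. Each application of ∂ₓ - ζ undoes one of the displacements up to the scalar c,
  -- non-zero because β is not an integer.
  have key : ∀ n : ℕ, ∀ (β : ℂ) (w : M.Compl v), (∀ n : ℤ, β ≠ n) → w ∈ M.psi v ζ β →
      (∃ m ∈ N.toSubmodule, ∀ j (k : ℤ), fr.fac j = ζ → k + fr.exp j = β →
        fr.cf w j k = fr.cf (1 ⊗ₜ m) j (k + coordSign v * n)) →
      ∃ m ∈ N.toSubmodule, M.IsComponent v ζ β m w := by
    intro n
    induction n with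
    | zero =>
      rintro β w - hw ⟨m, hm, h⟩
      exact ⟨m, hm, (fr.isComponent_iff hζ β m w).2 ⟨hw, by simpa using h⟩⟩
    | succ n ih =>
      rintro β w hβ hw ⟨m, hm, h⟩
      have hβ' : ∀ n : ℤ, β + coordSign v ≠ n := fun k hk =>
        hβ (k - coordSign v) (by push_cast; linear_combination hk)
      obtain ⟨m', hm', hc⟩ := ih (β + coordSign v) (t v ^ coordSign v • w) hβ' (by
          rw [fr.mem_psi_iff hζ] at hw ⊢
          intro j k hjk
          rw [cf_t_zpow_smul]
          refine hw j _ fun h => hjk ⟨h.1, ?_⟩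
          rw [← h.2]; push_cast; ring) ⟨m, hm, fun j k hj hk => by
            rw [cf_t_zpow_smul, h j _ hj (by push_cast; linear_combination hk)]
            congr 1; push_cast; ring⟩
      rw [fr.isComponent_iff hζ] at hc
      set c : ℂ := coordSign v * (β + coordSign v) with hcdef
      have hc0 : c ≠ 0 := mul_ne_zero (coordSign_ne_zero v) (by simpa using hβ' 0)
      refine ⟨C c⁻¹ • (M.D m' - C ζ • m'), N.toSubmodule.smul_mem _ (N.toSubmodule.sub_mem
        (N.D_mem _ hm') (N.toSubmodule.smul_mem _ hm')), ?_⟩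
      rw [fr.isComponent_iff hζ]
      refine ⟨hw, fun j k hj hk => ?_⟩
      have h1 := hc.2 j (k + coordSign v) hj (by push_cast; linear_combination hk)
      rw [cf_t_zpow_smul, add_sub_cancel_right] at h1
      rw [smul_one_tmul, TensorProduct.tmul_sub, one_tmul_D, smul_one_tmul, algebraMap_C,
        algebraMap_C, algebraMap_smul_compl, algebraMap_smul_compl, cf_smul,
        fr.cf_conn_sub hζ _ hj, ← h1,
        show (k : ℂ) + coordSign v + fr.exp j = β + coordSign v by linear_combination hk,
        ← hcdef, inv_mul_cancel_left₀ hc0]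
  choose l hl using fun j => exists_int_gt ((α - fr.exp j).re)
  -- The precision exceeds every order n with n + exp j = α, so the error has no coefficient with
  -- eigenvalue α.
  obtain ⟨n₀, h⟩ := fr.exists_approx hwN (∑ j, (l j).natAbs)
  obtain ⟨m, hm, y, hy, e⟩ := h n₀ le_rfl
  refine key n₀ α w hα hw ⟨m, hm, fun j k hj hk => ?_⟩
  rw [e, algebraMap_coordPoly_pow, cf_t_zpow_smul, add_sub_cancel_right, cf_add]
  have : fr.cf y j k = 0 := by
    refine hy j k ?_
    have h1 := hl j
    rw [← hk, add_sub_cancel_right, Complex.intCast_re] at h1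
    have h2 : k < l j := by exact_mod_cast h1
    have h4 := Finset.single_le_sum (f := fun j => (l j).natAbs) (fun _ _ => Nat.zero_le _)
      (Finset.mem_univ j)
    have h3 : ((l j).natAbs : ℤ) ≤ ∑ j, ((l j).natAbs : ℤ) := by exact_mod_cast h4
    omega
  rw [this, add_zero]

theorem finite_compl (fr : M.Frame v) : Module.Finite (LocalField v) (M.Compl v) := Module.Finite.of_basis fr.basis

/-- A subspace of the completion stable under the connection is spanned by eigenvectors. -/
theorem span_eigenvectors (S : Submodule (LocalField v) (M.Compl v))
    (hS : ∀ z ∈ S, M.conn v z ∈ S) :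
    S ≤ Submodule.span (LocalField v) {w | w ∈ S ∧ ∃ j, w ∈ M.psi v (fr.fac j) (fr.exp j)} := by
  classical
  have := fr.finite_compl
  induction hd : Module.finrank (LocalField v) S using Nat.strong_induction_on generalizing S with
  | _ d ih =>
  by_cases hbot : S = ⊥
  · rw [hbot]; exact bot_le
  -- A non-zero vector of S with the fewest non-zero coordinates, scaled to have a coordinate 1,
  -- satisfies ∇w = λw: the difference lies in S and has fewer coordinates. Subtracting multiples of
  -- w leaves a stable subspace of smaller dimension.
  have hex : ∃ n : ℕ, ∃ z ∈ S, z ≠ 0 ∧ (Finset.univ.filter fun j => fr.basis.coord j z ≠ 0).card = n := by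
    obtain ⟨z, hz, h0⟩ := Submodule.exists_mem_ne_zero_of_ne_bot hbot
    exact ⟨_, z, hz, h0, rfl⟩
  obtain ⟨z, hzS, hz0, hzn⟩ := Nat.find_spec hex
  obtain ⟨j₀, hj₀⟩ : ∃ j, fr.basis.coord j z ≠ 0 := by
    by_contra h
    push Not at h
    exact hz0 (fr.basis.ext_elem fun j => by
      have := h j
      rw [Module.Basis.coord_apply] at this
      rw [this, map_zero, Finsupp.zero_apply])
  set g := fr.basis.coord j₀ z with hg
  obtain ⟨w, hw⟩ : ∃ w, w = g⁻¹ • z := ⟨_, rfl⟩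
  have hwS : w ∈ S := hw ▸ S.smul_mem _ hzS
  have hw1 : fr.basis.coord j₀ w = 1 := by
    rw [hw, map_smul, smul_eq_mul, ← hg, inv_mul_cancel₀ hj₀]
  have hd1 : der v (1 : LocalField v) = 0 := by simpa using der_algebraMap v 1
  set lam := algebraMap ℂ (LocalField v) (fr.fac j₀)
    + (eulerCoeff v)⁻¹ * algebraMap ℂ _ (fr.exp j₀) with hlam
  have hy : M.conn v w - lam • w = 0 := by
    by_contra hne
    have hlt : (Finset.univ.filter fun j => fr.basis.coord j (M.conn v w - lam • w) ≠ 0).card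
        < Nat.find hex := by
      rw [← hzn]
      apply Finset.card_lt_card
      rw [Finset.ssubset_iff_of_subset]
      · refine ⟨j₀, Finset.mem_filter.2 ⟨Finset.mem_univ _, hj₀⟩, ?_⟩
        simp only [Finset.mem_filter, Finset.mem_univ, true_and, not_not]
        rw [map_sub, fr.coord_conn, map_smul, hw1, hd1, ← hlam, smul_eq_mul, zero_add, sub_self]
      · intro j
        simp only [Finset.mem_filter, Finset.mem_univ, true_and]
        intro h h0
        apply h
        have : fr.basis.coord j w = 0 := by rw [hw, map_smul, h0, smul_zero]
        rw [map_sub, fr.coord_conn, map_smul, this]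
        simp
    exact Nat.find_min hex hlt ⟨_, S.sub_mem (hS _ hwS) (S.smul_mem _ hwS), hne, rfl⟩
  have hwpsi : w ∈ M.psi v (fr.fac j₀) (fr.exp j₀) := by
    refine (Module.End.mem_maxGenEigenspace _ _ _).2 ⟨1, ?_⟩
    rw [pow_one, LinearMap.sub_apply, LinearMap.smul_apply, Module.End.one_apply]
    have h1 : M.eulerOp v (fr.fac j₀) w
        = eulerCoeff v • (M.conn v w - algebraMap ℂ (LocalField v) (fr.fac j₀) • w) := by
      rw [algebraMap_smul_compl]; rfl
    rw [h1, sub_eq_zero.1 hy, hlam, ← sub_smul, add_sub_cancel_left, smul_smul,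
      mul_inv_cancel_left₀ (eulerCoeff_ne_zero v), algebraMap_smul_compl, sub_self]
  set S₁ := S ⊓ LinearMap.ker (fr.basis.coord j₀) with hS₁
  have hS₁c : ∀ z ∈ S₁, M.conn v z ∈ S₁ := fun z hz => by
    refine ⟨hS z hz.1, LinearMap.mem_ker.2 ?_⟩
    rw [fr.coord_conn, LinearMap.mem_ker.1 hz.2]
    simp
  have hlt : Module.finrank (LocalField v) S₁ < d := by
    rw [← hd]
    apply Submodule.finrank_lt_finrank_of_lt
    refine lt_of_le_of_ne inf_le_left fun h => ?_
    have : w ∈ S₁ := h ▸ hwS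
    have := LinearMap.mem_ker.1 this.2
    rw [hw1] at this
    exact one_ne_zero this
  have hle := ih _ hlt S₁ hS₁c rfl
  intro z hz
  have h1 : z - fr.basis.coord j₀ z • w ∈ S₁ := by
    refine ⟨S.sub_mem hz (S.smul_mem _ hwS), LinearMap.mem_ker.2 ?_⟩
    rw [map_sub, map_smul, hw1, smul_eq_mul, mul_one, sub_self]
  rw [← sub_add_cancel z (fr.basis.coord j₀ z • w)]
  refine Submodule.add_mem _ ?_ (Submodule.smul_mem _ _ (Submodule.subset_span ⟨hwS, j₀, hwpsi⟩))
  refine Submodule.span_mono ?_ (hle h1)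
  rintro y ⟨hy, hy'⟩
  exact ⟨hy.1, hy'⟩

/-- A subspace of the completion stable under the connection contains the components of its
elements. -/
theorem psi_part_mem {ζ : ℂ} (hζ : v.Adm ζ) {S : Submodule (LocalField v) (M.Compl v)}
    (hS : ∀ z ∈ S, M.conn v z ∈ S) {z w : M.Compl v} (hz : z ∈ S) {α : ℂ}
    (hw : w ∈ M.psi v ζ α)
    (h : ∀ j (n : ℤ), fr.fac j = ζ → n + fr.exp j = α → fr.cf w j n = fr.cf z j n) : w ∈ S := by
  have hz' : z ∈ (Submodule.span (LocalField v)
    {w | w ∈ S ∧ ∃ j, w ∈ M.psi v (fr.fac j) (fr.exp j)}).toAddSubmonoid :=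
    fr.span_eigenvectors S hS hz
  rw [Submodule.span_eq_closure] at hz'
  clear hz
  induction hz' using AddSubmonoid.closure_induction generalizing w with
  | mem z hz =>
    obtain ⟨g, -, w₀, ⟨hw₀, j₀, hj₀⟩, rfl⟩ := hz
    have hj₀' := hj₀
    rw [fr.mem_psi_iff (fr.adm_fac j₀)] at hj₀
    by_cases hcase : fr.fac j₀ = ζ ∧ ∃ n : ℤ, n + fr.exp j₀ = α
    · obtain ⟨h1, n, h2⟩ := hcase
      have : w = coeff g n • t v ^ n • w₀ := by
        refine fr.psi_ext hζ hw (Submodule.smul_mem _ _ ?_) fun j k hj hk => ?_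
        · rw [fr.mem_psi_iff hζ]
          intro j k hjk
          rw [cf_t_zpow_smul]
          refine hj₀ j _ fun h3 => hjk ⟨h3.1.trans h1, ?_⟩
          rw [← h2, ← h3.2]; push_cast; ring
        · rw [h j k hj hk, cf_smul, cf_t_zpow_smul]
          change fr.cf (g • w₀) j k = _
          have hsing : fr.basis.coord j w₀ = algebraMap ℂ _ (fr.cf w₀ j (k - n)) * t v ^ (k - n) := by
            ext l
            rw [coeff_algebraMap_mul, coeff_t_zpow]
            by_cases hl : l = k - n
            · rw [if_pos hl, mul_one, hl]; rfl
            · rw [if_neg hl, mul_zero]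
              refine hj₀ j l fun h3 => hl ?_
              have h5 : (l : ℂ) = ((k - n : ℤ) : ℂ) := by
                push_cast; linear_combination h3.2 - hk + h2
              exact_mod_cast h5
          rw [cf, map_smul, smul_eq_mul, hsing, mul_left_comm, coeff_algebraMap_mul, mul_comm g,
            coeff_t_zpow_mul, sub_sub_cancel, mul_comm]
      rw [this, ← algebraMap_smul_compl]
      exact S.smul_mem _ (S.smul_mem _ hw₀)
    · have : w = 0 := by
        refine fr.psi_ext hζ hw (Submodule.zero_mem _) fun j k hj hk => ?_
        rw [h j k hj hk, cf_zero]
        change fr.cf (g • w₀) j k = 0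
        have h0 : fr.basis.coord j w₀ = 0 := by
          ext l
          refine hj₀ j l fun h3 => hcase ⟨h3.1.symm.trans hj, k - l, ?_⟩
          push_cast; linear_combination hk - h3.2
        rw [cf, map_smul, h0, smul_zero, LocalField.coeff_zero]
      rw [this]; exact S.zero_mem
  | zero =>
    have : w = 0 := fr.psi_ext hζ hw (Submodule.zero_mem _) h
    rw [this]; exact S.zero_mem
  | add a b _ _ ha hb =>
    obtain ⟨wa, hwa, ha'⟩ := fr.exists_psi_part hζ α a
    obtain ⟨wb, hwb, hb'⟩ := fr.exists_psi_part hζ α b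
    have : w = wa + wb := by
      refine fr.psi_ext hζ hw (Submodule.add_mem _ hwa hwb) fun j k hj hk => ?_
      rw [h j k hj hk, cf_add, cf_add, ha' j k hj hk, hb' j k hj hk]
    rw [this]
    exact S.add_mem (ha hwa ha') (hb hwb hb')

theorem conn_mem_complSpan (N : M.Sub) {z : M.Compl v} (hz : z ∈ complSpan v N.toSubmodule) :
    M.conn v z ∈ complSpan v N.toSubmodule := by
  induction hz using Submodule.span_induction with
  | mem z hz =>
    obtain ⟨m, hm, rfl⟩ := hz
    change M.conn v (1 ⊗ₜ m) ∈ _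
    rw [← one_tmul_D]
    exact one_tmul_mem_complSpan (N.D_mem m hm)
  | zero => rw [map_zero]; exact Submodule.zero_mem _
  | add a b _ _ ha hb => rw [map_add]; exact Submodule.add_mem _ ha hb
  | smul g z hz' hz =>
    rw [conn_smul]
    exact Submodule.add_mem _ (Submodule.smul_mem _ _ hz') (Submodule.smul_mem _ _ hz)

/-- The completion of a submodule is stable under the connection, so it contains the components of
its elements. With `Frame.exists_isComponent`, its vectors of non-integral eigenvalue are exactly
the components of sections. -/
theorem mem_complSpan_of_isComponent (fr : M.Frame v) {ζ : ℂ} (hζ : v.Adm ζ) {N : M.Sub} {α : ℂ} {m : M}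
    (hm : m ∈ N.toSubmodule) {w : M.Compl v} (h : M.IsComponent v ζ α m w) :
    w ∈ complSpan v N.toSubmodule := by
  rw [fr.isComponent_iff hζ] at h
  exact fr.psi_part_mem hζ (fun z hz => conn_mem_complSpan N hz) (one_tmul_mem_complSpan hm) h.1 h.2

end Frame

end WeylModule

/-! ### Gamma factors and the Laplace transform of expansions. -/

namespace LocalField

theorem OrdGE.rescale {v : Place} (v' : Place) {g : LocalField v} {N : ℤ} (hg : OrdGE g N)
    (c : ℤ → ℂ) : OrdGE (rescale v v' c g) N := fun n hn => by
  rw [coeff_rescale, hg n hn, mul_zero]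

theorem OrdGE.of_rescale {v v' : Place} {g : LocalField v} {N : ℤ} {c : ℤ → ℂ} (hc : ∀ n, c n ≠ 0)
    (hg : OrdGE (LocalField.rescale v v' c g) N) : OrdGE g N := fun n hn =>
  (mul_eq_zero.1 (hg n hn)).resolve_left (hc n)

/-- Vectors with linearly independent leading terms span. -/
theorem eq_top_of_leading_terms {v : Place} {I : Type*} [Fintype I] [DecidableEq I]
    {S : Submodule (LocalField v) (I → LocalField v)}
    (h : ∀ i, ∃ u ∈ S, ∃ n : ℤ, ∃ c : ℂ, c ≠ 0 ∧ ∀ i', OrdGE (u i') n ∧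
      coeff (u i') n = if i' = i then c else 0) : S = ⊤ := by
  have h' : ∀ i, ∃ u ∈ S, ∀ i', OrdGE (u i') 0 ∧ coeff (u i') 0 = if i' = i then 1 else 0 := by
    intro i
    obtain ⟨u, hu, n, c, hc, h⟩ := h i
    refine ⟨(algebraMap ℂ (LocalField v) c⁻¹ * t v ^ (-n)) • u, S.smul_mem _ hu, fun i' => ?_⟩
    have e : ∀ k, coeff (((algebraMap ℂ (LocalField v) c⁻¹ * t v ^ (-n)) • u) i') k
        = c⁻¹ * coeff (u i') (k + n) := fun k => by
      rw [Pi.smul_apply, smul_eq_mul, mul_assoc, coeff_algebraMap_mul, coeff_t_zpow_mul,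
        sub_neg_eq_add]
    refine ⟨fun k hk => ?_, ?_⟩
    · rw [e, (h i').1 _ (by omega), mul_zero]
    · rw [e, zero_add, (h i').2]
      split_ifs <;> simp [hc]
  choose u hu h1 using h'
  choose G hG using fun i' i => ordGE_zero_iff.1 (h1 i i').1
  -- After normalization the vectors are the columns of a matrix of power series with constant term
  -- 1.
  obtain ⟨e, he⟩ := exists_basis_of_gauge (Pi.basisFun (LocalField v) I) (Matrix.of G)
    (fun i' i => by
      have := (h1 i i').2
      rw [hG i' i] at this
      have h2 := coeff_ofPowerSeries (v := v) (G i' i) 0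
      rw [Nat.cast_zero, this] at h2
      rw [Matrix.of_apply, ← PowerSeries.coeff_zero_eq_constantCoeff_apply, ← h2])
  rw [eq_top_iff, ← e.span_eq, Submodule.span_le]
  rintro _ ⟨i, rfl⟩
  have : e i = u i := by
    rw [he]
    funext i'
    rw [Finset.sum_apply, Finset.sum_eq_single i']
    · rw [hG i' i]; simp
    · intro k _ hk
      simp [Ne.symm hk]
    · simp
  rw [this]
  exact hu i

end LocalField

namespace WeylModule

open LocalField

/-- A linear map on the Laplace transform from a linear map which sends `∂ₓ` to the multiplication by
the coordinate. -/
def laplaceLift {N : WeylModule.{u}} {v : Place} (φ : N →ₗ[ℂ] LocalField v)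
    (h : ∀ m, φ (N.D m) = x v * φ m) : N.laplace →ₗ[ℂ[X]] LocalField v where
  toFun m := φ (show N from m)
  map_add' a b := φ.map_add _ _
  map_smul' f m := by
    change φ (aeval N.dLin f (show N from m)) = f • φ (show N from m)
    rw [Algebra.smul_def, LocalField.algebraMap_def]
    generalize (show N from m) = m
    induction f using Polynomial.induction_on generalizing m with
    | C a => simp [Algebra.smul_def]
    | add p q hp hq => simp only [map_add, LinearMap.add_apply, hp, hq, add_mul]
    | monomial n a ih =>
      rw [pow_succ, ← mul_assoc, map_mul, Module.End.mul_apply, ih, aeval_X]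
      have h1 : φ (N.dLin m) = x v * φ m := h m
      rw [h1, map_mul _ (C a * X ^ n) X, aeval_X, mul_assoc]

theorem laplaceLift_apply {N : WeylModule.{u}} {v : Place} (φ : N →ₗ[ℂ] LocalField v)
    (h : ∀ m, φ (N.D m) = x v * φ m) (m : N) : laplaceLift φ h (N.toLaplace m) = φ m := rfl

theorem one_tmul_smul {M : WeylModule.{u}} {v : Place} (c : ℂ) (m : M) :
    (1 : LocalField v) ⊗ₜ[ℂ[X]] (c • m) = c • ((1 : LocalField v) ⊗ₜ[ℂ[X]] m) := by
  rw [complex_smul_def, smul_one_tmul, algebraMap_C, algebraMap_smul_compl]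

/-- A coordinate of the expansions of the sections in a submodule, rescaled. -/
def Frame.expansion {M : WeylModule.{u}} {v : Place} (fr : M.Frame v) (L : M.Sub) (v' : Place)
    (c : ℤ → ℂ) (j : fr.ι) : L.toWeyl →ₗ[ℂ] LocalField v' where
  toFun m := rescale v v' c (fr.basis.coord j (1 ⊗ₜ L.incl m))
  map_add' a b := by rw [map_add, TensorProduct.tmul_add, map_add, map_add]
  map_smul' a m := by
    have : L.incl (a • m) = a • L.incl m := rfl
    rw [this, one_tmul_smul, ← algebraMap_smul_compl, map_smul, smul_eq_mul, ← Algebra.smul_def,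
      map_smul, RingHom.id_apply]

theorem Frame.coeff_expansion {M : WeylModule.{u}} {v : Place} (fr : M.Frame v) (L : M.Sub)
    (v' : Place) (c : ℤ → ℂ) (j : fr.ι) (m : L.toWeyl) (n : ℤ) :
    coeff (fr.expansion L v' c j m) n = c n * fr.cf (1 ⊗ₜ L.incl m) j n := rfl

theorem incl_D {M : WeylModule.{u}} (L : M.Sub) (m : L.toWeyl) :
    L.incl (L.toWeyl.D m) = M.D (L.incl m) := rfl

theorem Frame.cf_D_fin {M : WeylModule.{u}} {p : ℂ} (fr : M.Frame (.fin p)) (m : M) (j : fr.ι)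
    (n : ℤ) : fr.cf (1 ⊗ₜ M.D m) j n = (n + 1 + fr.exp j) * fr.cf (1 ⊗ₜ m) j (n + 1) := by
  have := fr.cf_conn_sub (Place.adm_fin p) (1 ⊗ₜ m) (fr.fac_fin p rfl j) n
  rw [zero_smul, sub_zero, coordSign, ← one_tmul_D] at this
  rw [this]; push_cast; ring

theorem Frame.cf_X_smul_fin {M : WeylModule.{u}} {p : ℂ} (fr : M.Frame (.fin p)) (m : M) (j : fr.ι)
    (n : ℤ) : fr.cf (1 ⊗ₜ ((X : ℂ[X]) • m)) j n
      = p * fr.cf (1 ⊗ₜ m) j n + fr.cf (1 ⊗ₜ m) j (n - 1) := by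
  rw [smul_one_tmul, algebraMap_X, x, cf, map_smul, smul_eq_mul, add_mul, LocalField.coeff_add,
    coeff_algebraMap_mul, coeff_t_mul]
  rfl

theorem Frame.cf_D_infty {M : WeylModule.{u}} (fr : M.Frame .infty) (m : M) (j : fr.ι)
    (n : ℤ) : fr.cf (1 ⊗ₜ M.D m) j n
      = fr.fac j * fr.cf (1 ⊗ₜ m) j n - (n - 1 + fr.exp j) * fr.cf (1 ⊗ₜ m) j (n - 1) := by
  have := fr.cf_conn_sub (Place.adm_infty _) (1 ⊗ₜ m) (rfl : fr.fac j = _) n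
  rw [cf_sub, cf_smul, coordSign, ← one_tmul_D] at this
  rw [sub_eq_iff_eq_add.1 this]; push_cast; rw [← sub_eq_add_neg]; ring_nf

theorem Frame.cf_X_smul_infty {M : WeylModule.{u}} (fr : M.Frame .infty) (m : M) (j : fr.ι)
    (n : ℤ) : fr.cf (1 ⊗ₜ ((X : ℂ[X]) • m)) j n = fr.cf (1 ⊗ₜ m) j (n + 1) := by
  rw [smul_one_tmul, algebraMap_X_infty, cf, map_smul, smul_eq_mul, coeff_t_inv_mul]
  rfl

theorem gamma_ne_zero {s : ℂ} (hs : ∀ n : ℤ, s ≠ n) : Complex.Gamma s ≠ 0 :=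
  Complex.Gamma_ne_zero fun m h => hs (-m) (by rw [h]; push_cast; rfl)

/-- The scalars in the Laplace transform of the part of an expansion at a finite point. -/
def gammaFin (μ : ℂ) (n : ℤ) : ℂ := Complex.Gamma (μ + n + 1)

/-- The scalars in the Laplace transform of an expansion at infinity. -/
def gammaInfty (α : ℂ) (n : ℤ) : ℂ := (-1) ^ n * (Complex.Gamma (α + n))⁻¹

theorem gammaFin_ne_zero {μ : ℂ} (hμ : ∀ n : ℤ, μ ≠ n) (n : ℤ) : gammaFin μ n ≠ 0 :=
  gamma_ne_zero fun k h => hμ (k - n - 1) (by push_cast; linear_combination h)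

theorem gammaInfty_ne_zero {α : ℂ} (hα : ∀ n : ℤ, α ≠ n) (n : ℤ) : gammaInfty α n ≠ 0 :=
  mul_ne_zero (zpow_ne_zero _ (by norm_num)) (inv_ne_zero
    (gamma_ne_zero fun k h => hα (k - n) (by push_cast; linear_combination h)))

/-- This recursion is what turns ∂ₓ on coefficients at p into multiplication by 1/t at infinity, and
multiplication by -x into the derivation of the rank one connection with factor -p and exponent μ +
1. -/
theorem gammaFin_succ {μ : ℂ} (hμ : ∀ n : ℤ, μ ≠ n) (n : ℤ) :
    gammaFin μ (n + 1) = (n + 1 + μ) * gammaFin μ n := by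
  rw [gammaFin, gammaFin, Int.cast_add, Int.cast_one, ← add_assoc,
    Complex.Gamma_add_one _ fun h => hμ (-n - 1) (by push_cast; linear_combination h)]
  ring

/-- The inverse Gamma function appears because x^{-s} is the transform of ξ^{s-1} / Γ(s); the sign
(-1)^n accounts for ∂_ξ acting as -x. -/
theorem gammaInfty_succ {α : ℂ} (hα : ∀ n : ℤ, α ≠ n) (n : ℤ) :
    gammaInfty α n = -((n + α) * gammaInfty α (n + 1)) := by
  have h0 : α + n ≠ 0 := fun h => hα (-n) (by push_cast; linear_combination h)
  rw [gammaInfty, gammaInfty, Int.cast_add, Int.cast_one, ← add_assoc,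
    Complex.Gamma_add_one _ h0, zpow_add_one₀ (by norm_num), mul_inv, add_comm (n : ℂ)]
  field_simp

variable {M : WeylModule.{u}} {P Q : Finset ℂ}

theorem complSpan_eq_top (v : Place) {L : Submodule ℂ[X] M}
    (hL : ∀ m : M, ∃ k : ℕ, polePoly P ^ k • m ∈ L) : complSpan v L = ⊤ :=
  eq_top_of_one_tmul_mem fun m => by
    obtain ⟨k, hk⟩ := hL m
    exact one_tmul_mem_of_smul_mem (pow_ne_zero k (polePoly_ne_zero P)) (one_tmul_mem_complSpan hk)

theorem Frame.expansion_fin_D {p : ℂ} (fr : M.Frame (.fin p)) (L : M.Sub) (j : fr.ι)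
    (hj : ∀ n : ℤ, fr.exp j ≠ n) (m : L.toWeyl) :
    fr.expansion L .infty (gammaFin (fr.exp j)) j (L.toWeyl.D m)
      = x .infty * fr.expansion L .infty (gammaFin (fr.exp j)) j m := by
  ext n
  rw [coeff_expansion, x, coeff_t_inv_mul, coeff_expansion, incl_D, cf_D_fin, gammaFin_succ hj]
  ring

theorem Frame.expansion_infty_D (fr : M.Frame .infty) (L : M.Sub) (j : fr.ι) {η : ℂ} (hη : fr.fac j = η)
    (hj : ∀ n : ℤ, fr.exp j ≠ n) (m : L.toWeyl) :
    fr.expansion L (.fin η) (gammaInfty (fr.exp j)) j (L.toWeyl.D m)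
      = x (.fin η) * fr.expansion L (.fin η) (gammaInfty (fr.exp j)) j m := by
  subst hη
  ext n
  have h := gammaInfty_succ hj (n - 1)
  rw [sub_add_cancel] at h
  rw [coeff_expansion, x, add_mul, LocalField.coeff_add, coeff_algebraMap_mul, coeff_t_mul,
    coeff_expansion, coeff_expansion, incl_D, cf_D_infty, h]
  push_cast
  ring

end WeylModule

namespace WeylModule

open LocalField

variable {M : WeylModule.{u}} {P Q : Finset ℂ}

theorem ne_intCast_of_re {z : ℂ} (h : ∀ n : ℤ, z.re ≠ n) (n : ℤ) : z ≠ n := fun e =>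
  h n (by rw [e, Complex.intCast_re])

theorem toLaplace_surjective (N : WeylModule.{u}) : Function.Surjective N.toLaplace := fun a => ⟨a, rfl⟩

theorem Sub.exists_incl_eq {L : M.Sub} {m : M} (hm : m ∈ L.toSubmodule) : ∃ a, L.incl a = m :=
  ⟨⟨m, hm⟩, rfl⟩

theorem laplace_D (N : WeylModule.{u}) (m : N) :
    N.laplace.D (N.toLaplace m) = N.toLaplace (-((X : ℂ[X]) • m)) := rfl

theorem laplace_smul (N : WeylModule.{u}) (c : ℂ) (m : N) :
    c • N.toLaplace m = N.toLaplace (c • m) := by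
  change aeval N.dLin (C c) m = c • m
  simp

/-- Sections of the minimal extension with prescribed leading terms at a point of `P`, vanishing
to a higher order at the other ones. -/
theorem exists_leading_term (fr : ∀ p : P, M.Frame (.fin p)) (p : P) (j : (fr p).ι) :
    ∃ m ∈ (minExt fr).toSubmodule, ∃ (n : ℤ) (c : ℂ), c ≠ 0 ∧
      (∀ j', OrdGE ((fr p).basis.coord j' (1 ⊗ₜ m)) n) ∧
      (∀ j', j' ≠ j → (fr p).cf (1 ⊗ₜ m) j' n = 0) ∧ (fr p).cf (1 ⊗ₜ m) j n = c ∧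
      ∀ p', p' ≠ p → ∀ j', OrdGE ((fr p').basis.coord j' (1 ⊗ₜ m)) (n + 1) := by
  classical
  have htop := complSpan_eq_top (.fin p) (exists_pow_smul_mem_minExt fr)
  obtain ⟨n₀, h⟩ := (fr p).exists_approx (z := (fr p).basis j) (htop ▸ Submodule.mem_top) 1
  obtain ⟨m, hm, y, hy, e⟩ := h n₀ le_rfl
  obtain ⟨K, hK⟩ := exists_mem_boundedSections fr m
  -- A unit at p, f raises the orders at the other points beyond n₀: the exponent K compensates the
  -- poles of m there, and the last 1 makes the inequality strict.
  set f : ℂ[X] := polePoly (P.erase p) ^ (n₀ + K + 1) with hf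
  have hfp : f.eval (p : ℂ) ≠ 0 := by
    rw [hf, Polynomial.eval_pow]
    exact pow_ne_zero _ (eval_polePoly_erase_ne_zero P p)
  have hc : ∀ j', (fr p).basis.coord j' (1 ⊗ₜ m)
      = t (.fin p) ^ (n₀ : ℤ) * ((if j = j' then 1 else 0) + (fr p).basis.coord j' y) := fun j' => by
    rw [e, algebraMap_coordPoly_pow, map_smul, map_add, smul_eq_mul, coordSign, one_mul]
    congr 2
    rw [Module.Basis.coord_apply, Module.Basis.repr_self, Finsupp.single_apply]
  have hord : ∀ j', OrdGE ((fr p).basis.coord j' (1 ⊗ₜ m)) n₀ := fun j' => by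
    rw [hc]
    refine ((ordGE_t_zpow (v := .fin p) (n₀ : ℤ)).mul (OrdGE.add (N := 0) ?_
      ((hy j').mono (by omega)))).mono (by omega)
    split_ifs
    · simpa using ordGE_algebraMap (v := .fin p) 1
    · exact ordGE_zero _
  have hcoeff : ∀ j', (fr p).cf (1 ⊗ₜ (f • m)) j' n₀ = if j = j' then f.eval (p : ℂ) else 0 := by
    intro j'
    rw [smul_one_tmul, Frame.cf, map_smul, smul_eq_mul]
    have h1 := coeff_mul_of_ordGE (ordGE_algebraMap_fin p f) (hord j')
    rw [zero_add, coeff_algebraMap_fin_zero] at h1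
    rw [h1, hc, coeff_t_zpow_mul, sub_self, LocalField.coeff_add, hy j' 0 (by omega), add_zero]
    split_ifs
    · rw [coeff_one, if_pos rfl, mul_one]
    · rw [LocalField.coeff_zero, mul_zero]
  refine ⟨f • m, Submodule.smul_mem _ _ hm, n₀, f.eval (p : ℂ), hfp, fun j' => ?_, fun j' hj' => ?_,
    ?_, fun p' hp' j' => ?_⟩
  · rw [smul_one_tmul, map_smul, smul_eq_mul]
    exact ((ordGE_algebraMap_fin p f).mul (hord j')).mono (by omega)
  · rw [hcoeff, if_neg (Ne.symm hj')]
  · rw [hcoeff, if_pos rfl]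
  · rw [smul_one_tmul, map_smul, smul_eq_mul]
    have hmem : (p' : ℂ) ∈ P.erase p :=
      Finset.mem_erase.2 ⟨fun h => hp' (Subtype.ext h), p'.2⟩
    exact ((ordGE_polePoly_pow_fin hmem (n₀ + K + 1)).mul (hK p' j')).mono (by push_cast; omega)

theorem exists_leading_term_infty {L : M.Sub} (hL : ∀ m : M, ∃ k : ℕ, polePoly P ^ k • m ∈ L.toSubmodule)
    (fi : M.Frame .infty) (j : fi.ι) :
    ∃ m ∈ L.toSubmodule, ∃ n : ℤ, (∀ j', OrdGE (fi.basis.coord j' (1 ⊗ₜ m)) n) ∧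
      (∀ j', j' ≠ j → fi.cf (1 ⊗ₜ m) j' n = 0) ∧ fi.cf (1 ⊗ₜ m) j n = 1 := by
  classical
  have htop := complSpan_eq_top .infty hL
  obtain ⟨n₀, h⟩ := fi.exists_approx (z := fi.basis j) (htop ▸ Submodule.mem_top) 1
  obtain ⟨m, hm, y, hy, e⟩ := h n₀ le_rfl
  have hc : ∀ j', fi.basis.coord j' (1 ⊗ₜ m)
      = t .infty ^ (-n₀ : ℤ) * ((if j = j' then 1 else 0) + fi.basis.coord j' y) := fun j' => by
    rw [e, algebraMap_coordPoly_pow, map_smul, map_add, smul_eq_mul, coordSign, neg_one_mul]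
    congr 2
    rw [Module.Basis.coord_apply, Module.Basis.repr_self, Finsupp.single_apply]
  have hcoeff : ∀ j', fi.cf (1 ⊗ₜ m) j' (-n₀) = if j = j' then 1 else 0 := by
    intro j'
    rw [Frame.cf, hc, coeff_t_zpow_mul, sub_self, LocalField.coeff_add, hy j' 0 (by omega), add_zero]
    split_ifs
    · rw [coeff_one, if_pos rfl]
    · rw [LocalField.coeff_zero]
  refine ⟨m, hm, -n₀, fun j' => ?_, fun j' hj' => by rw [hcoeff, if_neg (Ne.symm hj')],
    by rw [hcoeff, if_pos rfl]⟩
  rw [hc]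
  refine ((ordGE_t_zpow (v := .infty) (-n₀ : ℤ)).mul (OrdGE.add (N := 0) ?_
    ((hy j').mono (by omega)))).mono (by omega)
  split_ifs
  · simpa using ordGE_algebraMap (v := .infty) 1
  · exact ordGE_zero _

open Classical in
/-- The expansions of the Laplace transform of the minimal extension, from those of the sections of
the bundle. -/
def laplaceExpansions (hM : IsMeromorphicBundle P M) (fr : ∀ p : P, M.Frame (.fin p))
    (hfr : ∀ p j, (fr p).exp j = 0 ∨ ∀ n : ℤ, ((fr p).exp j).re ≠ n) (fi : M.Frame .infty)
    (hfi : ∀ j, ∀ n : ℤ, (fi.exp j).re ≠ n) (hQ : ∀ ξ, ξ ∈ Q ↔ ∃ j, fi.fac j = ξ) :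
    (minExt fr).toWeyl.laplace.Expansions Q where
  -- Coordinates with residue 0 are left out: they are power series on the minimal extension and
  -- contribute nothing at infinity.
  I := Σ p : P, {j : (fr p).ι // (fr p).exp j ≠ 0}
  facI i := -i.1
  -- The shift is that of x^α ↦ ξ^{-α-1} in the coordinate 1/ξ; the opposite shift occurs at the
  -- points of Q.
  expI i := (fr i.1).exp i.2 + 1
  θI i := laplaceLift ((fr i.1).expansion (minExt fr) .infty (gammaFin ((fr i.1).exp i.2)) i.2)
    ((fr i.1).expansion_fin_D _ _ (ne_intCast_of_re ((hfr i.1 i.2).resolve_left i.2.2)))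
  θI_D i a := by
    have hi := ne_intCast_of_re ((hfr i.1 i.2).resolve_left i.2.2)
    obtain ⟨a, rfl⟩ := toLaplace_surjective _ a
    rw [laplace_D, laplaceLift_apply, laplaceLift_apply, map_neg]
    ext n
    have h := gammaFin_succ hi (n - 1)
    rw [sub_add_cancel] at h
    rw [LocalField.coeff_neg, Frame.coeff_expansion, map_smul, Frame.cf_X_smul_fin,
      LocalField.coeff_add, coeff_der_infty, add_mul, LocalField.coeff_add, coeff_algebraMap_mul,
      eulerCoeff, inv_neg, inv_inv, neg_mul, neg_mul, neg_mul, LocalField.coeff_neg, mul_assoc, coeff_t_mul,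
      coeff_algebraMap_mul, Frame.coeff_expansion, Frame.coeff_expansion, h]
    push_cast
    ring
  J η := {j : fi.ι // fi.fac j = η}
  expJ η j := fi.exp j - 1
  θJ η j := laplaceLift (fi.expansion (minExt fr) (.fin η) (gammaInfty (fi.exp j)) j)
    (fi.expansion_infty_D _ _ j.2 (ne_intCast_of_re (hfi j)))
  θJ_D η j a := by
    have hj := ne_intCast_of_re (hfi j)
    obtain ⟨a, rfl⟩ := toLaplace_surjective _ a
    rw [laplace_D, laplaceLift_apply, laplaceLift_apply, map_neg]
    ext n
    rw [LocalField.coeff_neg, Frame.coeff_expansion, map_smul, Frame.cf_X_smul_infty,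
      LocalField.coeff_add, coeff_der_fin, eulerCoeff, mul_assoc, coeff_t_inv_mul,
      coeff_algebraMap_mul, Frame.coeff_expansion, gammaInfty_succ hj n]
    ring
  expJ_ne η j n h := hfi j (n + 1) (by
    have := congrArg Complex.re h
    simp only [Complex.sub_re, Complex.one_re, Complex.intCast_re] at this
    push_cast; linarith)
  -- The Gamma factors do not vanish, so k bounds the poles of the section at P and n those at
  -- infinity; the coordinates with residue 0 are regular anyway. Sections of M with such bounds
  -- form a finite-dimensional space.
  finite n k := by
    obtain ⟨s, hs⟩ := hM.exists_finite_span fr fi k.toNat n.toNat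
    let ι : (minExt fr).toWeyl.laplace →ₗ[ℂ] M :=
      { toFun := fun a => (minExt fr).incl (show (minExt fr).toWeyl from a)
        map_add' := fun a b => map_add (minExt fr).incl _ _
        map_smul' := fun c a => by
          obtain ⟨a, rfl⟩ := toLaplace_surjective _ a
          exact congrArg (minExt fr).incl (laplace_smul _ c a) }
    have hι : Function.Injective ι := Subtype.val_injective
    have hfin : FiniteDimensional ℂ ((Submodule.span ℂ (s : Set M)).comap ι) := by
      have : FiniteDimensional ℂ (Submodule.span ℂ (s : Set M)) := inferInstance
      exact Module.Finite.of_injective (ι.restrict fun a ha => ha :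
        (Submodule.span ℂ (s : Set M)).comap ι →ₗ[ℂ] Submodule.span ℂ (s : Set M))
        fun a b h => Subtype.ext (hι (congrArg (fun z : Submodule.span ℂ (s : Set M) => (z : M)) h))
    obtain ⟨s', hs'⟩ := (Submodule.fg_iff_finiteDimensional _).2 hfin
    refine ⟨s', fun a hI hJ => ?_⟩
    rw [hs']
    refine hs _ (fun p j => ?_) fun j => ?_
    · by_cases hj : (fr p).exp j = 0
      · exact (mem_minExt.1 (Sub.incl_mem _ _) p j hj).mono (by omega)
      · exact (OrdGE.of_rescale (gammaFin_ne_zero (ne_intCast_of_re ((hfr p j).resolve_left hj)))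
          (hI ⟨p, j, hj⟩)).mono (by omega)
    · exact (OrdGE.of_rescale (gammaInfty_ne_zero (ne_intCast_of_re (hfi j)))
        (hJ (fi.fac j) ((hQ _).2 ⟨j, rfl⟩) ⟨j, rfl⟩)).mono (by omega)
  spanI := by
    refine eq_top_of_leading_terms fun i => ?_
    obtain ⟨m, hm, n, c, hc, h1, h2, h3, h4⟩ := exists_leading_term fr i.1 i.2
    have hi := ne_intCast_of_re ((hfr i.1 i.2).resolve_left i.2.2)
    obtain ⟨m, rfl⟩ := Sub.exists_incl_eq hm
    refine ⟨_, Submodule.subset_span ⟨(minExt fr).toWeyl.toLaplace m, rfl⟩, n,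
      gammaFin ((fr i.1).exp i.2) n * c, mul_ne_zero (gammaFin_ne_zero hi n) hc, fun i' => ?_⟩
    obtain ⟨p', j', hj'⟩ := i'
    by_cases hp : p' = i.1
    · obtain ⟨p, j, hj⟩ := i
      obtain rfl : p' = p := hp
      refine ⟨(h1 j').rescale _ _, ?_⟩
      change coeff (laplaceLift _ _ _) n = _
      rw [laplaceLift_apply, Frame.coeff_expansion]
      by_cases h : j' = j
      · subst h
        rw [if_pos rfl]
        exact congrArg _ h3
      · rw [if_neg (by simpa using h)]
        exact mul_eq_zero_of_right _ (h2 j' h)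
    · refine ⟨((h4 p' hp j').mono (by omega)).rescale _ _, ?_⟩
      rw [if_neg (fun h => hp (by rw [← h]))]
      exact ((h4 p' hp j').rescale _ _) n (by omega)
  spanJ η hη := by
    refine eq_top_of_leading_terms fun j => ?_
    obtain ⟨m, hm, n, h1, h2, h3⟩ := exists_leading_term_infty (exists_pow_smul_mem_minExt fr) fi j
    obtain ⟨m, rfl⟩ := Sub.exists_incl_eq hm
    refine ⟨_, Submodule.subset_span ⟨(minExt fr).toWeyl.toLaplace m, rfl⟩, n,
      gammaInfty (fi.exp j) n, gammaInfty_ne_zero (ne_intCast_of_re (hfi j)) n, fun j' => ?_⟩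
    refine ⟨(h1 j').rescale _ _, ?_⟩
    change coeff (laplaceLift _ _ _) n = _
    rw [laplaceLift_apply, Frame.coeff_expansion]
    by_cases h : j' = j
    · subst h
      rw [if_pos rfl]
      exact (congrArg _ h3).trans (mul_one _)
    · rw [if_neg h]
      exact mul_eq_zero_of_right _ (h2 j' fun h' => h (Subtype.ext h'))

end WeylModule

/-! ### Stationary phase as a map of completions. -/

namespace WeylModule

open LocalField

variable {M : WeylModule.{u}} {v : Place}

namespace Frame

/-- The map which rescales some of the coordinates and moves them to another frame. -/
def transport (fr : M.Frame v) {A : WeylModule.{u}} {v' : Place} (fr' : A.Frame v') {J : Type}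
    [Fintype J] (k : J → fr.ι) (e : J → fr'.ι) (c : J → ℤ → ℂ) : M.Compl v →ₗ[ℂ] A.Compl v' where
  toFun z := ∑ i, rescale v v' (c i) (fr.basis.coord (k i) z) • fr'.basis (e i)
  map_add' z w := by simp only [map_add, add_smul, Finset.sum_add_distrib]
  map_smul' a z := by
    rw [RingHom.id_apply, Finset.smul_sum]
    refine Finset.sum_congr rfl fun i _ => ?_
    rw [← algebraMap_smul_compl a z, map_smul, smul_eq_mul, ← Algebra.smul_def, map_smul, smul_assoc]

variable (fr : M.Frame v) {A : WeylModule.{u}} {v' : Place} (fr' : A.Frame v') {J : Type}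
    [Fintype J] (k : J → fr.ι) (e : J → fr'.ι) (c : J → ℤ → ℂ)

theorem cf_transport {e : J → fr'.ι} (he : Function.Injective e) (z : M.Compl v) (i : J) (n : ℤ) :
    fr'.cf (fr.transport fr' k e c z) (e i) n = c i n * fr.cf z (k i) n := by
  classical
  have : fr'.basis.coord (e i) (fr.transport fr' k e c z)
      = rescale v v' (c i) (fr.basis.coord (k i) z) := by
    change fr'.basis.coord (e i) (∑ i, _) = _
    rw [map_sum, Finset.sum_eq_single i]
    · simp
    · intro i' _ h
      simp [he.ne h]
    · simp
  rw [cf, this]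
  rfl

theorem cf_transport_of_notMem (z : M.Compl v) {j : fr'.ι} (hj : ∀ i, e i ≠ j) (n : ℤ) :
    fr'.cf (fr.transport fr' k e c z) j n = 0 := by
  classical
  have : fr'.basis.coord j (fr.transport fr' k e c z) = 0 := by
    change fr'.basis.coord j (∑ i, _) = _
    rw [map_sum]
    refine Finset.sum_eq_zero fun i _ => ?_
    simp [hj i]
  rw [cf, this, LocalField.coeff_zero]

theorem t_zpow_smul_mem_psi_iff {ζ : ℂ} (hζ : v.Adm ζ) (fr : M.Frame v) (α : ℂ) (N : ℤ)
    (w : M.Compl v) : t v ^ N • w ∈ M.psi v ζ (α + N) ↔ w ∈ M.psi v ζ α := by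
  rw [fr.mem_psi_iff hζ, fr.mem_psi_iff hζ]
  constructor
  · intro h j n hn
    have := h j (n + N) fun h' => hn ⟨h'.1, by have := h'.2; push_cast at this; linear_combination this⟩
    rwa [cf_t_zpow_smul, add_sub_cancel_right] at this
  · intro h j n hn
    rw [cf_t_zpow_smul]
    exact h j _ fun h' => hn ⟨h'.1, by rw [← h'.2]; push_cast; ring⟩

end Frame

/-- The data of a formal stationary phase: the sections `m` of a submodule have images `hat m` in
another module, and the coordinates of `hat m` at a place `v'` are, up to non-zero factors and for
the non-integral exponents, those of `m` at a place `v`. -/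
structure Phase (L : M.Sub) (A : WeylModule.{u}) (hat : L.toWeyl → A) (v : Place) (ζ : ℂ)
    (v' : Place) (ζ' : ℂ) (s : ℤ) where
  fr : M.Frame v
  fr' : A.Frame v'
  adm : v.Adm ζ
  adm' : v'.Adm ζ'
  J : Type
  [fintype : Fintype J]
  k : J → fr.ι
  e : J → fr'.ι
  k_inj : Function.Injective k
  e_inj : Function.Injective e
  k_fac : ∀ i, fr.fac (k i) = ζ
  e_fac : ∀ i, fr'.fac (e i) = ζ'
  exp_e : ∀ i, fr'.exp (e i) = fr.exp (k i) + s
  k_surj : ∀ j, fr.fac j = ζ → (∀ n : ℤ, fr.exp j ≠ n) → ∃ i, k i = j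
  e_surj : ∀ j, fr'.fac j = ζ' → (∀ n : ℤ, fr'.exp j ≠ n) → ∃ i, e i = j
  gam : J → ℤ → ℂ
  gam_ne : ∀ i n, gam i n ≠ 0
  gam_shift : ∀ α : ℂ, (∀ n : ℤ, α ≠ n) → ∀ N : ℤ, ∃ c : ℂ, c ≠ 0 ∧
    ∀ i (n : ℤ), n + fr.exp (k i) = α → gam i (n + N) = c * gam i n
  cf_hat : ∀ m i n, fr'.cf (1 ⊗ₜ hat m) (e i) n = gam i n * fr.cf (1 ⊗ₜ L.incl m) (k i) n

attribute [instance] Phase.fintype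

namespace Phase

variable {L : M.Sub} {A : WeylModule.{u}} {hat : L.toWeyl → A} {ζ : ℂ}
    {v' : Place} {ζ' : ℂ} {s : ℤ} (ph : Phase L A hat v ζ v' ζ' s)

/-- The map of completions which realizes the stationary phase isomorphisms. -/
def Φ : M.Compl v →ₗ[ℂ] A.Compl v' := ph.fr.transport ph.fr' ph.k ph.e ph.gam

theorem cf_Φ (z : M.Compl v) (i : ph.J) (n : ℤ) :
    ph.fr'.cf (ph.Φ z) (ph.e i) n = ph.gam i n * ph.fr.cf z (ph.k i) n :=
  ph.fr.cf_transport _ _ _ ph.e_inj z i n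

theorem Φ_mem_psi {α : ℂ} {w : M.Compl v} (hw : w ∈ M.psi v ζ α) :
    ph.Φ w ∈ A.psi v' ζ' (α + s) := by
  rw [ph.fr.mem_psi_iff ph.adm] at hw
  rw [ph.fr'.mem_psi_iff ph.adm']
  intro j n hn
  by_cases h : ∃ i, ph.e i = j
  · obtain ⟨i, rfl⟩ := h
    rw [cf_Φ, hw _ _ fun h => hn ⟨ph.e_fac i, ?_⟩, mul_zero]
    rw [ph.exp_e, ← h.2]; ring
  · push Not at h
    exact ph.fr.cf_transport_of_notMem _ _ _ _ _ h n

section NonIntegral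

variable {α : ℂ}

theorem exists_k {j : ph.fr.ι} (hα : ∀ n : ℤ, α ≠ n) (hj : ph.fr.fac j = ζ) {n : ℤ}
    (hn : n + ph.fr.exp j = α) : ∃ i, ph.k i = j :=
  ph.k_surj j hj fun k hk => hα (n + k) (by rw [← hn, hk]; push_cast; rfl)

theorem exists_e {j : ph.fr'.ι} (hα : ∀ n : ℤ, α ≠ n) (hj : ph.fr'.fac j = ζ') {n : ℤ}
    (hn : n + ph.fr'.exp j = α + s) : ∃ i, ph.e i = j :=
  ph.e_surj j hj fun k hk => hα (n + k - s) (by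
    push_cast; rw [← hk]; linear_combination -hn)

theorem Φ_injOn (hα : ∀ n : ℤ, α ≠ n) {w w' : M.Compl v} (hw : w ∈ M.psi v ζ α)
    (hw' : w' ∈ M.psi v ζ α) (h : ph.Φ w = ph.Φ w') : w = w' := by
  refine ph.fr.psi_ext ph.adm hw hw' fun j n hj hn => ?_
  obtain ⟨i, rfl⟩ := ph.exists_k hα hj hn
  have h1 := ph.cf_Φ w i n
  rw [h, cf_Φ] at h1
  exact (mul_left_cancel₀ (ph.gam_ne i n) h1).symm

theorem exists_Φ_eq (hα : ∀ n : ℤ, α ≠ n) {w' : A.Compl v'} (hw' : w' ∈ A.psi v' ζ' (α + s)) :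
    ∃ w ∈ M.psi v ζ α, ph.Φ w = w' := by
  set w := ph.fr'.transport ph.fr ph.e ph.k (fun i n => (ph.gam i n)⁻¹) w' with hw
  have hcf : ∀ i n, ph.fr.cf w (ph.k i) n = (ph.gam i n)⁻¹ * ph.fr'.cf w' (ph.e i) n :=
    fun i n => ph.fr'.cf_transport _ _ _ ph.k_inj w' i n
  have hmem : w ∈ M.psi v ζ α := by
    rw [ph.fr'.mem_psi_iff ph.adm'] at hw'
    rw [ph.fr.mem_psi_iff ph.adm]
    intro j n hn
    by_cases h : ∃ i, ph.k i = j
    · obtain ⟨i, rfl⟩ := h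
      rw [hcf, hw' _ _ fun h => hn ⟨ph.k_fac i, ?_⟩, mul_zero]
      have := h.2
      rw [ph.exp_e] at this
      linear_combination this
    · push Not at h
      exact ph.fr'.cf_transport_of_notMem _ _ _ _ _ h n
  refine ⟨w, hmem, ph.fr'.psi_ext ph.adm' (ph.Φ_mem_psi hmem) hw' fun j n hj hn => ?_⟩
  obtain ⟨i, rfl⟩ := ph.exists_e hα hj hn
  rw [cf_Φ, hcf, mul_inv_cancel_left₀ (ph.gam_ne i n)]

theorem isComponent_Φ (hα : ∀ n : ℤ, α ≠ n) {m : L.toWeyl} {w : M.Compl v}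
    (h : M.IsComponent v ζ α (L.incl m) w) : A.IsComponent v' ζ' (α + s) (hat m) (ph.Φ w) := by
  rw [ph.fr.isComponent_iff ph.adm] at h
  rw [ph.fr'.isComponent_iff ph.adm']
  refine ⟨ph.Φ_mem_psi h.1, fun j n hj hn => ?_⟩
  obtain ⟨i, rfl⟩ := ph.exists_e hα hj hn
  rw [cf_Φ, cf_hat, h.2 _ _ (ph.k_fac i)]
  rw [ph.exp_e] at hn
  linear_combination hn

theorem _root_.WeylModule.Frame.isComponent_unique {M : WeylModule.{u}} {v : Place} (fr : M.Frame v)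
    {ζ α : ℂ} (hζ : v.Adm ζ) {m : M} {w w' : M.Compl v} (h : M.IsComponent v ζ α m w)
    (h' : M.IsComponent v ζ α m w') : w = w' := by
  rw [fr.isComponent_iff hζ] at h h'
  exact fr.psi_ext hζ h.1 h'.1 fun j n hj hn => (h.2 j n hj hn).trans (h'.2 j n hj hn).symm

/-- A section has only one component for given data, so the correspondence defined through sections
is single-valued, and it is the linear map `Φ`. -/
theorem phase_eq_Φ (hα : ∀ n : ℤ, α ≠ n) {m : L.toWeyl} {w : M.Compl v} {w' : A.Compl v'}
    (h : M.IsComponent v ζ α (L.incl m) w) (h' : A.IsComponent v' ζ' (α + s) (hat m) w') :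
    w' = ph.Φ w :=
  ph.fr'.isComponent_unique ph.adm' h' (ph.isComponent_Φ hα h)

/-- The factors `gam` change when orders are shifted, but by `gam_shift` the ratio depends only on
the eigenvalue and the shift. The resulting scalar does not affect subspaces, so the periodicity of
the filtrations is preserved. -/
theorem Φ_t_zpow_smul (hα : ∀ n : ℤ, α ≠ n) (N : ℤ) : ∃ c : ℂ, c ≠ 0 ∧ ∀ w ∈ M.psi v ζ α,
    ph.Φ (t v ^ N • w) = c • t v' ^ N • ph.Φ w := by
  obtain ⟨c, hc, h⟩ := ph.gam_shift α hα N
  refine ⟨c, hc, fun w hw => ?_⟩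
  have h1 := ph.Φ_mem_psi ((ph.fr.t_zpow_smul_mem_psi_iff ph.adm α N w).2 hw)
  have h2 : t v' ^ N • ph.Φ w ∈ A.psi v' ζ' (α + N + s) := by
    rw [add_right_comm]
    exact (ph.fr'.t_zpow_smul_mem_psi_iff ph.adm' _ N _).2 (ph.Φ_mem_psi hw)
  have hα' : ∀ n : ℤ, α + N ≠ n := fun n hn => hα (n - N) (by push_cast; linear_combination hn)
  refine ph.fr'.psi_ext ph.adm' h1 (Submodule.smul_mem _ c h2) fun j n hj hn => ?_
  obtain ⟨i, rfl⟩ := ph.exists_e hα' hj hn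
  rw [cf_Φ, Frame.cf_t_zpow_smul, Frame.cf_smul, Frame.cf_t_zpow_smul, cf_Φ]
  have := h i (n - N) (by
    rw [ph.exp_e] at hn
    push_cast; linear_combination hn)
  rw [sub_add_cancel] at this
  rw [this, mul_assoc]

theorem map_Φ_psi (hα : ∀ n : ℤ, α ≠ n) : (M.psi v ζ α).map ph.Φ = A.psi v' ζ' (α + s) := by
  refine le_antisymm ?_ fun w' hw' => ?_
  · rintro _ ⟨w, hw, rfl⟩
    exact ph.Φ_mem_psi hw
  · obtain ⟨w, hw, rfl⟩ := ph.exists_Φ_eq hα hw'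
    exact ⟨w, hw, rfl⟩

end NonIntegral

/-- The image of a subspace under the correspondence between the components of sections. -/
theorem span_phase_eq (hL : complSpan v L.toSubmodule = ⊤) {α : ℂ} (hα : ∀ n : ℤ, α ≠ n)
    {G : Submodule ℂ (M.Compl v)} (hG : G ≤ M.psi v ζ α) :
    Submodule.span ℂ {w' | ∃ (m : L.toWeyl), ∃ w ∈ G, M.IsComponent v ζ α (L.incl m) w ∧
      A.IsComponent v' ζ' (α + s) (hat m) w'} = G.map ph.Φ := by
  refine le_antisymm (Submodule.span_le.2 ?_) ?_
  · rintro w' ⟨m, w, hw, h, h'⟩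
    exact ⟨w, hw, (ph.phase_eq_Φ hα h h').symm⟩
  · rintro _ ⟨w, hw, rfl⟩
    -- The minimal extension spans the completion, so every vector of G is the component of some
    -- section; the correspondence is defined everywhere on G.
    obtain ⟨m, hm, h⟩ := ph.fr.exists_isComponent ph.adm hα (hG hw) (hL ▸ Submodule.mem_top)
    obtain ⟨m, rfl⟩ := Sub.exists_incl_eq hm
    exact Submodule.subset_span ⟨m, w, hw, h, ph.isComponent_Φ hα h⟩

end Phase

/-- In the eigenspaces with integral eigenvalues `n` the filtration has the weight `n` only. -/
def HasIntegralWeights (M : WeylModule.{u}) (F : M.Filtrations) (v : Place) (ζ : ℂ) : Prop :=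
  ∀ (n : ℤ) (β : ℝ), (β ≤ n → F v ζ n β = M.psi v ζ n) ∧ (n < β → F v ζ n β = ⊥)

/-- For integral eigenvalues the filtration is explicit. For the others, every axiom is carried over
by `Φ`, which is injective on each ψ^α and commutes with powers of t up to scalars. -/
theorem Phase.isParabolicAt {L : M.Sub} {A : WeylModule.{u}} {hat : L.toWeyl → A} {ζ : ℂ}
    {v' : Place} {ζ' : ℂ} {s : ℤ} (ph : Phase L A hat v ζ v' ζ' s) {F : M.Filtrations}
    (hF : M.IsParabolicAt F v ζ) {F' : A.Filtrations} (hwt : A.HasIntegralWeights F' v' ζ')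
    (hF' : ∀ α : ℂ, (∀ n : ℤ, α ≠ n) → ∀ β, F' v' ζ' (α + s) (β + s) = (F v ζ α β).map ph.Φ) :
    A.IsParabolicAt F' v' ζ' := by
  obtain ⟨h1, h2, h3, h4, h5⟩ := hF
  have hcase : ∀ α' : ℂ, (∃ n : ℤ, α' = n) ∨ ∃ α : ℂ, (∀ n : ℤ, α ≠ n) ∧ α' = α + s := by
    intro α'
    by_cases h : ∃ n : ℤ, α' = n
    · exact .inl h
    · push Not at h
      exact .inr ⟨α' - s, fun n hn => h (n + s) (by push_cast; rw [← hn]; ring), by ring⟩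
  have hshift : ∀ β' : ℝ, ∃ β : ℝ, β' = β + s := fun β' => ⟨β' - s, by ring⟩
  refine ⟨fun α β => ?_, fun α => ?_, fun α β => ?_, fun α => ?_, fun α β N w => ?_⟩
  · obtain ⟨n, rfl⟩ | ⟨α, hα, rfl⟩ := hcase α
    · rcases le_or_gt β n with h | h
      · rw [(hwt n β).1 h]
      · rw [(hwt n β).2 h]; exact bot_le
    · obtain ⟨β, rfl⟩ := hshift β
      rw [hF' α hα, ← ph.map_Φ_psi hα]
      exact Submodule.map_mono (h1 α β)
  · intro β γ hβγ
    obtain ⟨n, rfl⟩ | ⟨α, hα, rfl⟩ := hcase α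
    · rcases le_or_gt γ n with h | h
      · rw [(hwt n γ).1 h, (hwt n β).1 (hβγ.trans h)]
      · rw [(hwt n γ).2 h]; exact bot_le
    · obtain ⟨β, rfl⟩ := hshift β
      obtain ⟨γ, rfl⟩ := hshift γ
      rw [hF' α hα, hF' α hα]
      exact Submodule.map_mono (h2 α (by linarith))
  · obtain ⟨n, rfl⟩ | ⟨α, hα, rfl⟩ := hcase α
    · rcases le_or_gt β n with h | h
      · exact ⟨β - 1, by linarith, by rw [(hwt n β).1 h, (hwt n _).1 (by linarith)]⟩
      · exact ⟨(n + β) / 2, by linarith, by rw [(hwt n β).2 h, (hwt n _).2 (by linarith)]⟩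
    · obtain ⟨β, rfl⟩ := hshift β
      obtain ⟨γ, hγ, h⟩ := h3 α β
      exact ⟨γ + s, by linarith, by rw [hF' α hα, hF' α hα, h]⟩
  · obtain ⟨n, rfl⟩ | ⟨α, hα, rfl⟩ := hcase α
    · exact ⟨n, (hwt n n).1 le_rfl, (hwt n _).2 (by linarith)⟩
    · obtain ⟨k, hk, hk'⟩ := h4 α
      refine ⟨k + s, ?_, ?_⟩
      · push_cast
        rw [hF' α hα, hk, ph.map_Φ_psi hα]
      · push_cast
        rw [add_right_comm, hF' α hα, hk', Submodule.map_bot]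
  · obtain ⟨n, rfl⟩ | ⟨α, hα, rfl⟩ := hcase α
    · rcases le_or_gt β n with h | h
      · rw [(hwt n β).1 h, ← Int.cast_add, (hwt (n + N) _).1 (by push_cast; linarith),
          Int.cast_add, ph.fr'.t_zpow_smul_mem_psi_iff ph.adm']
      · rw [(hwt n β).2 h, ← Int.cast_add, (hwt (n + N) _).2 (by push_cast; linarith),
          Submodule.mem_bot, Submodule.mem_bot, smul_eq_zero_iff_right (zpow_ne_zero _ (t_ne_zero _))]
    · obtain ⟨β, rfl⟩ := hshift β
      have hα' : ∀ n : ℤ, α + N ≠ n := fun n hn =>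
        hα (n - N) (by push_cast; linear_combination hn)
      obtain ⟨c, hc, hΦ⟩ := ph.Φ_t_zpow_smul hα N
      rw [add_right_comm, add_right_comm β, hF' α hα, hF' _ hα']
      constructor
      · rintro ⟨w, hw, rfl⟩
        refine ⟨c⁻¹ • t v ^ N • w, Submodule.smul_mem _ _ ((h5 α β N w).1 hw), ?_⟩
        rw [map_smul, hΦ w (h1 _ _ hw), inv_smul_smul₀ hc]
      · rintro ⟨w', hw', h⟩
        obtain ⟨w₀, rfl⟩ : ∃ w₀, w' = t v ^ N • w₀ := ⟨t v ^ (-N) • w', by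
          rw [smul_smul, ← zpow_add₀ (t_ne_zero v), add_neg_cancel, zpow_zero, one_smul]⟩
        have hw₀ := (h5 α β N w₀).2 hw'
        rw [hΦ w₀ (h1 _ _ hw₀), smul_comm] at h
        have h' := congrArg (fun z => t v' ^ (-N) • z) h
        simp only [smul_smul, ← zpow_add₀ (t_ne_zero v'), neg_add_cancel, zpow_zero,
          one_smul] at h'
        rw [← h']
        exact ⟨c • w₀, Submodule.smul_mem _ _ hw₀, map_smul _ _ _⟩

theorem isParabolicAt_of_psi_eq_bot {F : M.Filtrations} {ζ : ℂ} (h : ∀ α, M.psi v ζ α = ⊥)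
    (hF : ∀ α β, F v ζ α β = ⊥) : M.IsParabolicAt F v ζ := by
  refine ⟨fun α β => by rw [hF]; exact bot_le, fun α β γ _ => by rw [hF, hF],
    fun α β => ⟨β - 1, by linarith, by rw [hF, hF]⟩, fun α => ⟨0, by rw [hF, h], hF _ _⟩,
    fun α β N w => ?_⟩
  rw [hF, hF, Submodule.mem_bot, Submodule.mem_bot,
    smul_eq_zero_iff_right (zpow_ne_zero _ (t_ne_zero _))]

end WeylModule

/-! ### Graded dimensions and the parabolic degree. -/

/-- The dimension of a graded piece of a decreasing filtration. -/
def grd {V : Type*} [AddCommGroup V] [Module ℂ V] (G : ℝ → Submodule ℂ V) (β : ℝ) : ℕ :=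
  Module.finrank ℂ (G β ⧸ (⨆ γ ∈ Set.Ioi β, G γ).submoduleOf (G β))

section Grd

variable {V W : Type*} [AddCommGroup V] [Module ℂ V] [AddCommGroup W] [Module ℂ W]

theorem grd_map (f : V →ₗ[ℂ] W) {U : Submodule ℂ V} (hf : ∀ x ∈ U, ∀ y ∈ U, f x = f y → x = y)
    {G : ℝ → Submodule ℂ V} (hG : ∀ γ, G γ ≤ U) (β : ℝ) :
    grd (fun γ => (G γ).map f) β = grd G β := by
  have hsup : (⨆ γ ∈ Set.Ioi β, (G γ).map f) = (⨆ γ ∈ Set.Ioi β, G γ).map f := by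
    simp only [Submodule.map_iSup]
  have hle : (⨆ γ ∈ Set.Ioi β, G γ) ≤ U := iSup₂_le fun γ _ => hG γ
  let e : G β ≃ₗ[ℂ] (G β).map f := LinearEquiv.ofBijective (f.submoduleMap (G β))
    ⟨fun x y h => Subtype.ext (hf _ (hG β x.2) _ (hG β y.2) (congrArg Subtype.val h)),
      f.submoduleMap_surjective _⟩
  refine (LinearEquiv.finrank_eq (Submodule.Quotient.equiv _ _ e ?_)).symm
  rw [hsup]
  ext ⟨y, hy⟩
  constructor
  · rintro ⟨x, hx, h⟩
    exact ⟨x, hx, congrArg Subtype.val h⟩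
  · rintro ⟨z, hz, h⟩
    obtain ⟨x, hx, rfl⟩ := hy
    obtain rfl := hf z (hle hz) x (hG β hx) h
    exact ⟨⟨z, hx⟩, hz, rfl⟩

theorem grd_add (G : ℝ → Submodule ℂ V) (s β : ℝ) :
    grd (fun γ => G (γ + s)) β = grd G (β + s) := by
  have : (⨆ γ ∈ Set.Ioi β, G (γ + s)) = ⨆ γ ∈ Set.Ioi (β + s), G γ := by
    refine le_antisymm (iSup₂_le fun γ hγ => ?_) (iSup₂_le fun γ hγ => ?_)
    · exact le_iSup₂_of_le (γ + s) (by simpa using hγ) le_rfl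
    · refine le_iSup₂_of_le (γ - s) (by rw [Set.mem_Ioi] at hγ ⊢; linarith) ?_
      rw [sub_add_cancel]
  unfold grd
  rw [this]

theorem grd_eq_zero_of_eq_bot {G : ℝ → Submodule ℂ V} {β : ℝ} (h : G β = ⊥) : grd G β = 0 := by
  have : Subsingleton (G β) := by rw [h]; infer_instance
  exact Module.finrank_zero_of_subsingleton

theorem grd_eq_zero_of_ne {G : ℝ → Submodule ℂ V} {U : Submodule ℂ V} {b : ℝ}
    (h₁ : ∀ β ≤ b, G β = U) (h₂ : ∀ β > b, G β = ⊥) {β : ℝ} (hβ : β ≠ b) : grd G β = 0 := by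
  rcases lt_or_gt_of_ne hβ with h | h
  · have htop : (⨆ γ ∈ Set.Ioi β, G γ).submoduleOf (G β) = ⊤ := by
      rw [Submodule.submoduleOf_eq_top]
      refine le_iSup₂_of_le b h ?_
      rw [h₁ β h.le, h₁ b le_rfl]
    have : Subsingleton (G β ⧸ (⨆ γ ∈ Set.Ioi β, G γ).submoduleOf (G β)) :=
      Submodule.Quotient.subsingleton_iff.2 htop
    exact Module.finrank_zero_of_subsingleton
  · exact grd_eq_zero_of_eq_bot (h₂ β h)

end Grd

namespace WeylModule

open LocalField

variable {M : WeylModule.{u}} {v : Place} {P Q : Finset ℂ}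

theorem grDim_eq_grd (F : M.Filtrations) (v : Place) (ζ α : ℂ) (β : ℝ) :
    M.grDim F v ζ α β = grd (F v ζ α) β := rfl

/-- The contribution of a place and an exponential factor to minus the degree. -/
def locDeg (M : WeylModule.{u}) (F : M.Filtrations) (v : Place) (ζ : ℂ) : ℂ :=
  ∑ᶠ (α : ℂ) (β : ℝ) (_ : β ∈ Set.Ico (0 : ℝ) 1), α * M.grDim F v ζ α β

/-- The contribution of a place and an exponential factor to the sum of the weights. -/
def locWeight (M : WeylModule.{u}) (F : M.Filtrations) (v : Place) (ζ : ℂ) : ℝ :=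
  ∑ᶠ (α : ℂ) (β : ℝ) (_ : β ∈ Set.Ico (0 : ℝ) 1), β * M.grDim F v ζ α β

theorem parDegree_eq (M : WeylModule.{u}) (F : M.Filtrations) (P : Finset ℂ) :
    M.parDegree P F
      = (-(∑ p ∈ P, M.locDeg F (.fin p) 0 + ∑ᶠ ξ : ℂ, M.locDeg F .infty ξ)).re
        + (∑ p ∈ P, M.locWeight F (.fin p) 0 + ∑ᶠ ξ : ℂ, M.locWeight F .infty ξ) := rfl

/-- The piece at α = β = 0 is multiplied by zero, so it may differ. This tolerance is needed: the
residue 0 parts of a bundle and of its transform are unrelated. -/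
theorem locDeg_congr {A : WeylModule.{u}} {F : M.Filtrations} {F' : A.Filtrations} {v' : Place}
    {ζ ζ' : ℂ} (h : ∀ α, ∀ β ∈ Set.Ico (0 : ℝ) 1,
      M.grDim F v ζ α β = A.grDim F' v' ζ' α β ∨
        α = 0 ∧ β = 0) : M.locDeg F v ζ = A.locDeg F' v' ζ' := by
  refine finsum_congr fun α => finsum_congr fun β => finsum_congr fun hβ => ?_
  rcases h α β hβ with h | ⟨h, -⟩ <;> rw [h]
  rw [zero_mul, zero_mul]

theorem locWeight_congr {A : WeylModule.{u}} {F : M.Filtrations} {F' : A.Filtrations} {v' : Place}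
    {ζ ζ' : ℂ} (h : ∀ α, ∀ β ∈ Set.Ico (0 : ℝ) 1,
      M.grDim F v ζ α β = A.grDim F' v' ζ' α β ∨
        α = 0 ∧ β = 0) : M.locWeight F v ζ = A.locWeight F' v' ζ' := by
  refine finsum_congr fun α => finsum_congr fun β => finsum_congr fun hβ => ?_
  rcases h α β hβ with h | ⟨-, h⟩ <;> rw [h]
  rw [zero_mul, zero_mul]

theorem locDeg_eq_zero {F : M.Filtrations} {ζ : ℂ} (h : ∀ α β, F v ζ α β = ⊥) :
    M.locDeg F v ζ = 0 := by
  have : ∀ α β, M.grDim F v ζ α β = 0 := fun α β => grd_eq_zero_of_eq_bot (h α β)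
  simp [locDeg, this]

theorem locWeight_eq_zero {F : M.Filtrations} {ζ : ℂ} (h : ∀ α β, F v ζ α β = ⊥) :
    M.locWeight F v ζ = 0 := by
  have : ∀ α β, M.grDim F v ζ α β = 0 := fun α β => grd_eq_zero_of_eq_bot (h α β)
  simp [locWeight, this]

/-- The intersection of filtrations with subspaces of the completions. -/
def Filtrations.inter (F : M.Filtrations) (S : ∀ v, Submodule (LocalField v) (M.Compl v)) :
    M.Filtrations := fun v ξ α β => (S v).restrictScalars ℂ ⊓ F v ξ α β

theorem Filtrations.inter_top (F : M.Filtrations) : F.inter (fun _ => ⊤) = F := by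
  funext v ξ α β
  simp [inter]

theorem HasIntegralWeights.grDim_inter {F : M.Filtrations} {ζ : ℂ} (h : M.HasIntegralWeights F v ζ)
    (S : ∀ v, Submodule (LocalField v) (M.Compl v)) {n : ℤ} {β : ℝ} (hβ : β ≠ n) :
    M.grDim (F.inter S) v ζ n β = 0 := by
  refine grd_eq_zero_of_ne (U := (S v).restrictScalars ℂ ⊓ M.psi v ζ n) (b := n) (fun β hβ => ?_)
    (fun β hβ => ?_) hβ
  · rw [Filtrations.inter, (h n β).1 hβ]
  · rw [Filtrations.inter, (h n β).2 hβ, inf_bot_eq]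

/-- Multiplication by t^s is injective, maps the steps onto the shifted steps and preserves S, which
is a subspace over the Laurent series. -/
theorem IsParabolicAt.grDim_inter {F : M.Filtrations} {ζ : ℂ} (hF : M.IsParabolicAt F v ζ)
    (S : ∀ v, Submodule (LocalField v) (M.Compl v)) (s : ℤ) (α : ℂ) (β : ℝ) :
    M.grDim (F.inter S) v ζ (α + s) (β + s) = M.grDim (F.inter S) v ζ α β := by
  have ht := zpow_ne_zero s (t_ne_zero v)
  have h1 : (fun γ => F.inter S v ζ (α + s) (γ + s))
      = fun γ => (F.inter S v ζ α γ).map (Algebra.lsmul ℂ ℂ (M.Compl v) (t v ^ s)) := by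
    funext γ
    ext w
    constructor
    · rintro ⟨hw1, hw2⟩
      have e : t v ^ s • (t v ^ s)⁻¹ • w = w := smul_inv_smul₀ ht w
      exact ⟨(t v ^ s)⁻¹ • w, ⟨(S v).smul_mem _ hw1, (hF.2.2.2.2 α γ s _).2 (by rwa [e])⟩, e⟩
    · rintro ⟨w, ⟨hw1, hw2⟩, rfl⟩
      exact ⟨(S v).smul_mem _ hw1, (hF.2.2.2.2 α γ s _).1 hw2⟩
  rw [grDim_eq_grd, ← grd_add, h1, grd_map _ (U := ⊤) _ (fun _ => le_top)]
  · rfl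
  · intro x _ y _ h
    exact (smul_right_injective _ ht) h

namespace Phase

variable {L : M.Sub} {A : WeylModule.{u}} {hat : L.toWeyl → A} {ζ : ℂ}
    {v' : Place} {ζ' : ℂ} {s : ℤ} (ph : Phase L A hat v ζ v' ζ' s) {F : M.Filtrations}
    {F' : A.Filtrations} {S : ∀ v, Submodule (LocalField v) (M.Compl v)}
    {S' : ∀ v, Submodule (LocalField v) (A.Compl v)}

/-- `Φ` identifies the pair (α, β) of the source with (α + s, β + s) of the target; multiplication
by t^s in the source then returns to the same pair on both sides. -/
theorem grDim_inter_eq (hF : M.IsParabolicAt F v ζ) {α : ℂ} (hα : ∀ n : ℤ, α ≠ n)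
    (hF' : ∀ β, F' v' ζ' (α + s) (β + s) = (F v ζ α β).map ph.Φ)
    (hS : ∀ w ∈ M.psi v ζ α, w ∈ S v ↔ ph.Φ w ∈ S' v') (β : ℝ) :
    A.grDim (F'.inter S') v' ζ' (α + s) (β + s) = M.grDim (F.inter S) v ζ (α + s) (β + s) := by
  have h1 : (fun γ => F'.inter S' v' ζ' (α + s) (γ + s))
      = fun γ => (F.inter S v ζ α γ).map ph.Φ := by
    funext γ
    ext w
    rw [Filtrations.inter, hF']
    constructor
    · rintro ⟨hw1, w, hw2, rfl⟩
      exact ⟨w, ⟨(hS w (hF.1 _ _ hw2)).2 hw1, hw2⟩, rfl⟩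
    · rintro ⟨w, ⟨hw1, hw2⟩, rfl⟩
      exact ⟨(hS w (hF.1 _ _ hw2)).1 hw1, w, hw2, rfl⟩
  rw [hF.grDim_inter, grDim_eq_grd, ← grd_add, h1, grd_map _ (U := M.psi v ζ α)
    (G := F.inter S v ζ α)
    (fun x hx y hy h => ph.Φ_injOn hα hx hy h) (fun γ => inf_le_right.trans (hF.1 α γ))]
  rfl

/-- For an integral eigenvalue n both sides vanish unless β = n, and a weight in [0, 1) that is an
integer is 0. -/
theorem grDim_inter_eq_or (hF : M.IsParabolicAt F v ζ) (hwt : M.HasIntegralWeights F v ζ)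
    (hwt' : A.HasIntegralWeights F' v' ζ')
    (hF' : ∀ α : ℂ, (∀ n : ℤ, α ≠ n) → ∀ β, F' v' ζ' (α + s) (β + s) = (F v ζ α β).map ph.Φ)
    (hS : ∀ α : ℂ, (∀ n : ℤ, α ≠ n) → ∀ w ∈ M.psi v ζ α, w ∈ S v ↔ ph.Φ w ∈ S' v') (α : ℂ) (β : ℝ)
    (hβ : β ∈ Set.Ico (0 : ℝ) 1) :
    A.grDim (F'.inter S') v' ζ' α β = M.grDim (F.inter S) v ζ α β ∨ α = 0 ∧ β = 0 := by
  by_cases h : ∃ n : ℤ, α = n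
  · obtain ⟨n, rfl⟩ := h
    by_cases hn : β = n
    · right
      have h0 : n = 0 := by
        have h1 : (0 : ℝ) ≤ n := hn ▸ hβ.1
        have h2 : (n : ℝ) < 1 := hn ▸ hβ.2
        have h3 : 0 ≤ n := by exact_mod_cast h1
        have h4 : n < 1 := by exact_mod_cast h2
        omega
      subst h0
      exact ⟨Int.cast_zero, by rw [hn, Int.cast_zero]⟩
    · left
      rw [hwt'.grDim_inter _ hn, hwt.grDim_inter _ hn]
  · left
    push Not at h
    have hα : ∀ n : ℤ, α - s ≠ n := fun n hn => h (n + s) (by push_cast; rw [← hn]; ring)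
    have := ph.grDim_inter_eq hF hα (hF' _ hα) (hS _ hα) (β - s)
    rwa [sub_add_cancel, sub_add_cancel] at this

end Phase

/-- The parabolic degrees of two modules with corresponding local contributions. -/
theorem parDegree_eq_of_local {A : WeylModule.{u}} {F : M.Filtrations} {F' : A.Filtrations}
    (hP : ∀ p ∈ P, ∀ α, ∀ β ∈ Set.Ico (0 : ℝ) 1,
      A.grDim F' .infty (-p) α β = M.grDim F (.fin p) 0 α β ∨ α = 0 ∧ β = 0)
    (hQ : ∀ η ∈ Q, ∀ α, ∀ β ∈ Set.Ico (0 : ℝ) 1,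
      A.grDim F' (.fin η) 0 α β = M.grDim F .infty η α β ∨ α = 0 ∧ β = 0)
    (hP' : ∀ ξ, -ξ ∉ P → ∀ α β, F' .infty ξ α β = ⊥)
    (hQ' : ∀ ξ, ξ ∉ Q → ∀ α β, F .infty ξ α β = ⊥) :
    A.parDegree Q F' = M.parDegree P F := by
  rw [parDegree_eq, parDegree_eq]
  have e1 : ∑ᶠ ξ : ℂ, M.locDeg F .infty ξ = ∑ η ∈ Q, A.locDeg F' (.fin η) 0 := by
    rw [finsum_eq_sum_of_support_subset (s := Q)]
    · exact Finset.sum_congr rfl fun η hη => (locDeg_congr (hQ η hη)).symm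
    · intro ξ hξ
      by_contra h
      exact hξ (locDeg_eq_zero (hQ' ξ h))
  have e2 : ∑ᶠ ξ : ℂ, A.locDeg F' .infty ξ = ∑ p ∈ P, M.locDeg F (.fin p) 0 := by
    rw [← finsum_comp_equiv (Equiv.neg ℂ), finsum_eq_sum_of_support_subset (s := P)]
    · exact Finset.sum_congr rfl fun p hp => locDeg_congr (hP p hp)
    · intro ξ hξ
      by_contra h
      exact hξ (locDeg_eq_zero (hP' (-ξ) (by rwa [neg_neg])))
  have e3 : ∑ᶠ ξ : ℂ, M.locWeight F .infty ξ = ∑ η ∈ Q, A.locWeight F' (.fin η) 0 := by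
    rw [finsum_eq_sum_of_support_subset (s := Q)]
    · exact Finset.sum_congr rfl fun η hη => (locWeight_congr (hQ η hη)).symm
    · intro ξ hξ
      by_contra h
      exact hξ (locWeight_eq_zero (hQ' ξ h))
  have e4 : ∑ᶠ ξ : ℂ, A.locWeight F' .infty ξ = ∑ p ∈ P, M.locWeight F (.fin p) 0 := by
    rw [← finsum_comp_equiv (Equiv.neg ℂ), finsum_eq_sum_of_support_subset (s := P)]
    · exact Finset.sum_congr rfl fun p hp => locWeight_congr (hP p hp)
    · intro ξ hξ
      by_contra h
      exact hξ (locWeight_eq_zero (hP' (-ξ) (by rwa [neg_neg])))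
  rw [e1, e2, e3, e4, add_comm (∑ η ∈ Q, A.locDeg F' (.fin η) 0),
    add_comm (∑ η ∈ Q, A.locWeight F' (.fin η) 0)]

namespace Sub

variable (N : M.Sub)

theorem complMap_tmul (v : Place) (g : LocalField v) (m : N.toWeyl) :
    N.complMap v (g ⊗ₜ m) = g ⊗ₜ[ℂ[X]] N.incl m := rfl

theorem complMap_injective (v : Place) : Function.Injective (N.complMap v) := by
  have h : Function.Injective N.incl := Subtype.val_injective
  exact Module.Flat.lTensor_preserves_injective_linearMap (M := LocalField v) N.incl h

theorem complMap_smul (v : Place) (g : LocalField v) (z : N.toWeyl.Compl v) :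
    N.complMap v (g • z) = g • N.complMap v z := map_smul (N.incl.baseChange (LocalField v)) g z

theorem complMap_conn (v : Place) (z : N.toWeyl.Compl v) :
    N.complMap v (N.toWeyl.conn v z) = M.conn v (N.complMap v z) := by
  induction z using TensorProduct.induction_on with
  | zero => simp
  | add a b ha hb => rw [map_add, map_add, map_add, map_add, ha, hb]
  | tmul g m => rw [conn_tmul, map_add, complMap_tmul, complMap_tmul, complMap_tmul, conn_tmul]; rfl

theorem complMap_eulerOp (v : Place) (ξ : ℂ) (z : N.toWeyl.Compl v) :
    N.complMap v (N.toWeyl.eulerOp v ξ z) = M.eulerOp v ξ (N.complMap v z) := by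
  change N.complMap v (eulerCoeff v • (N.toWeyl.conn v z - ξ • z))
    = eulerCoeff v • (M.conn v (N.complMap v z) - ξ • N.complMap v z)
  rw [complMap_smul, map_sub, complMap_conn, map_smul]

theorem psi_eq_comap (v : Place) (ξ α : ℂ) :
    N.toWeyl.psi v ξ α = (M.psi v ξ α).comap (N.complMap v) := by
  ext z
  rw [Submodule.mem_comap, psi, psi, Module.End.mem_maxGenEigenspace,
    Module.End.mem_maxGenEigenspace]
  refine exists_congr fun k => ?_
  have : ∀ k : ℕ, N.complMap v (((N.toWeyl.eulerOp v ξ - α • 1) ^ k) z)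
      = ((M.eulerOp v ξ - α • 1) ^ k) (N.complMap v z) := by
    intro k
    induction k with
    | zero => rfl
    | succ k ih =>
      rw [pow_succ', pow_succ', Module.End.mul_apply, Module.End.mul_apply, ← ih,
        LinearMap.sub_apply, LinearMap.sub_apply, map_sub, complMap_eulerOp]
      simp
  rw [← this, map_eq_zero_iff _ (N.complMap_injective v)]

theorem range_complMap (v : Place) :
    LinearMap.range (N.complMap v) = (complSpan v N.toSubmodule).restrictScalars ℂ := by
  refine le_antisymm ?_ ?_
  · rintro _ ⟨z, rfl⟩
    change N.complMap v z ∈ complSpan v N.toSubmodule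
    induction z using TensorProduct.induction_on with
    | zero => rw [map_zero]; exact Submodule.zero_mem _
    | add a b ha hb => rw [map_add]; exact Submodule.add_mem _ ha hb
    | tmul g m =>
      rw [complMap_tmul, tmul_eq_smul]
      exact Submodule.smul_mem _ _ (one_tmul_mem_complSpan (N.incl_mem m))
  · intro z hz
    change z ∈ LinearMap.range (N.incl.baseChange (LocalField v))
    have hle : complSpan v N.toSubmodule ≤ LinearMap.range (N.incl.baseChange (LocalField v)) := by
      refine Submodule.span_le.2 ?_
      rintro _ ⟨m, hm, rfl⟩
      obtain ⟨m, rfl⟩ := exists_incl_eq hm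
      exact ⟨1 ⊗ₜ m, rfl⟩
    exact hle hz

/-- By flatness the completion of N embeds into that of M, and its ψ is the trace of the ambient
one. So the induced filtration is F intersected with the span of N, and subbundles can be compared
inside the completions of M. -/
theorem grDim_induced {F : M.Filtrations} {v : Place} {ζ α : ℂ} (hF : ∀ β, F v ζ α β ≤ M.psi v ζ α)
    (β : ℝ) : N.toWeyl.grDim (N.induced F) v ζ α β
      = M.grDim (F.inter fun v => complSpan v N.toSubmodule) v ζ α β := by
  have h1 : F.inter (fun v => complSpan v N.toSubmodule) v ζ α
      = fun γ => (N.induced F v ζ α γ).map (N.complMap v) := by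
    funext γ
    have : N.induced F v ζ α γ = (F v ζ α γ).comap (N.complMap v) := by
      rw [induced, psi_eq_comap]
      exact inf_eq_right.2 (Submodule.comap_mono (hF γ))
    rw [this, Submodule.map_comap_eq, range_complMap]
    rfl
  rw [grDim_eq_grd, grDim_eq_grd, h1, grd_map _ (U := ⊤) _ (fun _ => le_top)]
  exact fun x _ y _ h => N.complMap_injective v h

/-- The parabolic degree of a submodule with the induced filtrations. -/
theorem parDegree_induced {F : M.Filtrations} (hP : ∀ p ∈ P, ∀ α β, F (.fin p) 0 α β ≤ M.psi (.fin p) 0 α)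
    (hI : ∀ ξ α β, F .infty ξ α β ≤ M.psi .infty ξ α) :
    N.toWeyl.parDegree P (N.induced F)
      = M.parDegree P (F.inter fun v => complSpan v N.toSubmodule) := by
  rw [parDegree_eq, parDegree_eq,
    Finset.sum_congr rfl fun p hp => locDeg_congr fun α β _ => .inl (N.grDim_induced (hP p hp α) β),
    Finset.sum_congr rfl fun p hp =>
      locWeight_congr fun α β _ => .inl (N.grDim_induced (hP p hp α) β),
    finsum_congr fun ξ => locDeg_congr fun α β _ => .inl (N.grDim_induced (hI ξ α) β),
    finsum_congr fun ξ => locWeight_congr fun α β _ => .inl (N.grDim_induced (hI ξ α) β)]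

end Sub

end WeylModule

/-! ### Singularities of the minimal Laplace transform. -/

namespace WeylModule

open LocalField

variable {M : WeylModule.{u}} {v : Place} {P Q : Finset ℂ}

theorem Frame.psi_eq_bot (fr : M.Frame v) {ζ α : ℂ} (hζ : v.Adm ζ)
    (h : ∀ j (n : ℤ), fr.fac j = ζ → n + fr.exp j ≠ α) : M.psi v ζ α = ⊥ := by
  rw [eq_bot_iff]
  intro z hz
  exact fr.psi_ext hζ hz (Submodule.zero_mem _) fun j n hj hn => absurd hn (h j n hj)

section Lattices

theorem Frame.hasLogLattice {p : ℂ} (fr : M.Frame (.fin p))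
    (h₁ : ∀ k, fr.exp k = 0 ∨ ∀ n : ℤ, (fr.exp k).re ≠ n)
    (h₂ : ∀ k m, ∀ n : ℤ, fr.exp k - fr.exp m = n → n = 0) : M.HasLogLattice p := by
  let e := Fintype.equivFin fr.ι
  refine ⟨_, fr.basis.reindex e, fun j => fr.exp (e.symm j), 0, fun j => ?_, fun k => h₁ _,
    fun k m => h₂ _ _⟩
  rw [Module.Basis.reindex_apply, fr.conn_basis, fr.fac_fin p rfl]
  simp only [Matrix.zero_apply, map_zero, zero_smul, Finset.sum_const_zero, add_zero, zero_add,
    eulerCoeff]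
  rw [mul_smul, algebraMap_smul_compl]

theorem Frame.hasRankOneLattice (fr : M.Frame .infty) (h₁ : ∀ k, ∀ n : ℤ, (fr.exp k).re ≠ n)
    (h₂ : ∀ k m, fr.fac k = fr.fac m → ∀ n : ℤ, fr.exp k - fr.exp m = n → n = 0) :
    ∃ Q', M.HasRankOneLattice Q' := by
  let e := Fintype.equivFin fr.ι
  refine ⟨_, _, fr.basis.reindex e, fun j => fr.fac (e.symm j), fun j => -fr.exp (e.symm j), 0,
    fun j => ?_, fun k n h => h₁ (e.symm k) (-n) ?_, fun k m h n hn => ?_, rfl⟩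
  · rw [Module.Basis.reindex_apply, fr.conn_basis]
    simp only [Matrix.zero_apply, map_zero, mul_zero, zero_smul, Finset.sum_const_zero, add_zero,
      eulerCoeff]
    rw [add_smul, algebraMap_smul_compl, mul_smul, algebraMap_smul_compl, inv_neg, inv_inv,
      neg_smul, neg_smul, smul_neg]
  · rw [Complex.neg_re] at h
    push_cast; linarith
  · have := h₂ _ _ h (-n) (by push_cast; linear_combination -hn)
    omega

end Lattices

section MinimalLaplace

variable (fr : ∀ p : P, M.Frame (.fin p)) (fi : M.Frame .infty)

theorem exists_frame_minLaplace_infty (hM : IsMeromorphicBundle P M)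
    (hfr : ∀ p j, (fr p).exp j = 0 ∨ ∀ n : ℤ, ((fr p).exp j).re ≠ n)
    (hfi : ∀ j, ∀ n : ℤ, (fi.exp j).re ≠ n) (hQ : ∀ ξ, ξ ∈ Q ↔ ∃ j, fi.fac j = ξ) :
    ∃ (f : ((minExt fr).minLaplace Q).Frame .infty)
      (e : (Σ p : P, {j : (fr p).ι // (fr p).exp j ≠ 0}) ≃ f.ι),
      (∀ i, f.fac (e i) = -i.1) ∧ (∀ i, f.exp (e i) = (fr i.1).exp i.2 + 1) ∧
      ∀ m i n, f.cf (1 ⊗ₜ (minExt fr).toMinLaplace Q m) (e i) n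
        = gammaFin ((fr i.1).exp i.2) n * (fr i.1).cf (1 ⊗ₜ (minExt fr).incl m) i.2 n := by
  obtain ⟨f, e, h1, h2, h3⟩ := (laplaceExpansions hM fr hfr fi hfi hQ).exists_frame_infty
  exact ⟨f, e, h1, h2, fun m i n => congrArg (fun g => coeff g n) (h3 _ i)⟩

theorem exists_frame_minLaplace_fin (hM : IsMeromorphicBundle P M)
    (hfr : ∀ p j, (fr p).exp j = 0 ∨ ∀ n : ℤ, ((fr p).exp j).re ≠ n)
    (hfi : ∀ j, ∀ n : ℤ, (fi.exp j).re ≠ n) (hQ : ∀ ξ, ξ ∈ Q ↔ ∃ j, fi.fac j = ξ) {η : ℂ}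
    (hη : η ∈ Q) :
    ∃ (f : ((minExt fr).minLaplace Q).Frame (.fin η)) (d : ℕ)
      (e : Fin d ⊕ {j : fi.ι // fi.fac j = η} ≃ f.ι),
      (∀ i, f.exp (e (.inl i)) = 0) ∧ (∀ j, f.exp (e (.inr j)) = fi.exp j - 1) ∧
      ∀ m j n, f.cf (1 ⊗ₜ (minExt fr).toMinLaplace Q m) (e (.inr j)) n
        = gammaInfty (fi.exp j) n * fi.cf (1 ⊗ₜ (minExt fr).incl m) j n := by
  obtain ⟨f, d, e, h1, h2, h3⟩ := (laplaceExpansions hM fr hfr fi hfi hQ).exists_frame_fin hη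
  exact ⟨f, d, e, h1, h2, fun m j n => congrArg (fun g => coeff g n) (h3 _ j)⟩

theorem gammaFin_shift {α : ℂ} (hα : ∀ n : ℤ, α ≠ n) (N : ℤ) : ∃ c : ℂ, c ≠ 0 ∧
    ∀ (μ : ℂ) (n : ℤ), n + μ = α → gammaFin μ (n + N) = c * gammaFin μ n := by
  have h := gammaFin_ne_zero hα 0
  refine ⟨gammaFin α N * (gammaFin α 0)⁻¹, mul_ne_zero (gammaFin_ne_zero hα N) (inv_ne_zero h),
    fun μ n hn => ?_⟩
  have h1 : gammaFin μ (n + N) = gammaFin α N := by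
    rw [gammaFin, gammaFin, ← hn]; push_cast; ring_nf
  have h2 : gammaFin μ n = gammaFin α 0 := by
    rw [gammaFin, gammaFin, ← hn]; push_cast; ring_nf
  rw [h1, h2, inv_mul_cancel_right₀ h]

/-- Apart from the sign (-1)^n, the factor depends only on the eigenvalue n + μ, and the sign
cancels in the ratio. -/
theorem gammaInfty_shift {α : ℂ} (hα : ∀ n : ℤ, α ≠ n) (N : ℤ) : ∃ c : ℂ, c ≠ 0 ∧
    ∀ (μ : ℂ) (n : ℤ), n + μ = α → gammaInfty μ (n + N) = c * gammaInfty μ n := by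
  have h := gammaInfty_ne_zero hα 0
  refine ⟨gammaInfty α N * (gammaInfty α 0)⁻¹,
    mul_ne_zero (gammaInfty_ne_zero hα N) (inv_ne_zero h), fun μ n hn => ?_⟩
  have h1 : gammaInfty μ (n + N) = (-1) ^ n * gammaInfty α N := by
    rw [gammaInfty, gammaInfty, ← hn, zpow_add₀ (by norm_num), mul_assoc]
    push_cast
    rw [← add_assoc, add_comm μ]
  have h2 : gammaInfty μ n = (-1) ^ n * gammaInfty α 0 := by
    rw [gammaInfty, gammaInfty, ← hn, zpow_zero, one_mul, Int.cast_zero, add_zero, add_comm μ]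
  rw [h1, h2]
  field_simp

theorem exists_phase_infty (hM : IsMeromorphicBundle P M)
    (hfr : ∀ p j, (fr p).exp j = 0 ∨ ∀ n : ℤ, ((fr p).exp j).re ≠ n)
    (hfi : ∀ j, ∀ n : ℤ, (fi.exp j).re ≠ n) (hQ : ∀ ξ, ξ ∈ Q ↔ ∃ j, fi.fac j = ξ) (p : P) :
    Nonempty (Phase (minExt fr) ((minExt fr).minLaplace Q) ((minExt fr).toMinLaplace Q)
      (.fin p) 0 .infty (-p) 1) := by
  classical
  obtain ⟨f, e, h1, h2, h3⟩ := exists_frame_minLaplace_infty fr fi hM hfr hfi hQ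
  refine ⟨{ fr := fr p, fr' := f, adm := Place.adm_fin p, adm' := Place.adm_infty _
            J := {j : (fr p).ι // (fr p).exp j ≠ 0}
            k := Subtype.val, e := fun j => e ⟨p, j⟩, k_inj := Subtype.val_injective
            e_inj := fun j j' h => ?_, k_fac := fun j => (fr p).fac_fin p rfl _
            e_fac := fun j => h1 _, exp_e := fun j => ?_, k_surj := fun j _ hj => ?_
            e_surj := fun j hj _ => ?_, gam := fun j => gammaFin ((fr p).exp j)
            gam_ne := fun j => ?_, gam_shift := fun α hα N => ?_
            cf_hat := fun m j n => h3 m ⟨p, j⟩ n }⟩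
  · simpa using e.injective h
  · rw [h2, Int.cast_one]
  · exact ⟨⟨j, by simpa using hj 0⟩, rfl⟩
  · obtain ⟨⟨p', j⟩, rfl⟩ := e.surjective j
    rw [h1, neg_inj] at hj
    obtain rfl : p' = p := Subtype.ext hj
    exact ⟨j, rfl⟩
  · exact gammaFin_ne_zero (ne_intCast_of_re ((hfr p j).resolve_left j.2))
  · obtain ⟨c, hc, h⟩ := gammaFin_shift hα N
    exact ⟨c, hc, fun j n hn => h _ n hn⟩

/-- The horizontal vectors of the frame at η are not reached by the expansions; this is harmless
because their exponent 0 is integral. -/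
theorem exists_phase_fin (hM : IsMeromorphicBundle P M)
    (hfr : ∀ p j, (fr p).exp j = 0 ∨ ∀ n : ℤ, ((fr p).exp j).re ≠ n)
    (hfi : ∀ j, ∀ n : ℤ, (fi.exp j).re ≠ n) (hQ : ∀ ξ, ξ ∈ Q ↔ ∃ j, fi.fac j = ξ) {η : ℂ}
    (hη : η ∈ Q) :
    Nonempty (Phase (minExt fr) ((minExt fr).minLaplace Q) ((minExt fr).toMinLaplace Q)
      .infty η (.fin η) 0 (-1)) := by
  classical
  obtain ⟨f, d, e, h1, h2, h3⟩ := exists_frame_minLaplace_fin fr fi hM hfr hfi hQ hη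
  refine ⟨{ fr := fi, fr' := f, adm := Place.adm_infty _, adm' := Place.adm_fin η
            J := {j : fi.ι // fi.fac j = η}
            k := Subtype.val, e := fun j => e (.inr j), k_inj := Subtype.val_injective
            e_inj := fun j j' h => ?_, k_fac := fun j => j.2
            e_fac := fun j => f.fac_fin η rfl _, exp_e := fun j => ?_
            k_surj := fun j hj _ => ⟨⟨j, hj⟩, rfl⟩
            e_surj := fun j _ hj => ?_, gam := fun j => gammaInfty (fi.exp j)
            gam_ne := fun j => gammaInfty_ne_zero (ne_intCast_of_re (hfi j))
            gam_shift := fun α hα N => ?_, cf_hat := h3 }⟩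
  · simpa using e.injective h
  · rw [h2]; push_cast; ring
  · obtain ⟨i | i, rfl⟩ := e.surjective j
    · exact absurd (h1 i) (by simpa using hj 0)
    · exact ⟨i, rfl⟩
  · obtain ⟨c, hc, h⟩ := gammaInfty_shift hα N
    exact ⟨c, hc, fun j n hn => h _ n hn⟩

theorem hasLogLattice_minLaplace (hM : IsMeromorphicBundle P M)
    (hfr : ∀ p j, (fr p).exp j = 0 ∨ ∀ n : ℤ, ((fr p).exp j).re ≠ n)
    (hfi : ∀ j, ∀ n : ℤ, (fi.exp j).re ≠ n)
    (hfi' : ∀ k m, fi.fac k = fi.fac m → ∀ n : ℤ, fi.exp k - fi.exp m = n → n = 0)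
    (hQ : ∀ ξ, ξ ∈ Q ↔ ∃ j, fi.fac j = ξ) {η : ℂ} (hη : η ∈ Q) :
    ((minExt fr).minLaplace Q).HasLogLattice η := by
  obtain ⟨f, d, e, h1, h2, -⟩ := exists_frame_minLaplace_fin fr fi hM hfr hfi hQ hη
  have hre : ∀ (j : {j : fi.ι // fi.fac j = η}) (n : ℤ), (f.exp (e (.inr j))).re ≠ n := fun j n h =>
    hfi j (n + 1) (by
      rw [h2, Complex.sub_re, Complex.one_re] at h
      push_cast; linarith)
  refine f.hasLogLattice (fun k => ?_) fun k m n h => ?_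
  · obtain ⟨i | j, rfl⟩ := e.surjective k
    · exact .inl (h1 i)
    · exact .inr (hre j)
  · obtain ⟨i | j, rfl⟩ := e.surjective k <;> obtain ⟨i' | j', rfl⟩ := e.surjective m
    · rw [h1, h1, sub_zero] at h
      exact_mod_cast h.symm
    · rw [h1, zero_sub] at h
      refine absurd ?_ (hre j' (-n))
      rw [← neg_neg (f.exp _), h, Complex.neg_re, Complex.intCast_re]; push_cast; rfl
    · rw [h1, sub_zero] at h
      exact absurd (by rw [h, Complex.intCast_re]) (hre j n)
    · rw [h2, h2] at h
      exact hfi' j j' (j.2.trans j'.2.symm) n (by rw [← h]; ring)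

theorem hasRankOneLattice_minLaplace (hM : IsMeromorphicBundle P M)
    (hfr : ∀ p j, (fr p).exp j = 0 ∨ ∀ n : ℤ, ((fr p).exp j).re ≠ n)
    (hfr' : ∀ p k m, ∀ n : ℤ, (fr p).exp k - (fr p).exp m = n → n = 0)
    (hfi : ∀ j, ∀ n : ℤ, (fi.exp j).re ≠ n) (hQ : ∀ ξ, ξ ∈ Q ↔ ∃ j, fi.fac j = ξ) :
    ∃ Q', ((minExt fr).minLaplace Q).HasRankOneLattice Q' := by
  obtain ⟨f, e, h1, h2, -⟩ := exists_frame_minLaplace_infty fr fi hM hfr hfi hQ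
  refine f.hasRankOneLattice (fun k n h => ?_) fun k m hkm n h => ?_
  · obtain ⟨i, rfl⟩ := e.surjective k
    rw [h2, Complex.add_re, Complex.one_re] at h
    exact (hfr i.1 i.2).resolve_left i.2.2 (n - 1) (by push_cast; linarith)
  · obtain ⟨⟨p, j⟩, rfl⟩ := e.surjective k
    obtain ⟨⟨p', j'⟩, rfl⟩ := e.surjective m
    rw [h1, h1, neg_inj] at hkm
    obtain rfl : p = p' := Subtype.ext hkm
    rw [h2, h2] at h
    exact hfr' p j j' n (by rw [← h]; ring)

theorem psi_minLaplace_infty_eq_bot (hM : IsMeromorphicBundle P M)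
    (hfr : ∀ p j, (fr p).exp j = 0 ∨ ∀ n : ℤ, ((fr p).exp j).re ≠ n)
    (hfi : ∀ j, ∀ n : ℤ, (fi.exp j).re ≠ n) (hQ : ∀ ξ, ξ ∈ Q ↔ ∃ j, fi.fac j = ξ) {ξ : ℂ}
    (hξ : -ξ ∉ P) (α : ℂ) : ((minExt fr).minLaplace Q).psi .infty ξ α = ⊥ := by
  obtain ⟨f, e, h1, -⟩ := exists_frame_minLaplace_infty fr fi hM hfr hfi hQ
  refine f.psi_eq_bot (Place.adm_infty _) fun j n hj => ?_
  obtain ⟨i, rfl⟩ := e.surjective j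
  rw [h1] at hj
  exact absurd i.1.2 (by rwa [← hj, neg_neg] at hξ)

/-- A non-zero bundle has a frame vector at infinity. Its factor η belongs to Q and gives a basis
vector of the completion of the transform at η. -/
theorem nontrivial_minLaplace [Nontrivial M] (hM : IsMeromorphicBundle P M)
    (hfr : ∀ p j, (fr p).exp j = 0 ∨ ∀ n : ℤ, ((fr p).exp j).re ≠ n)
    (hfi : ∀ j, ∀ n : ℤ, (fi.exp j).re ≠ n) (hQ : ∀ ξ, ξ ∈ Q ↔ ∃ j, fi.fac j = ξ) :
    Nontrivial ((minExt fr).minLaplace Q) := by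
  have hne : Nonempty fi.ι := by
    by_contra h
    rw [not_nonempty_iff] at h
    have hsub : Subsingleton (M.Compl .infty) := ⟨fun a b => fi.basis.ext_elem fun i => h.elim i⟩
    obtain ⟨r, w, hw, hb⟩ := hM.exists_sections
    obtain ⟨b, -⟩ := hb .infty
    have hr : IsEmpty (Fin r) := ⟨fun i => b.ne_zero i (Subsingleton.elim _ _)⟩
    obtain ⟨m, hm⟩ := exists_ne (0 : M)
    obtain ⟨a, h, e⟩ := hw m
    rw [Finset.univ_eq_empty, Finset.sum_empty] at e
    exact hm (hM.smul_eq_zero (pow_ne_zero a (polePoly_ne_zero P)) e)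
  obtain ⟨j⟩ := hne
  obtain ⟨f, d, e, -⟩ := exists_frame_minLaplace_fin fr fi hM hfr hfi hQ ((hQ _).2 ⟨j, rfl⟩)
  by_contra h
  rw [not_nontrivial_iff_subsingleton] at h
  have hz : ∀ z : ((minExt fr).minLaplace Q).Compl (.fin (fi.fac j)), z = 0 := by
    intro z
    induction z using TensorProduct.induction_on with
    | zero => rfl
    | add a b ha hb => rw [ha, hb, add_zero]
    | tmul g m => rw [Subsingleton.elim m 0, TensorProduct.tmul_zero]
  exact f.basis.ne_zero (e (.inr ⟨j, rfl⟩)) (hz _)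

end MinimalLaplace

/-- A non-zero submodule of a meromorphic bundle has positive rank. -/
theorem IsMeromorphicBundle.rank_pos (hM : IsMeromorphicBundle P M) {N : M.Sub}
    (hN : N.toSubmodule ≠ ⊥) : 0 < N.toWeyl.rank := by
  classical
  have htf := hM.isTorsionFree
  obtain ⟨r, w, hw, -⟩ := hM.exists_sections
  let U := Submodule.span ℂ[X] (Set.range w)
  have hU : Module.Finite ℂ[X] U := Module.Finite.iff_fg.2 (Submodule.fg_span (Set.finite_range w))
  have hle : Module.rank ℂ[X] M ≤ Module.finrank ℂ[X] U := by
    refine rank_le fun s hs => ?_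
    choose a h e using hw
    set K := ∑ m ∈ s, a m with hK
    have hmem : ∀ i : s, polePoly P ^ K • (i : M) ∈ U := fun i => by
      obtain ⟨d, hd⟩ := Nat.exists_eq_add_of_le
        (Finset.single_le_sum (f := a) (fun _ _ => Nat.zero_le _) i.2)
      rw [← hK] at hd
      rw [hd, add_comm, pow_add, mul_smul, e]
      exact U.smul_mem _ (Submodule.sum_mem _ fun j _ =>
        U.smul_mem _ (Submodule.subset_span ⟨j, rfl⟩))
    have hli : LinearIndependent ℂ[X] fun i : s => (⟨_, hmem i⟩ : U) := by
      refine LinearIndependent.of_comp U.subtype ?_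
      refine hs.map' (LinearMap.lsmul ℂ[X] M (polePoly P ^ K)) (LinearMap.ker_eq_bot'.2 fun m hm => ?_)
      exact hM.smul_eq_zero (pow_ne_zero K (polePoly_ne_zero P)) hm
    simpa using hli.fintype_card_le_finrank
  -- Finiteness is essential: an infinite rank would be read as 0 by `finrank`.
  have hlt : Module.rank ℂ[X] N.toSubmodule < Cardinal.aleph0 :=
    ((Submodule.rank_le _).trans hle).trans_lt Cardinal.natCast_lt_aleph0
  have hnt : Nontrivial N.toSubmodule := (Submodule.nontrivial_iff_ne_bot).2 hN
  have hpos : 0 < Module.rank ℂ[X] N.toSubmodule := _root_.rank_pos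
  exact Nat.pos_of_ne_zero (Cardinal.toNat_ne_zero.2 ⟨hpos.ne', hlt⟩)

end WeylModule

/-! ### Corresponding submodules, and the filtrations of the transform. -/

namespace WeylModule

open LocalField

variable {M : WeylModule.{u}} {v : Place} {P Q : Finset ℂ}

namespace Sub

theorem toMinLaplace_eq (L : M.Sub) (Q : Finset ℂ) (m : L.toWeyl) : L.toMinLaplace Q m
    = L.toWeyl.laplace.toLocalizeLin (polePoly Q) (L.toWeyl.toLaplace m) := rfl

theorem toMinLaplace_add (L : M.Sub) (Q : Finset ℂ) (m m' : L.toWeyl) :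
    L.toMinLaplace Q (m + m') = L.toMinLaplace Q m + L.toMinLaplace Q m' :=
  map_add (L.toWeyl.laplace.toLocalizeLin (polePoly Q)) _ _

theorem toMinLaplace_zero (L : M.Sub) (Q : Finset ℂ) : L.toMinLaplace Q 0 = 0 :=
  map_zero (L.toWeyl.laplace.toLocalizeLin (polePoly Q))

theorem toMinLaplace_C_smul (L : M.Sub) (Q : Finset ℂ) (c : ℂ) (m : L.toWeyl) :
    L.toMinLaplace Q ((C c : ℂ[X]) • m) = (C c : ℂ[X]) • L.toMinLaplace Q m := by
  have h := laplace_smul L.toWeyl c m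
  rw [complex_smul_def, complex_smul_def] at h
  rw [toMinLaplace_eq, ← h]
  exact map_smul (L.toWeyl.laplace.toLocalizeLin (polePoly Q)) _ _

theorem toMinLaplace_X_smul (L : M.Sub) (Q : Finset ℂ) (m : L.toWeyl) :
    L.toMinLaplace Q ((X : ℂ[X]) • m) = -(L.minLaplace Q).D (L.toMinLaplace Q m) := by
  have h : (L.minLaplace Q).D (L.toMinLaplace Q m) = L.toMinLaplace Q (-((X : ℂ[X]) • m)) :=
    D_toLocalizeLin L.toWeyl.laplace (polePoly Q) (L.toWeyl.toLaplace m)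
  have h' : L.toMinLaplace Q (-((X : ℂ[X]) • m)) = -L.toMinLaplace Q ((X : ℂ[X]) • m) :=
    map_neg (L.toWeyl.laplace.toLocalizeLin (polePoly Q)) _
  rw [h, h', neg_neg]

theorem toMinLaplace_D (L : M.Sub) (Q : Finset ℂ) (m : L.toWeyl) :
    L.toMinLaplace Q (L.toWeyl.D m) = (X : ℂ[X]) • L.toMinLaplace Q m := by
  have h : (X : ℂ[X]) • L.toWeyl.toLaplace m = L.toWeyl.toLaplace (L.toWeyl.D m) := by
    change aeval L.toWeyl.dLin X m = L.toWeyl.D m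
    rw [aeval_X]
    rfl
  rw [toMinLaplace_eq, ← h]
  exact map_smul (L.toWeyl.laplace.toLocalizeLin (polePoly Q)) _ _

/-- The sections of the minimal extension which belong to a given submodule of the minimal Laplace
transform. -/
def pullback (L : M.Sub) (Q : Finset ℂ) (N : (L.minLaplace Q).Sub) : L.toWeyl.Sub where
  toSubmodule :=
    { carrier := {m | L.toMinLaplace Q m ∈ N.toSubmodule}
      add_mem' := fun ha hb => by
        rw [Set.mem_ofPred_eq, toMinLaplace_add]
        exact N.toSubmodule.add_mem ha hb
      zero_mem' := by
        rw [Set.mem_ofPred_eq, toMinLaplace_zero]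
        exact N.toSubmodule.zero_mem
      smul_mem' := fun f m hm => by
        rw [Set.mem_ofPred_eq] at hm ⊢
        induction f using Polynomial.induction_on generalizing m with
        | C a =>
          rw [toMinLaplace_C_smul]
          exact N.toSubmodule.smul_mem _ hm
        | add p q hp hq =>
          rw [add_smul, toMinLaplace_add]
          exact N.toSubmodule.add_mem (hp m hm) (hq m hm)
        | monomial n a ih =>
          rw [pow_succ, ← mul_assoc, mul_smul]
          refine ih _ ?_
          rw [toMinLaplace_X_smul]
          exact N.toSubmodule.neg_mem (N.D_mem _ hm) }
  D_mem := fun m hm => by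
    change L.toMinLaplace Q (L.toWeyl.D m) ∈ N.toSubmodule
    rw [toMinLaplace_D]
    exact N.toSubmodule.smul_mem _ hm

theorem mem_pullback {L : M.Sub} {N : (L.minLaplace Q).Sub} {m : L.toWeyl} :
    m ∈ (L.pullback Q N).toSubmodule ↔ L.toMinLaplace Q m ∈ N.toSubmodule := Iff.rfl

theorem exists_pow_smul_eq_toMinLaplace (L : M.Sub) (z : L.minLaplace Q) :
    ∃ (k : ℕ) (m : L.toWeyl), polePoly Q ^ k • z = L.toMinLaplace Q m :=
  L.toWeyl.laplace.exists_pow_smul_eq (polePoly Q) z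

/-- The elements of a submodule of the minimal Laplace transform which come from the minimal
extension. -/
def sections (L : M.Sub) (N : (L.minLaplace Q).Sub) : (L.minLaplace Q).Sub where
  toSubmodule := N.toSubmodule ⊓
    LinearMap.range (show L.toWeyl.laplace →ₗ[ℂ[X]] L.minLaplace Q from
      L.toWeyl.laplace.toLocalizeLin (polePoly Q))
  D_mem := by
    rintro _ ⟨h, m, rfl⟩
    exact ⟨N.D_mem _ h, _, (D_toLocalizeLin L.toWeyl.laplace (polePoly Q) m).symm⟩

theorem mem_sections {L : M.Sub} {N : (L.minLaplace Q).Sub} {z : L.minLaplace Q} :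
    z ∈ (L.sections N).toSubmodule ↔
      z ∈ N.toSubmodule ∧ ∃ m : L.toWeyl, L.toMinLaplace Q m = z := Iff.rfl

/-- Denominators are invertible in Laurent series, so the elements coming from the minimal extension
span the whole completion of N. -/
theorem complSpan_sections (L : M.Sub) (N : (L.minLaplace Q).Sub) (v : Place) :
    complSpan v (L.sections N).toSubmodule = complSpan v N.toSubmodule := by
  refine le_antisymm (Submodule.span_mono (Set.image_mono fun z hz => (mem_sections.1 hz).1))
    (Submodule.span_le.2 ?_)
  rintro _ ⟨z, hz, rfl⟩
  obtain ⟨k, m, h⟩ := L.exists_pow_smul_eq_toMinLaplace z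
  refine one_tmul_mem_of_smul_mem (pow_ne_zero k (polePoly_ne_zero Q)) (one_tmul_mem_complSpan ?_)
  exact mem_sections.2 ⟨N.toSubmodule.smul_mem _ hz, m, h.symm⟩

theorem complSpan_saturation {f : ℂ[X]} (hf : f ≠ 0) (N : M.Sub) (v : Place) :
    complSpan v (N.saturation f).toSubmodule = complSpan v N.toSubmodule := by
  refine le_antisymm (Submodule.span_le.2 ?_) (Submodule.span_mono (Set.image_mono fun m hm => ?_))
  · rintro _ ⟨m, ⟨k, hk⟩, rfl⟩
    exact one_tmul_mem_of_smul_mem (pow_ne_zero k hf) (one_tmul_mem_complSpan hk)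
  · exact ⟨0, by rwa [pow_zero, one_smul]⟩

end Sub

theorem Frame.exists_component (fr : M.Frame v) {ζ : ℂ} (hζ : v.Adm ζ) (α : ℂ) (m : M) :
    ∃ w, M.IsComponent v ζ α m w := by
  obtain ⟨w, hw, h⟩ := fr.exists_psi_part hζ α (1 ⊗ₜ m)
  exact ⟨w, (fr.isComponent_iff hζ α m w).2 ⟨hw, h⟩⟩

/-- The stationary phase isomorphisms respect the completions of corresponding submodules. -/
theorem Phase.mem_complSpan_iff {L : M.Sub} {ζ : ℂ} {v' : Place} {ζ' : ℂ} {s : ℤ}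
    (ph : Phase L (L.minLaplace Q) (L.toMinLaplace Q) v ζ v' ζ' s) (N : (L.minLaplace Q).Sub)
    {α : ℂ} (hα : ∀ n : ℤ, α ≠ n) {w : M.Compl v} (hw : w ∈ M.psi v ζ α) :
    w ∈ complSpan v (Sub.push (L.pullback Q N)).toSubmodule ↔
      ph.Φ w ∈ complSpan v' N.toSubmodule := by
  constructor
  · intro h
    -- The vector is realized as the component of a section, the section is transformed, and the
    -- component of its image is `Φ w`. The converse goes the same way back, using that `Φ` is
    -- injective.
    obtain ⟨_, ⟨m, hm, rfl⟩, hc⟩ := ph.fr.exists_isComponent ph.adm hα hw h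
    exact ph.fr'.mem_complSpan_of_isComponent ph.adm' (Sub.mem_pullback.1 hm)
      (ph.isComponent_Φ hα hc)
  · intro h
    rw [← L.complSpan_sections N] at h
    have hα' : ∀ n : ℤ, α + s ≠ n := fun n hn => hα (n - s) (by push_cast; linear_combination hn)
    obtain ⟨z, hz, hc⟩ := ph.fr'.exists_isComponent ph.adm' hα' (ph.Φ_mem_psi hw) h
    obtain ⟨hzN, m, rfl⟩ := Sub.mem_sections.1 hz
    obtain ⟨w₀, hw₀⟩ := ph.fr.exists_component ph.adm α (L.incl m)
    obtain rfl : w = w₀ := ph.Φ_injOn hα hw hw₀.1 (ph.phase_eq_Φ hα hw₀ hc)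
    exact ph.fr.mem_complSpan_of_isComponent (N := Sub.push (L.pullback Q N)) ph.adm ⟨m, hzN, rfl⟩ hw₀

section Weights

theorem hasIntegralWeights_laplaceFiltrations (L : M.Sub) (F : M.Filtrations) (v : Place) (ζ : ℂ) :
    (L.minLaplace Q).HasIntegralWeights (L.laplaceFiltrations Q F) v ζ := by
  intro n β
  have hn : ∃ k : ℤ, (n : ℂ) = k := ⟨n, rfl⟩
  cases v with
  | fin η =>
    refine ⟨fun h => ?_, fun h => ?_⟩
    · rw [Sub.laplaceFiltrations, if_pos hn, if_pos (by rwa [Complex.intCast_re])]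
    · rw [Sub.laplaceFiltrations, if_pos hn, if_neg (by rwa [Complex.intCast_re, not_le])]
  | infty =>
    refine ⟨fun h => ?_, fun h => ?_⟩
    · rw [Sub.laplaceFiltrations, if_pos hn, if_pos (by rwa [Complex.intCast_re])]
    · rw [Sub.laplaceFiltrations, if_pos hn, if_neg (by rwa [Complex.intCast_re, not_le])]

/-- Admissibility fixes the filtration for the eigenvalue 0, and multiplication by t^n transports it
to the eigenvalue n. -/
theorem IsParabolicAt.hasIntegralWeights (fr : M.Frame v) {ζ : ℂ} (hζ : v.Adm ζ)
    {F : M.Filtrations} (hF : M.IsParabolicAt F v ζ) (hadm : M.IsAdmissibleAt F v ζ) :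
    M.HasIntegralWeights F v ζ := by
  have h0 : ∀ β ≤ 0, F v ζ 0 β = M.psi v ζ 0 := fun β hβ =>
    le_antisymm (hF.1 _ _) (hadm.1 ▸ hF.2.1 0 hβ)
  have hs : ∀ (n : ℤ) (β : ℝ) (w : M.Compl v), w ∈ F v ζ 0 (β - n) ↔ t v ^ n • w ∈ F v ζ n β := by
    intro n β w
    have := hF.2.2.2.2 0 (β - n) n w
    rwa [zero_add, sub_add_cancel] at this
  have hps : ∀ (n : ℤ) (w : M.Compl v), t v ^ n • w ∈ M.psi v ζ n ↔ w ∈ M.psi v ζ 0 := by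
    intro n w
    have := fr.t_zpow_smul_mem_psi_iff hζ 0 n w
    rwa [zero_add] at this
  have hw : ∀ (n : ℤ) (w : M.Compl v), ∃ w₀, w = t v ^ n • w₀ := fun n w =>
    ⟨(t v ^ n)⁻¹ • w, (smul_inv_smul₀ (zpow_ne_zero _ (t_ne_zero v)) w).symm⟩
  refine fun n β => ⟨fun h => ?_, fun h => ?_⟩
  · ext w
    obtain ⟨w, rfl⟩ := hw n w
    rw [← hs, hps, h0 _ (by linarith)]
  · rw [eq_bot_iff]
    intro w hw'
    obtain ⟨w, rfl⟩ := hw n w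
    rw [← hs, hadm.2 _ (by linarith), Submodule.mem_bot] at hw'
    rw [hw', smul_zero]
    exact Submodule.zero_mem _

theorem hasIntegralWeights_of_psi_eq_bot {F : M.Filtrations} {ζ : ℂ}
    (hF : ∀ α β, F v ζ α β ≤ M.psi v ζ α) (h : ∀ n : ℤ, M.psi v ζ n = ⊥) :
    M.HasIntegralWeights F v ζ := fun n β => by
  have : F v ζ n β = ⊥ := eq_bot_iff.2 (h n ▸ hF n β)
  exact ⟨fun _ => by rw [this, h], fun _ => this⟩

variable {L : M.Sub} {F : M.Filtrations}

theorem laplaceFiltrations_infty {p : ℂ} (hL : complSpan (.fin p) L.toSubmodule = ⊤)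
    (ph : Phase L (L.minLaplace Q) (L.toMinLaplace Q) (.fin p) 0 .infty (-p) 1)
    (hF : ∀ α β, F (.fin p) 0 α β ≤ M.psi (.fin p) 0 α) (α : ℂ) (hα : ∀ n : ℤ, α ≠ n) (β : ℝ) :
    L.laplaceFiltrations Q F .infty (-p) (α + (1 : ℤ)) (β + (1 : ℤ))
      = (F (.fin p) 0 α β).map ph.Φ := by
  have hn : ¬ ∃ n : ℤ, α + (1 : ℤ) = n := fun ⟨n, hn⟩ =>
    hα (n - 1) (by push_cast at hn ⊢; linear_combination hn)
  rw [Sub.laplaceFiltrations, if_neg hn, neg_neg, ← ph.span_phase_eq hL hα (hF α β),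
    Sub.phaseImage, Int.cast_one, Int.cast_one, add_sub_cancel_right, add_sub_cancel_right]

theorem laplaceFiltrations_fin {η : ℂ} (hL : complSpan .infty L.toSubmodule = ⊤)
    (ph : Phase L (L.minLaplace Q) (L.toMinLaplace Q) .infty η (.fin η) 0 (-1))
    (hF : ∀ α β, F .infty η α β ≤ M.psi .infty η α) (α : ℂ) (hα : ∀ n : ℤ, α ≠ n) (β : ℝ) :
    L.laplaceFiltrations Q F (.fin η) 0 (α + (-1 : ℤ)) (β + (-1 : ℤ))
      = (F .infty η α β).map ph.Φ := by
  have hn : ¬ ∃ n : ℤ, α + (-1 : ℤ) = n := fun ⟨n, hn⟩ =>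
    hα (n + 1) (by push_cast at hn ⊢; linear_combination hn)
  rw [Sub.laplaceFiltrations, if_neg hn, ← ph.span_phase_eq hL hα (hF α β),
    Sub.phaseImage, Int.cast_neg, Int.cast_one, Int.cast_neg, Int.cast_one, neg_add_cancel_right,
    neg_add_cancel_right]

theorem laplaceFiltrations_infty_le (ξ : ℂ) (α : ℂ) (β : ℝ) :
    L.laplaceFiltrations Q F .infty ξ α β ≤ (L.minLaplace Q).psi .infty ξ α := by
  rw [Sub.laplaceFiltrations]
  split_ifs
  · exact le_rfl
  · exact bot_le
  · refine Submodule.span_le.2 ?_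
    rintro w ⟨m, w₀, -, -, h⟩
    exact h.1

end Weights

end WeylModule

/-! ### Parabolic degree and stability of the transform. -/

namespace WeylModule

open LocalField

variable {M : WeylModule.{u}} {P Q : Finset ℂ}

section Stability

variable {F : M.Filtrations} (fr : ∀ p : P, M.Frame (.fin p)) (fi : M.Frame .infty)

theorem IsParabolicBundle.psi_infty_eq_bot {ξ : ℂ} (hQ : ∀ ξ, ξ ∈ Q ↔ ∃ j, fi.fac j = ξ)
    (hξ : ξ ∉ Q) (α : ℂ) : M.psi .infty ξ α = ⊥ :=
  fi.psi_eq_bot (Place.adm_infty _) fun j _ hj => absurd ((hQ ξ).2 ⟨j, hj⟩) hξ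

theorem IsParabolicBundle.hasIntegralWeights_infty (hM : M.IsParabolicBundle P Q F)
    (hfi : ∀ j, ∀ n : ℤ, (fi.exp j).re ≠ n) (ξ : ℂ) : M.HasIntegralWeights F .infty ξ :=
  hasIntegralWeights_of_psi_eq_bot (hM.parabolic_infty ξ).1 fun n =>
    fi.psi_eq_bot (Place.adm_infty _) fun j k _ h => ne_intCast_of_re (hfi j) (n - k) (by
      push_cast; linear_combination h)

theorem IsParabolicBundle.minLaplace (hM : M.IsParabolicBundle P Q F)
    (hfr : ∀ p j, (fr p).exp j = 0 ∨ ∀ n : ℤ, ((fr p).exp j).re ≠ n)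
    (hfr' : ∀ p k m, ∀ n : ℤ, (fr p).exp k - (fr p).exp m = n → n = 0)
    (hfi : ∀ j, ∀ n : ℤ, (fi.exp j).re ≠ n)
    (hfi' : ∀ k m, fi.fac k = fi.fac m → ∀ n : ℤ, fi.exp k - fi.exp m = n → n = 0)
    (hQ : ∀ ξ, ξ ∈ Q ↔ ∃ j, fi.fac j = ξ) :
    ∃ Q', ((minExt fr).minLaplace Q).IsParabolicBundle Q Q'
      ((minExt fr).laplaceFiltrations Q F) := by
  have hL := fun v => complSpan_eq_top v (exists_pow_smul_mem_minExt fr)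
  obtain ⟨Q', hQ'⟩ := hasRankOneLattice_minLaplace fr fi hM.bundle hfr hfr' hfi hQ
  have hwt := hasIntegralWeights_laplaceFiltrations (Q := Q) (minExt fr) F
  refine ⟨Q', (laplaceExpansions hM.bundle fr hfr fi hfi hQ).isMeromorphicBundle,
    fun η hη => hasLogLattice_minLaplace fr fi hM.bundle hfr hfi hfi' hQ hη, hQ',
    fun η hη => ?_, fun ξ => ?_, fun η _ => ?_⟩
  · obtain ⟨ph⟩ := exists_phase_fin fr fi hM.bundle hfr hfi hQ hη
    exact ph.isParabolicAt (hM.parabolic_infty η) (hwt _ _)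
      (laplaceFiltrations_fin (hL _) ph (hM.parabolic_infty η).1)
  · by_cases hξ : -ξ ∈ P
    · obtain ⟨p, rfl⟩ : ∃ p, ξ = -p := ⟨-ξ, (neg_neg ξ).symm⟩
      rw [neg_neg] at hξ
      obtain ⟨ph⟩ := exists_phase_infty fr fi hM.bundle hfr hfi hQ ⟨p, hξ⟩
      exact ph.isParabolicAt (hM.parabolic_fin p hξ) (hwt _ _)
        (laplaceFiltrations_infty (hL _) ph (hM.parabolic_fin p hξ).1)
    · have h0 := fun α => psi_minLaplace_infty_eq_bot fr fi hM.bundle hfr hfi hQ hξ α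
      exact isParabolicAt_of_psi_eq_bot h0 fun α β =>
        eq_bot_iff.2 (h0 α ▸ laplaceFiltrations_infty_le ξ α β)
  · have h := hwt (.fin η) 0 0
    rw [Int.cast_zero, Int.cast_zero] at h
    exact ⟨(h 0).1 le_rfl, fun β hβ => (h β).2 hβ⟩

/-- The parabolic degrees of the minimal Laplace transform and of the bundle, with the filtrations
restricted to corresponding subspaces. -/
theorem IsParabolicBundle.parDegree_minLaplace_inter (hM : M.IsParabolicBundle P Q F)
    (hfr : ∀ p j, (fr p).exp j = 0 ∨ ∀ n : ℤ, ((fr p).exp j).re ≠ n)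
    (hfi : ∀ j, ∀ n : ℤ, (fi.exp j).re ≠ n) (hQ : ∀ ξ, ξ ∈ Q ↔ ∃ j, fi.fac j = ξ)
    {S : ∀ v, Submodule (LocalField v) (M.Compl v)}
    {S' : ∀ v, Submodule (LocalField v) (((minExt fr).minLaplace Q).Compl v)}
    (hS : ∀ {v : Place} {ζ : ℂ} {v' : Place} {ζ' : ℂ} {s : ℤ} (ph : Phase (minExt fr)
      ((minExt fr).minLaplace Q) ((minExt fr).toMinLaplace Q) v ζ v' ζ' s) (α : ℂ),
      (∀ n : ℤ, α ≠ n) → ∀ w ∈ M.psi v ζ α, w ∈ S v ↔ ph.Φ w ∈ S' v') :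
    ((minExt fr).minLaplace Q).parDegree Q (((minExt fr).laplaceFiltrations Q F).inter S')
      = M.parDegree P (F.inter S) := by
  have hL := fun v => complSpan_eq_top v (exists_pow_smul_mem_minExt fr)
  have hwt := hasIntegralWeights_laplaceFiltrations (Q := Q) (minExt fr) F
  refine parDegree_eq_of_local (fun p hp => ?_) (fun η hη => ?_) (fun ξ hξ α β => ?_)
    fun ξ hξ α β => ?_
  · obtain ⟨ph⟩ := exists_phase_infty fr fi hM.bundle hfr hfi hQ ⟨p, hp⟩
    exact ph.grDim_inter_eq_or (hM.parabolic_fin p hp)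
      ((hM.parabolic_fin p hp).hasIntegralWeights (fr ⟨p, hp⟩) (Place.adm_fin p)
        (hM.admissible p hp)) (hwt _ _)
      (laplaceFiltrations_infty (hL _) ph (hM.parabolic_fin p hp).1) (hS ph)
  · obtain ⟨ph⟩ := exists_phase_fin fr fi hM.bundle hfr hfi hQ hη
    exact ph.grDim_inter_eq_or (hM.parabolic_infty η) (hM.hasIntegralWeights_infty fi hfi η)
      (hwt _ _) (laplaceFiltrations_fin (hL _) ph (hM.parabolic_infty η).1) (hS ph)
  · rw [eq_bot_iff, ← psi_minLaplace_infty_eq_bot fr fi hM.bundle hfr hfi hQ hξ α]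
    exact inf_le_right.trans (laplaceFiltrations_infty_le ξ α β)
  · rw [eq_bot_iff, ← IsParabolicBundle.psi_infty_eq_bot fi hQ hξ α]
    exact inf_le_right.trans ((hM.parabolic_infty ξ).1 α β)

theorem IsParabolicBundle.parDegree_minLaplace (hM : M.IsParabolicBundle P Q F)
    (hfr : ∀ p j, (fr p).exp j = 0 ∨ ∀ n : ℤ, ((fr p).exp j).re ≠ n)
    (hfi : ∀ j, ∀ n : ℤ, (fi.exp j).re ≠ n) (hQ : ∀ ξ, ξ ∈ Q ↔ ∃ j, fi.fac j = ξ) :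
    ((minExt fr).minLaplace Q).parDegree Q ((minExt fr).laplaceFiltrations Q F)
      = M.parDegree P F := by
  have := hM.parDegree_minLaplace_inter fr fi hfr hfi hQ (S := fun _ => ⊤) (S' := fun _ => ⊤)
    fun ph α _ w _ => iff_of_true Submodule.mem_top Submodule.mem_top
  rwa [Filtrations.inter_top, Filtrations.inter_top] at this

/-- Both slopes to be compared with are 0, so only signs of degrees matter. This is why subbundles
of equal degree suffice although their ranks may differ. -/
theorem IsParabolicBundle.isParStable_minLaplace (hM : M.IsParabolicBundle P Q F)
    (hdeg : M.parDegree P F = 0) (hst : M.IsParStable P F)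
    (hfr : ∀ p j, (fr p).exp j = 0 ∨ ∀ n : ℤ, ((fr p).exp j).re ≠ n)
    (hfr' : ∀ p k m, ∀ n : ℤ, (fr p).exp k - (fr p).exp m = n → n = 0)
    (hfi : ∀ j, ∀ n : ℤ, (fi.exp j).re ≠ n)
    (hfi' : ∀ k m, fi.fac k = fi.fac m → ∀ n : ℤ, fi.exp k - fi.exp m = n → n = 0)
    (hQ : ∀ ξ, ξ ∈ Q ↔ ∃ j, fi.fac j = ξ) :
    ((minExt fr).minLaplace Q).IsParStable Q ((minExt fr).laplaceFiltrations Q F) := by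
  have hnt := hst.1
  obtain ⟨Q', hA⟩ := hM.minLaplace fr fi hfr hfr' hfi hfi' hQ
  refine ⟨nontrivial_minLaplace fr fi hM.bundle hfr hfi hQ, fun N' hN' hbot htop => ?_⟩
  set N := (Sub.push ((minExt fr).pullback Q N')).saturation (polePoly P) with hN
  have hNbot : N.toSubmodule ≠ ⊥ := by
    obtain ⟨z, hz, hz0⟩ := Submodule.exists_mem_ne_zero_of_ne_bot hbot
    obtain ⟨k, m, hkm⟩ := (minExt fr).exists_pow_smul_eq_toMinLaplace z
    have hm : (minExt fr).incl m ∈ N.toSubmodule := ⟨0, by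
      rw [pow_zero, one_smul, Sub.mem_push, Sub.mem_pullback, ← hkm]
      exact N'.toSubmodule.smul_mem _ hz⟩
    intro h
    rw [h, Submodule.mem_bot] at hm
    have hm0 : m = 0 := Subtype.ext hm
    rw [hm0, Sub.toMinLaplace_zero] at hkm
    exact hz0 (hA.bundle.smul_eq_zero (pow_ne_zero k (polePoly_ne_zero Q)) hkm)
  -- If N were M, the pullback would have a quotient in the minimal extension supported on P, so it
  -- would be the whole minimal extension. Then N' would contain the images of all its sections and,
  -- being a subbundle, would be everything.
  have hNtop : N.toSubmodule ≠ ⊤ := by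
    intro h
    have hmin := hM.bundle.isMinimalExtension_minExt fr hfr
    have hall := hmin.2.2.eq_top P ((minExt fr).pullback Q N') fun m => by
      have hm : (minExt fr).incl m ∈ N.toSubmodule := h ▸ Submodule.mem_top
      obtain ⟨k, hk⟩ := Sub.mem_saturation.1 hm
      exact ⟨k, by rwa [← map_smul, Sub.mem_push] at hk⟩
    refine htop (eq_top_iff.2 fun z _ => ?_)
    obtain ⟨k, m, hkm⟩ := (minExt fr).exists_pow_smul_eq_toMinLaplace z
    refine hN'.mem_of_pow (k := k) ?_
    rw [hkm, ← Sub.mem_pullback, hall]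
    exact Submodule.mem_top
  have hlt := hst.2 N (Sub.isSubbundle_saturation _) hNbot hNtop
  have hdegN : N'.toWeyl.parDegree Q (N'.induced ((minExt fr).laplaceFiltrations Q F))
      = N.toWeyl.parDegree P (N.induced F) := by
    rw [N'.parDegree_induced (fun η hη => (hA.parabolic_fin η hη).1)
      (fun ξ => (hA.parabolic_infty ξ).1), N.parDegree_induced (fun p hp => (hM.parabolic_fin p hp).1)
      (fun ξ => (hM.parabolic_infty ξ).1)]
    refine hM.parDegree_minLaplace_inter fr fi hfr hfi hQ fun ph α hα w hw => ?_
    rw [hN, Sub.complSpan_saturation (polePoly_ne_zero P)]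
    exact ph.mem_complSpan_iff N' hα hw
  rw [parSlope, parSlope, hdeg, zero_div] at hlt
  -- A non-negative degree divided by a rank, even by 0, would give a non-negative slope.
  have hneg : N.toWeyl.parDegree P (N.induced F) < 0 := by
    by_contra h
    exact absurd hlt (not_lt.2 (div_nonneg (not_lt.1 h) (Nat.cast_nonneg _)))
  rw [parSlope, parSlope, hM.parDegree_minLaplace fr fi hfr hfi hQ, hdeg, zero_div, hdegN]
  exact div_neg_of_neg_of_pos hneg (Nat.cast_pos.2 (hA.bundle.rank_pos hbot))

end Stability

end WeylModule

end

theorem proposition4p3 (M : WeylModule.{u}) (P Q : Finset ℂ) (F : M.Filtrations)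
    (hM : M.IsParabolicBundle P Q F)
    (hdeg : M.parDegree P F = 0)
    (hst : M.IsParStable P F) :
    (∃! L : M.Sub, L.IsMinimalExtension P) ∧
    ∀ L : M.Sub, L.IsMinimalExtension P →
      (∃ Q' : Finset ℂ, (L.minLaplace Q).IsParabolicBundle Q Q' (L.laplaceFiltrations Q F)) ∧
      (L.minLaplace Q).parDegree Q (L.laplaceFiltrations Q F) = 0 ∧
      (L.minLaplace Q).IsParStable Q (L.laplaceFiltrations Q F) := by
  choose fr hfr hfr' using fun p : P => (hM.logLattice p p.2).exists_frame
  obtain ⟨fi, hfi, hfi', hQ⟩ := hM.rankOneLattice.exists_frame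
  have hmin := hM.bundle.isMinimalExtension_minExt fr hfr
  refine ⟨⟨_, hmin, fun L hL => hL.unique hmin⟩, fun L hL => ?_⟩
  -- By uniqueness, only the explicit model has to be treated.
  obtain rfl := hL.unique hmin
  exact ⟨hM.minLaplace fr fi hfr hfr' hfi hfi' hQ,
    (hM.parDegree_minLaplace fr fi hfr hfi hQ).trans hdeg,
    hM.isParStable_minLaplace fr fi hdeg hst hfr hfr' hfi hfi' hQ⟩
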